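/- A convex body in $\mathbb{R}^n$ is a compact convex set with non-empty interior. For such a set $K$ and $u\in\mathbb{Z}^n\setminus\{0\}$ let $\omega_K(u)=\max_{x,y\in K}\langle u,x-y\rangle$, and let $\omega(K)=\min_{u\in\mathbb{Z}^n\setminus\{0\}}\omega_K(u)$ be the lattice width of $K$. Let $K$ be a convex body in $\mathbb{R}^3$. Then $$\mathrm{Vol}(K)\ \ge\ \frac{1}{12}\,\omega(K)^3 .$$ In addition, if $K=\mathrm{conv}\left\{(0,0,0),\left(1,\tfrac12,\tfrac12\right),\left(\tfrac12,1,\tfrac12\right),\left(\tfrac12,\tfrac12,1\right)\right\}$, then $\mathrm{Vol}(K)=\frac{1}{12}\,\omega(K)^3$. -/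

import Mathlib

open MeasureTheory

/-- The integer vector `u`, seen as a vector of Euclidean space. -/
def intVec {n : ℕ} (u : Fin n → ℤ) : EuclideanSpace ℝ (Fin n) :=
  WithLp.toLp 2 (fun i => (u i : ℝ))

/-- The width of `K` in the direction of the integer vector `u`, the maximum of `⟪u, x - y⟫`
over `x, y ∈ K`. For compact nonempty `K` the supremum is a maximum, see
`widthAlong_isGreatest`. -/
noncomputable def widthAlong {n : ℕ} (K : Set (EuclideanSpace ℝ (Fin n))) (u : Fin n → ℤ) : ℝ :=
  sSup {t : ℝ | ∃ x ∈ K, ∃ y ∈ K, t = inner ℝ (intVec u) (x - y)}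

/-- The lattice width of `K` with respect to `ℤⁿ`, the minimum of the widths of `K` in the
directions of the nonzero integer vectors. For compact `K` with nonempty interior (and `n ≠ 0`)
the infimum is a minimum, see `latticeWidth_isLeast`. -/
noncomputable def latticeWidth {n : ℕ} (K : Set (EuclideanSpace ℝ (Fin n))) : ℝ :=
  sInf (widthAlong K '' {u : Fin n → ℤ | u ≠ 0})

theorem widthAlong_isGreatest {n : ℕ} {K : Set (EuclideanSpace ℝ (Fin n))}
    (hK : IsCompact K) (hne : K.Nonempty) (u : Fin n → ℤ) :
    IsGreatest {t : ℝ | ∃ x ∈ K, ∃ y ∈ K, t = inner ℝ (intVec u) (x - y)} (widthAlong K u) := by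
  have himg : {t : ℝ | ∃ x ∈ K, ∃ y ∈ K, t = inner ℝ (intVec u) (x - y)} =
      (fun p : EuclideanSpace ℝ (Fin n) × EuclideanSpace ℝ (Fin n) =>
        (inner ℝ (intVec u) (p.1 - p.2) : ℝ)) '' (K ×ˢ K) := by
    ext t
    constructor
    · rintro ⟨x, hx, y, hy, rfl⟩
      exact ⟨(x, y), ⟨hx, hy⟩, rfl⟩
    · rintro ⟨⟨x, y⟩, ⟨hx, hy⟩, rfl⟩
      exact ⟨x, hx, y, hy, rfl⟩
  unfold widthAlong
  rw [himg]
  exact ((hK.prod hK).image (by fun_prop)).isGreatest_sSup ((hne.prod hne).image _)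

theorem latticeWidth_isLeast {n : ℕ} [NeZero n] {K : Set (EuclideanSpace ℝ (Fin n))}
    (hK : IsCompact K) (hint : (interior K).Nonempty) :
    IsLeast (widthAlong K '' {u : Fin n → ℤ | u ≠ 0}) (latticeWidth K) := by
  obtain ⟨c, hc⟩ := hint
  have hne : K.Nonempty := ⟨c, interior_subset hc⟩
  obtain ⟨r, hr, hball⟩ := Metric.nhds_basis_closedBall.mem_iff.1 (mem_interior_iff_mem_nhds.1 hc)
  have hcoord : ∀ (u : Fin n → ℤ) (i : Fin n), 2 * r * |(u i : ℝ)| ≤ widthAlong K u := by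
    intro u i
    have hmem : ∀ s : ℝ, |s| = r → c + EuclideanSpace.single i s ∈ K := by
      intro s hs
      apply hball
      simp [hs]
    have h1 : ∀ s : ℝ, |s| = r → 2 * s * (u i : ℝ) ≤ widthAlong K u := by
      intro s hs
      refine (widthAlong_isGreatest hK hne u).2
        ⟨_, hmem s hs, _, hmem (-s) (by rwa [abs_neg]), ?_⟩
      rw [add_sub_add_left_eq_sub, inner_sub_right]
      simp only [EuclideanSpace.inner_single_right, intVec, conj_trivial]
      ring
    rcases abs_cases (u i : ℝ) with h | h
    · rw [h.1]
      exact h1 r (abs_of_pos hr)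
    · rw [h.1]
      have := h1 (-r) (by rw [abs_neg, abs_of_pos hr])
      linarith
  have hu0 : (fun _ => 1 : Fin n → ℤ) ≠ 0 := fun h => one_ne_zero (congrFun h 0)
  set C := widthAlong K (fun _ => 1) with hC
  have hfin : {u : Fin n → ℤ | u ≠ 0 ∧ widthAlong K u ≤ C}.Finite := by
    refine (Set.finite_Icc (fun _ => -⌈C / (2 * r)⌉ : Fin n → ℤ)
      (fun _ => ⌈C / (2 * r)⌉)).subset ?_
    rintro u ⟨-, hu⟩
    have h2 : ∀ i, |u i| ≤ ⌈C / (2 * r)⌉ := by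
      intro i
      have h3 : |(u i : ℝ)| ≤ C / (2 * r) := by
        rw [le_div_iff₀ (by positivity)]
        linarith [hcoord u i]
      exact_mod_cast h3.trans (Int.le_ceil _)
    exact ⟨fun i => (abs_le.1 (h2 i)).1, fun i => (abs_le.1 (h2 i)).2⟩
  obtain ⟨v, hv, hmin⟩ := hfin.exists_minimalFor (widthAlong K) _ ⟨fun _ => 1, hu0, le_refl C⟩
  have hleast : IsLeast (widthAlong K '' {u : Fin n → ℤ | u ≠ 0}) (widthAlong K v) := by
    refine ⟨⟨v, hv.1, rfl⟩, ?_⟩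
    rintro _ ⟨u, hu, rfl⟩
    rcases le_total (widthAlong K u) (widthAlong K v) with h | h
    · exact hmin ⟨hu, h.trans hv.2⟩ h
    · exact h
  unfold latticeWidth
  rwa [hleast.csInf_eq]

/-! Let D be the difference body K - K scaled by 1/ω(K). It is convex and symmetric, and its support
function is at least 1 at every nonzero integer vector. Points of D are rescaled chords of K, and a
convex body with chords p, q, r has volume at least |det(p, q, r)|/6
(`ofReal_abs_det_div_six_le_volume`). So it suffices to find in D triples with determinant
arbitrarily close to 1/2 (`exists_lt_abs_det3`).

Call a matrix A feasible if the support function of D is at least 1 at Au for all nonzero integer u.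
Take a feasible A that almost minimizes |det A|, and replace D by AᵀD; since |det A| is at most
about 1, large determinants in AᵀD give large ones in D. A small quadratic penalty makes a minimizer
exist. Stationarity (`exists_decomposition_of_minimal`) then writes a slight perturbation of the
identity as ∑ c p uᵀ with c ≥ 0, p in the body and u contacts, that is, integer vectors at which the
support function equals 1; taking traces, ∑ c is close to 3.

If all determinants of contacts are 0 or ±1, Cauchy–Binet compares det(∑ c p uᵀ) with det(∑ c u uᵀ).
A unimodular system of rank three embeds in the roots of A₃: some integer B with |det B| = 2
satisfies |Bu|² ≤ 2 on it. AM–GM for the eigenvalues then yields 1/2 in the limit.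

Otherwise three contacts have |det| ≥ 2. After adding a small ball to D, no point is extremal for
two independent directions; this forces |det| = 2 and makes half the sum of the three contacts
integral. In the coordinates given by the contacts the body lies in a cube, touches its facets and
reaches 2 along every diagonal, so it contains a triple of determinant 1
(`exists_one_le_abs_det3_of_subset_cube`), which is 1/2 in the original coordinates. -/

/-! ### Volume bounds from chords. -/

/-- A compact convex set which contains a segment of length one in the first direction has at least
the volume of the cone over its projection along that direction. -/
theorem measure_image_snd_le_of_segment_mem {E : Type*} [NormedAddCommGroup E] [NormedSpace ℝ E]
    [FiniteDimensional ℝ E] [MeasurableSpace E] [BorelSpace E] (μ : Measure E)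
    [μ.IsAddHaarMeasure] {K : Set (ℝ × E)} (hK : IsCompact K) (hc : Convex ℝ K) {c : ℝ} {o : E}
    (h0 : (c, o) ∈ K) (h1 : (c + 1, o) ∈ K) :
    ENNReal.ofReal (1 / ((Module.finrank ℝ E : ℝ) + 1)) * μ (Prod.snd '' K) ≤
      ((volume : Measure ℝ).prod μ) K := by
  set d := Module.finrank ℝ E with hd
  have hfin : ∀ y, volume ((fun x : ℝ => (x, y)) ⁻¹' K) ≠ ⊤ := by
    intro y
    have : (fun x : ℝ => (x, y)) ⁻¹' K ⊆ Prod.fst '' K := fun x hx => ⟨(x, y), hx, rfl⟩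
    exact ((measure_mono this).trans_lt (hK.image continuous_fst).measure_lt_top).ne
  set f : E → ℝ := fun y => (volume ((fun x : ℝ => (x, y)) ⁻¹' K)).toReal with hf
  have hmeas : Measurable f := (measurable_measure_prodMk_right hK.measurableSet).ennreal_toReal
  have e1 : ((volume : Measure ℝ).prod μ) K = ∫⁻ y, ENNReal.ofReal (f y) ∂μ := by
    rw [Measure.prod_apply_symm hK.measurableSet]
    refine lintegral_congr fun y => ?_
    rw [hf, ENNReal.ofReal_toReal (hfin y)]
  rw [e1, lintegral_eq_lintegral_meas_le μ (Filter.Eventually.of_forall fun y => by positivity)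
    hmeas.aemeasurable]
  -- Over the image of y under the homothety with centre o and ratio 1 - t, the fibre contains the
  -- combination of a point over y, with weight 1 - t, and the unit segment over o, with weight t.
  -- Its length is therefore at least t.
  have hlev : ∀ t ∈ Set.Ioo (0 : ℝ) 1,
      ENNReal.ofReal ((1 - t) ^ d) * μ (Prod.snd '' K) ≤ μ {y | t ≤ f y} := by
    intro t ht
    have hsub : AffineMap.homothety o (1 - t) '' (Prod.snd '' K) ⊆ {y | t ≤ f y} := by
      rintro _ ⟨_, ⟨⟨h, y⟩, hy, rfl⟩, rfl⟩
      simp only [Set.mem_ofPred_eq]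
      have hI : Set.Icc ((1 - t) * h + t * c) ((1 - t) * h + t * c + t) ⊆
          (fun x : ℝ => (x, AffineMap.homothety o (1 - t) y)) ⁻¹' K := by
        intro x hx
        have hseg : (c + (x - ((1 - t) * h + t * c)) / t, o) ∈ K := by
          set s := (x - ((1 - t) * h + t * c)) / t with hs
          have hs0 : 0 ≤ s := div_nonneg (by linarith [hx.1]) ht.1.le
          have hs1 : s ≤ 1 := by
            rw [hs, div_le_one ht.1]; linarith [hx.2]
          have := hc h0 h1 (by linarith : (0 : ℝ) ≤ 1 - s) hs0 (by ring)
          convert this using 1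
          ext
          · simp; ring
          · simp [← add_smul]
        have := hc hy hseg (by linarith [ht.2] : (0 : ℝ) ≤ 1 - t) ht.1.le (by ring)
        simp only [Set.mem_preimage]
        convert this using 1
        ext
        · have := ht.1.ne'
          simp; field_simp; ring
        · simp only [AffineMap.homothety_apply, Prod.snd_add, Prod.smul_snd, vsub_eq_sub,
            vadd_eq_add]
          module
      have hv := measure_mono (μ := volume) hI
      rw [Real.volume_Icc] at hv
      rw [hf]
      refine (ENNReal.ofReal_le_iff_le_toReal (hfin _)).1 ?_
      convert hv using 2
      ring
    refine le_trans ?_ (measure_mono hsub)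
    rw [Measure.addHaar_image_homothety, abs_of_nonneg (pow_nonneg (by linarith [ht.2]) _)]
  calc ENNReal.ofReal (1 / ((d : ℝ) + 1)) * μ (Prod.snd '' K)
      = ∫⁻ t in Set.Ioo (0 : ℝ) 1, ENNReal.ofReal ((1 - t) ^ d) * μ (Prod.snd '' K) := by
        rw [lintegral_mul_const _ (by fun_prop)]
        congr 1
        rw [← ofReal_integral_eq_lintegral_ofReal]
        · congr 1
          rw [← integral_Ioc_eq_integral_Ioo, ← intervalIntegral.integral_of_le zero_le_one]
          have := intervalIntegral.integral_comp_sub_left (a := (0 : ℝ)) (b := 1)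
            (fun x : ℝ => x ^ d) 1
          rw [this]
          simp
        · exact (((by fun_prop : Continuous fun t : ℝ => (1 - t) ^ d).integrableOn_Icc
            (a := 0) (b := 1))).mono_set Set.Ioo_subset_Icc_self
        · filter_upwards [ae_restrict_mem measurableSet_Ioo] with t ht
          exact pow_nonneg (by linarith [ht.2]) _
    _ ≤ ∫⁻ t in Set.Ioo (0 : ℝ) 1, μ {y | t ≤ f y} :=
        setLIntegral_mono' measurableSet_Ioo hlev
    _ ≤ ∫⁻ t in Set.Ioi (0 : ℝ), μ {y | t ≤ f y} :=
        lintegral_mono_set fun t ht => ht.1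

theorem one_half_le_volume_of_segments_mem {K : Set (ℝ × ℝ)} (hK : IsCompact K)
    (hc : Convex ℝ K) {p q : ℝ × ℝ} (hp0 : p ∈ K) (hp1 : p + (1, 0) ∈ K) (hq0 : q ∈ K)
    (hq1 : q + (0, 1) ∈ K) : ENNReal.ofReal (1 / 2) ≤ volume K := by
  have h := measure_image_snd_le_of_segment_mem (volume : Measure ℝ) hK hc (c := p.1) (o := p.2)
    hp0 (by convert hp1 using 1; ext <;> simp)
  have hI : Set.Icc q.2 (q.2 + 1) ⊆ Prod.snd '' K := by
    have hcv : Convex ℝ (Prod.snd '' K) := hc.linear_image (LinearMap.snd ℝ ℝ ℝ)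
    rw [← segment_eq_Icc (by linarith : q.2 ≤ q.2 + 1)]
    exact hcv.segment_subset ⟨q, hq0, rfl⟩ ⟨_, hq1, by simp⟩
  have h2 := measure_mono (μ := volume) hI
  rw [Real.volume_Icc] at h2
  simp only [add_sub_cancel_left, ENNReal.ofReal_one, Module.finrank_self] at h2 h
  calc ENNReal.ofReal (1 / 2) = ENNReal.ofReal (1 / ((1 : ℕ) + 1)) * 1 := by
        rw [mul_one]; norm_num
    _ ≤ _ := mul_le_mul_right h2 _
    _ ≤ _ := h

/-- The projection along the first chord is a planar set with two unit chords, and the cone bound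
loses a factor 3, whence 1/3 · 1/2. -/
theorem one_sixth_le_volume_of_segments_mem {K : Set (ℝ × ℝ × ℝ)} (hK : IsCompact K)
    (hc : Convex ℝ K) {p q r : ℝ × ℝ × ℝ} (hp0 : p ∈ K) (hp1 : p + (1, 0, 0) ∈ K) (hq0 : q ∈ K)
    (hq1 : q + (0, 1, 0) ∈ K) (hr0 : r ∈ K) (hr1 : r + (0, 0, 1) ∈ K) :
    ENNReal.ofReal (1 / 6) ≤ volume K := by
  have h := measure_image_snd_le_of_segment_mem (volume : Measure (ℝ × ℝ)) hK hc (c := p.1)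
    (o := p.2) hp0 (by convert hp1 using 1; ext <;> simp)
  have h2 := one_half_le_volume_of_segments_mem (K := Prod.snd '' K) (hK.image continuous_snd)
    (hc.linear_image (LinearMap.snd ℝ ℝ (ℝ × ℝ))) (p := q.2) (q := r.2)
    ⟨q, hq0, rfl⟩ ⟨_, hq1, by simp⟩ ⟨r, hr0, rfl⟩ ⟨_, hr1, by simp⟩
  calc ENNReal.ofReal (1 / 6) = ENNReal.ofReal (1 / ((2 : ℕ) + 1)) * ENNReal.ofReal (1 / 2) := by
        rw [← ENNReal.ofReal_mul (by positivity)]; norm_num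
    _ ≤ _ := mul_le_mul_right h2 _
    _ ≤ _ := by
        refine le_trans (le_of_eq ?_) h
        simp [Module.finrank_prod]

/-- `(x₀, x₁, x₂) ↦ (x₀, (x₁, x₂))` -/
def tripleEquiv : (Fin 3 → ℝ) ≃ᵐ ℝ × ℝ × ℝ :=
  (MeasurableEquiv.piFinSuccAbove (fun _ => ℝ) 0).trans
    ((MeasurableEquiv.refl ℝ).prodCongr MeasurableEquiv.finTwoArrow)

theorem tripleEquiv_apply (x : Fin 3 → ℝ) : tripleEquiv x = (x 0, x 1, x 2) := rfl

theorem volume_preserving_tripleEquiv : MeasurePreserving tripleEquiv :=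
  (volume_preserving_piFinSuccAbove (fun _ : Fin 3 => ℝ) 0).trans
    ((MeasurePreserving.id volume).prod (volume_preserving_finTwoArrow ℝ))

/-- The volume of a convex body is at least a sixth of the determinant of three of its chords. -/
theorem ofReal_abs_det_div_six_le_volume {K : Set (Fin 3 → ℝ)} (hK : IsCompact K)
    (hc : Convex ℝ K) {a p : Fin 3 → Fin 3 → ℝ} (h0 : ∀ i, a i ∈ K) (h1 : ∀ i, a i + p i ∈ K) :
    ENNReal.ofReal (|(Matrix.of p).det| / 6) ≤ volume K := by
  rcases eq_or_ne (Matrix.of p).det 0 with hd | hd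
  · simp [hd]
  -- L sends the standard basis to the chords, so the preimage of K has unit chords in the
  -- coordinate directions.
  set L : (Fin 3 → ℝ) →ₗ[ℝ] (Fin 3 → ℝ) := Matrix.toLin' (Matrix.of p).transpose with hL
  have hdet : LinearMap.det L = (Matrix.of p).det := by
    rw [hL, LinearMap.det_toLin', Matrix.det_transpose]
  have hLd : LinearMap.det L ≠ 0 := by rwa [hdet]
  set e := L.equivOfDetNeZero hLd with he
  have hee : ∀ x, e x = L x := fun x => rfl
  have hsingle : ∀ i, L (Pi.single i 1) = p i := by
    intro i
    rw [hL, Matrix.toLin'_apply, Matrix.mulVec_single_one]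
    rfl
  have hvol := Measure.addHaar_preimage_linearMap (volume : Measure (Fin 3 → ℝ)) hLd K
  have hpre : L ⁻¹' K = e.symm '' K := by
    ext x
    rw [LinearEquiv.image_symm_eq_preimage]
    rfl
  have hcomp : IsCompact (L ⁻¹' K) := by
    rw [hpre]
    exact hK.image (LinearMap.continuous_of_finiteDimensional e.symm.toLinearMap)
  have hconv : Convex ℝ (L ⁻¹' K) := hc.linear_preimage L
  set φ : (Fin 3 → ℝ) →ₗ[ℝ] ℝ × ℝ × ℝ :=
    (LinearMap.proj 0).prod ((LinearMap.proj 1).prod (LinearMap.proj 2)) with hφ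
  have hφt : ∀ x, φ x = tripleEquiv x := fun x => rfl
  have hmem0 : ∀ i, φ (e.symm (a i)) ∈ φ '' (L ⁻¹' K) := fun i =>
    ⟨_, by rw [hpre]; exact ⟨_, h0 i, rfl⟩, rfl⟩
  have hmem1 : ∀ i, φ (e.symm (a i)) + φ (Pi.single i 1) ∈ φ '' (L ⁻¹' K) := by
    intro i
    rw [← map_add]
    refine ⟨_, ?_, rfl⟩
    rw [Set.mem_preimage, map_add, hsingle, ← hee, LinearEquiv.apply_symm_apply]
    exact h1 i
  have key := one_sixth_le_volume_of_segments_mem (K := φ '' (L ⁻¹' K))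
    (hcomp.image φ.continuous_of_finiteDimensional) (hconv.linear_image φ) (hmem0 0)
    (by simpa [hφ] using hmem1 0) (hmem0 1) (by simpa [hφ] using hmem1 1) (hmem0 2)
    (by simpa [hφ] using hmem1 2)
  have himg : volume (φ '' (L ⁻¹' K)) = volume (L ⁻¹' K) := by
    have : φ '' (L ⁻¹' K) = tripleEquiv '' (L ⁻¹' K) := rfl
    rw [this, MeasurableEquiv.image_eq_preimage_symm]
    exact volume_preserving_tripleEquiv.symm.measure_preimage_equiv _
  rw [himg, hvol, hdet] at key
  calc ENNReal.ofReal (|(Matrix.of p).det| / 6)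
      = ENNReal.ofReal |(Matrix.of p).det| * ENNReal.ofReal (1 / 6) := by
        rw [← ENNReal.ofReal_mul (abs_nonneg _)]; congr 1; ring
    _ ≤ ENNReal.ofReal |(Matrix.of p).det| *
        (ENNReal.ofReal |(Matrix.of p).det⁻¹| * volume K) := mul_le_mul_right key _
    _ = volume K := by
        rw [← mul_assoc, ← ENNReal.ofReal_mul (abs_nonneg _), ← abs_mul, mul_inv_cancel₀ hd]
        simp

/-! ### Large determinants in a symmetric body inscribed in a cube. -/

/-- The worst case is g = s², h = t², Q = (1 - s)², R = (1 - t)². Then F divided by 1 - s reads (1 +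
s)(1 - t²) - (1 - s)(1 - t)² < 1. The left side minus 1 is t(1 - 2t) ≥ 0 at s = 1/2 and grows with
s. -/
theorem le_half_of_pairing {s t g h Q R : ℝ} (ht0 : 0 ≤ t) (hst : t ≤ s)
    (hs1 : s ≤ 1) (hgs : g ≤ s ^ 2) (hht : h ≤ t ^ 2)
    (hQ : |Q| ≤ 1 - 2 * s + g) (hR : |R| ≤ 1 - 2 * t + h)
    (F : (1 - g) * (1 - h) - Q * R < 1 - s) (ht : t ≤ 1 / 2) : s ≤ 1 / 2 := by
  by_contra hs
  push Not at hs
  have h1 : Q * R ≤ (1 - s) ^ 2 * (1 - t) ^ 2 := by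
    calc Q * R ≤ |Q| * |R| := by rw [← abs_mul]; exact le_abs_self _
      _ ≤ (1 - s) ^ 2 * (1 - t) ^ 2 := by
        apply mul_le_mul _ _ (abs_nonneg _) (sq_nonneg _) <;> nlinarith
  have h2 : (1 - s ^ 2) * (1 - t ^ 2) ≤ (1 - g) * (1 - h) := by
    apply mul_le_mul <;> nlinarith
  have h3 : 0 < (1 - s) * ((1 - s) * (1 - t) ^ 2 - (s - t ^ 2 * (1 + s))) := by nlinarith
  have h4 : 0 < 1 - s := by
    rcases hs1.eq_or_lt with h | h
    · rw [h] at h3; simp at h3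
    · linarith
  have h5 := (mul_pos_iff_of_pos_left h4).1 h3
  nlinarith [mul_nonneg (by linarith : (0 : ℝ) ≤ 1 - t) (by linarith : (0 : ℝ) ≤ s - 1 / 2),
    mul_nonneg ht0 (by linarith : (0 : ℝ) ≤ 1 / 2 - t)]

/-- F gives QR > (1 - s²)(1 - t²) - (1 - s) ≥ (1 - s²)² - (1 - s) = s(1 - 2s) + s⁴ ≥ 0. -/
theorem mul_pos_of_pairing {s t g h Q R : ℝ} (ht0 : 0 ≤ t) (hst : t ≤ s)
    (hgs : g ≤ s ^ 2) (hht : h ≤ t ^ 2)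
    (F : (1 - g) * (1 - h) - Q * R < 1 - s) (hs : s ≤ 1 / 2) : 0 < Q * R := by
  have h2 : (1 - s ^ 2) * (1 - t ^ 2) ≤ (1 - g) * (1 - h) := by
    apply mul_le_mul <;> nlinarith
  have h3 : t ^ 2 ≤ s ^ 2 := by nlinarith
  have hs0 : 0 ≤ s := ht0.trans hst
  nlinarith [mul_nonneg (mul_nonneg hs0 (by linarith : (0 : ℝ) ≤ 1 - s)) hs0,
    mul_nonneg hs0 (by linarith : (0 : ℝ) ≤ 1 / 2 - s),
    mul_nonneg (mul_nonneg hs0 hs0) (by linarith : (0 : ℝ) ≤ 1 / 2 - s)]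

/-- If Q < g, then QR ≤ g(1 - 2t + h), and F1, F2 give max(s, t) < 2g(1 - t) + h ≤ 2s²(1 - t) + t².
For s, t ≤ 1/2 the last expression is at most max(s, t). -/
theorem one_le_of_pairing {s t g h Q R : ℝ} (hs0 : 0 ≤ s) (ht0 : 0 ≤ t)
    (hs1 : s ≤ 1 / 2) (ht1 : t ≤ 1 / 2) (hg : 0 ≤ g) (hgs : g ≤ s ^ 2) (hht : h ≤ t ^ 2)
    (hR : |R| ≤ 1 - 2 * t + h) (F1 : (1 - g) * (1 - h) - Q * R < 1 - s)
    (F2 : (1 - g) * (1 - h) - Q * R < 1 - t) (hR0 : 0 < R) : 1 ≤ 1 - g + Q := by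
  by_contra hlt
  push Not at hlt
  have h1 : Q * R ≤ g * (1 - 2 * t + h) := by
    rw [abs_of_pos hR0] at hR
    calc Q * R ≤ g * R := mul_le_mul_of_nonneg_right (by linarith) hR0.le
      _ ≤ _ := mul_le_mul_of_nonneg_left hR hg
  have h2 : g * (2 - 2 * t) + h ≤ s ^ 2 * (2 - 2 * t) + t ^ 2 :=
    add_le_add (mul_le_mul_of_nonneg_right hgs (by linarith)) hht
  rcases le_total t s with hts | hts
  · have h3 : s ^ 2 * (2 - 2 * t) + t ^ 2 ≤ s := by
      nlinarith [mul_nonneg (mul_nonneg hs0 (by linarith : 0 ≤ 1 - 2 * s))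
        (by linarith : 0 ≤ 1 - t), mul_nonneg ht0 (sub_nonneg.2 hts)]
    nlinarith
  · have h3 : s ^ 2 * (2 - 2 * t) + t ^ 2 ≤ t := by
      have : 2 * s ^ 2 ≤ t := by nlinarith
      nlinarith [mul_le_mul_of_nonneg_right this (by linarith : 0 ≤ 1 - t)]
    nlinarith

/-- The trichotomy for two pairs of points on opposite edges. -/
theorem pairing_trichotomy {c₁ c₂ c₃ c₄ Q R : ℝ} (h1 : 0 ≤ c₁) (h2 : 0 ≤ c₂) (h3 : 0 ≤ c₃)
    (h4 : 0 ≤ c₄) (h1' : c₁ ≤ 1) (h2' : c₂ ≤ 1) (h3' : c₃ ≤ 1) (h4' : c₄ ≤ 1)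
    (hQ : |Q| ≤ (1 - c₁) * (1 - c₂)) (hR : |R| ≤ (1 - c₃) * (1 - c₄))
    (F1 : (1 - c₁ * c₂) * (1 - c₃ * c₄) - Q * R < 1 - (c₁ + c₂) / 2)
    (F2 : (1 - c₁ * c₂) * (1 - c₃ * c₄) - Q * R < 1 - (c₃ + c₄) / 2) :
    (1 < c₁ + c₂ ∧ 1 < c₃ + c₄) ∨
    (0 < Q ∧ 0 < R ∧ 1 ≤ 1 - c₁ * c₂ + Q ∧ 1 ≤ 1 - c₃ * c₄ + R) ∨
    (Q < 0 ∧ R < 0 ∧ 1 ≤ 1 - c₁ * c₂ - Q ∧ 1 ≤ 1 - c₃ * c₄ - R) := by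
  set s := (c₁ + c₂) / 2 with hs
  set t := (c₃ + c₄) / 2 with ht
  have hg : 0 ≤ c₁ * c₂ := mul_nonneg h1 h2
  have hh : 0 ≤ c₃ * c₄ := mul_nonneg h3 h4
  have hgs : c₁ * c₂ ≤ s ^ 2 := by rw [hs]; nlinarith [sq_nonneg (c₁ - c₂)]
  have hht : c₃ * c₄ ≤ t ^ 2 := by rw [ht]; nlinarith [sq_nonneg (c₃ - c₄)]
  have hQ' : |Q| ≤ 1 - 2 * s + c₁ * c₂ := by rw [hs]; linarith
  have hR' : |R| ≤ 1 - 2 * t + c₃ * c₄ := by rw [ht]; linarith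
  have hs0 : 0 ≤ s := by positivity
  have ht0 : 0 ≤ t := by positivity
  have hs1 : s ≤ 1 := by rw [hs]; linarith
  have ht1 : t ≤ 1 := by rw [ht]; linarith
  clear_value s t
  have F1' : (1 - c₃ * c₄) * (1 - c₁ * c₂) - R * Q < 1 - s := by linarith
  have F2' : (1 - c₃ * c₄) * (1 - c₁ * c₂) - R * Q < 1 - t := by linarith
  by_cases hbad : 1 / 2 < s ∧ 1 / 2 < t
  · left; constructor <;> linarith
  right
  -- The smaller of s, t is at most 1/2 because `hbad` fails, and `le_half_of_pairing` carries this
  -- over to the larger one.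
  have hgood : s ≤ 1 / 2 ∧ t ≤ 1 / 2 := by
    rcases le_total t s with hts | hts
    · have ht2 : t ≤ 1 / 2 := by
        by_contra h; push Not at h; exact hbad ⟨by linarith, h⟩
      exact ⟨le_half_of_pairing ht0 hts hs1 hgs hht hQ' hR' F1 ht2, ht2⟩
    · have hs2 : s ≤ 1 / 2 := by
        by_contra h; push Not at h; exact hbad ⟨h, by linarith⟩
      exact ⟨hs2, le_half_of_pairing hs0 hts ht1 hht hgs hR' hQ' F2' hs2⟩
  have hpos : 0 < Q * R := by
    rcases le_total t s with hts | hts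
    · exact mul_pos_of_pairing ht0 hts hgs hht F1 hgood.1
    · rw [mul_comm]; exact mul_pos_of_pairing hs0 hts hht hgs F2' hgood.2
  rcases mul_pos_iff.1 hpos with ⟨a, b⟩ | ⟨a, b⟩
  · left
    exact ⟨a, b, one_le_of_pairing hs0 ht0 hgood.1 hgood.2 hg hgs hht hR' F1 F2 b,
      one_le_of_pairing ht0 hs0 hgood.2 hgood.1 hh hht hgs hQ' F2' F1' a⟩
  · right
    refine ⟨a, b, ?_, ?_⟩
    · have := one_le_of_pairing (Q := -Q) (R := -R) hs0 ht0 hgood.1 hgood.2 hg hgs hht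
        (by rwa [abs_neg]) (by linarith) (by linarith) (by linarith)
      linarith
    · have := one_le_of_pairing (Q := -R) (R := -Q) ht0 hs0 hgood.2 hgood.1 hh hht hgs
        (by rwa [abs_neg]) (by linarith) (by linarith) (by linarith)
      linarith

/-- The determinant of `(x₀, x₁, x₂)`, `(y₀, -y₁, -y₂)` and `(-z₀, z₁, -z₂)`. -/
def signedDet (x y z : Fin 3 → ℝ) (i j k : Fin 3) : ℝ :=
  z i * (x j * y k - x k * y j) + z j * (x k * y i + x i * y k) + z k * (x i * y j + x j * y i)

/-- In terms of the deficits a = 1 - x i, b = 1 - x j, c = 1 - x k, whose sum is 1, each coordinate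
is the sum of the two other deficits, and in these variables the determinant has only nonnegative
coefficients. -/
theorem signedDet_nonneg {x y z : Fin 3 → ℝ} {i j k : Fin 3}
    (hx : x i + x j + x k = 2) (hy : y i + y j + y k = 2) (hz : z i + z j + z k = 2)
    (hx1 : ∀ i, x i ≤ 1) (hy1 : ∀ i, y i ≤ 1) (hz1 : ∀ i, z i ≤ 1) :
    0 ≤ signedDet x y z i j k := by
  obtain ⟨a, ha, ha'⟩ : ∃ a, 0 ≤ a ∧ x i = 1 - a := ⟨1 - x i, by linarith [hx1 i], by ring⟩
  obtain ⟨b, hb, hb'⟩ : ∃ a, 0 ≤ a ∧ x j = 1 - a := ⟨1 - x j, by linarith [hx1 j], by ring⟩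
  obtain ⟨c, hc, hc'⟩ : ∃ a, 0 ≤ a ∧ x k = 1 - a := ⟨1 - x k, by linarith [hx1 k], by ring⟩
  obtain ⟨d, hd, hd'⟩ : ∃ a, 0 ≤ a ∧ y i = 1 - a := ⟨1 - y i, by linarith [hy1 i], by ring⟩
  obtain ⟨e, he, he'⟩ : ∃ a, 0 ≤ a ∧ y j = 1 - a := ⟨1 - y j, by linarith [hy1 j], by ring⟩
  obtain ⟨f, hf, hf'⟩ : ∃ a, 0 ≤ a ∧ y k = 1 - a := ⟨1 - y k, by linarith [hy1 k], by ring⟩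
  obtain ⟨g, hg, hg'⟩ : ∃ a, 0 ≤ a ∧ z i = 1 - a := ⟨1 - z i, by linarith [hz1 i], by ring⟩
  obtain ⟨h, hh, hh'⟩ : ∃ a, 0 ≤ a ∧ z j = 1 - a := ⟨1 - z j, by linarith [hz1 j], by ring⟩
  obtain ⟨l, hl, hl'⟩ : ∃ a, 0 ≤ a ∧ z k = 1 - a := ⟨1 - z k, by linarith [hz1 k], by ring⟩
  have e1 : x i = b + c := by linarith
  have e2 : x j = a + c := by linarith
  have e3 : x k = a + b := by linarith
  have e4 : y i = e + f := by linarith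
  have e5 : y j = d + f := by linarith
  have e6 : y k = d + e := by linarith
  have e7 : z i = h + l := by linarith
  have e8 : z j = g + l := by linarith
  have e9 : z k = g + h := by linarith
  have : signedDet x y z i j k = 2 * (a*e*h + a*e*l + c*d*h + c*d*l + c*e*h + c*e*l + a*e*g
      + a*f*g + b*e*g + b*e*l + b*f*g + b*d*g + c*d*g + c*e*g + c*f*g + c*f*h) := by
    rw [signedDet, e1, e2, e3, e4, e5, e6, e7, e8, e9]; ring
  rw [this]
  positivity

theorem signedDet_swap_right (x y z : Fin 3 → ℝ) (i j k : Fin 3) :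
    signedDet x z y j i k = signedDet x y z i j k := by
  simp only [signedDet]; ring

theorem mul_add_mul_lt_add {s t S T : ℝ} (hs : 0 ≤ s) (ht : 0 ≤ t) (hst : 0 < t + s) (hS : S < 1)
    (hT : T < 1) : s * S + t * T < t + s := by
  rcases hs.eq_or_lt with h | h
  · subst h
    have := mul_lt_mul_of_pos_left hT (by linarith : 0 < t)
    linarith
  · have h1 := mul_lt_mul_of_pos_left hS h
    have h2 := mul_le_mul_of_nonneg_left hT.le ht
    linarith

/-- Coordinate `i` splits the four points into the pairs {x, y} and {z, u}. For a pair w, v let g be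
the product of the deficits 1 - w i, 1 - v i, and Q the product of the deficits at k minus that at
j. The mixed products of the pair in the coordinates i, j and i, k are then 1 - g + Q and 1 - g - Q.
Combining the four determinant bounds two by two, with i-th coordinates as weights, gives the two
inequalities required by `pairing_trichotomy`. -/
theorem opposite_edges_trichotomy {x y z u : Fin 3 → ℝ} {i j k : Fin 3}
    (hx : x i + x j + x k = 2) (hy : y i + y j + y k = 2) (hz : z i + z j + z k = 2)
    (hu : u i + u j + u k = 2) (hx1 : ∀ i, x i ≤ 1) (hy1 : ∀ i, y i ≤ 1) (hz1 : ∀ i, z i ≤ 1)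
    (hu1 : ∀ i, u i ≤ 1) (h4 : signedDet x y z i j k < 1) (h3 : signedDet y x u i j k < 1)
    (h2 : signedDet z u x i j k < 1) (h1 : signedDet u z y i j k < 1) :
    (x i + y i < 1 ∧ z i + u i < 1) ∨
    ((1 - x j) * (1 - y j) < (1 - x k) * (1 - y k) ∧ (1 - z j) * (1 - u j) < (1 - z k) * (1 - u k)
      ∧ 1 ≤ x i * y j + x j * y i ∧ 1 ≤ z i * u j + z j * u i) ∨
    ((1 - x k) * (1 - y k) < (1 - x j) * (1 - y j) ∧ (1 - z k) * (1 - u k) < (1 - z j) * (1 - u j)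
      ∧ 1 ≤ x i * y k + x k * y i ∧ 1 ≤ z i * u k + z k * u i) := by
  have hb : ∀ {w v : Fin 3 → ℝ}, (w i + w j + w k = 2) → (v i + v j + v k = 2) →
      (∀ i, w i ≤ 1) → (∀ i, v i ≤ 1) →
      |(1 - w k) * (1 - v k) - (1 - w j) * (1 - v j)| ≤ (1 - (1 - w i)) * (1 - (1 - v i)) := by
    intro w v hw hv hw1 hv1
    have a1 := hw1 i; have a2 := hw1 j; have a3 := hw1 k
    have b1 := hv1 i; have b2 := hv1 j; have b3 := hv1 k
    have ew : 1 - (1 - w i) = (1 - w j) + (1 - w k) := by linarith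
    have ev : 1 - (1 - v i) = (1 - v j) + (1 - v k) := by linarith
    rw [ew, ev, abs_le]
    have c1 : 0 ≤ 1 - w j := by linarith
    have c2 : 0 ≤ 1 - w k := by linarith
    have c3 : 0 ≤ 1 - v j := by linarith
    have c4 : 0 ≤ 1 - v k := by linarith
    constructor <;>
      nlinarith [mul_nonneg c1 c3, mul_nonneg c1 c4, mul_nonneg c2 c3, mul_nonneg c2 c4]
  have hxi : x i = 2 - x j - x k := by linarith
  have hyi : y i = 2 - y j - y k := by linarith
  have hzi : z i = 2 - z j - z k := by linarith
  have hui : u i = 2 - u j - u k := by linarith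
  have hB : ∀ {w v : Fin 3 → ℝ}, (w i + w j + w k = 2) → (v i + v j + v k = 2) →
      w i * v j + w j * v i = 1 - (1 - w i) * (1 - v i) +
        ((1 - w k) * (1 - v k) - (1 - w j) * (1 - v j)) := by
    intro w v hw hv
    rw [show w i = 2 - w j - w k by linarith, show v i = 2 - v j - v k by linarith]; ring
  have hA : ∀ {w v : Fin 3 → ℝ}, (w i + w j + w k = 2) → (v i + v j + v k = 2) →
      w i * v k + w k * v i = 1 - (1 - w i) * (1 - v i) -
        ((1 - w k) * (1 - v k) - (1 - w j) * (1 - v j)) := by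
    intro w v hw hv
    rw [show w i = 2 - w j - w k by linarith, show v i = 2 - v j - v k by linarith]; ring
  have hx0 : 0 ≤ x i := by linarith [hx1 j, hx1 k]
  have hy0 : 0 ≤ y i := by linarith [hy1 j, hy1 k]
  have hz0 : 0 ≤ z i := by linarith [hz1 j, hz1 k]
  have hu0 : 0 ≤ u i := by linarith [hu1 j, hu1 k]
  have hF1 : u i * signedDet x y z i j k + z i * signedDet y x u i j k =
      (x i * y k + x k * y i) * (z i * u j + z j * u i) +
      (x i * y j + x j * y i) * (z i * u k + z k * u i) := by
    simp only [signedDet]; ring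
  have hF2 : y i * signedDet z u x i j k + x i * signedDet u z y i j k =
      (x i * y k + x k * y i) * (z i * u j + z j * u i) +
      (x i * y j + x j * y i) * (z i * u k + z k * u i) := by
    simp only [signedDet]; ring
  rw [hA hx hy, hB hx hy, hA hz hu, hB hz hu] at hF1 hF2
  -- A strict combined inequality needs weights that are not both zero. If z i = u i = 0, the other
  -- coordinates of z are 1, and the determinant 2 - 2(1 - x i)(1 - y i) bounds x i + y i directly.
  rcases (add_nonneg hz0 hu0).eq_or_lt with h0 | hzu
  · left
    have z0 : z i = 0 := by linarith
    have u0 : u i = 0 := by linarith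
    refine ⟨?_, by linarith⟩
    have zj : z j = 1 := by linarith [hz1 j, hz1 k]
    have zk : z k = 1 := by linarith [hz1 j, hz1 k]
    have : signedDet x y z i j k = 2 - 2 * (1 - x i) * (1 - y i) := by
      simp only [signedDet, z0, zj, zk, hxi, hyi]; ring
    linarith [mul_nonneg (sub_nonneg.2 (hx1 i)) hy0, mul_nonneg (sub_nonneg.2 (hy1 i)) hx0]
  rcases (add_nonneg hx0 hy0).eq_or_lt with h0 | hxy
  · left
    have x0 : x i = 0 := by linarith
    have y0 : y i = 0 := by linarith
    refine ⟨by linarith, ?_⟩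
    have xj : x j = 1 := by linarith [hx1 j, hx1 k]
    have xk : x k = 1 := by linarith [hx1 j, hx1 k]
    have : signedDet z u x i j k = 2 - 2 * (1 - z i) * (1 - u i) := by
      simp only [signedDet, x0, xj, xk, hzi, hui]; ring
    linarith [mul_nonneg (sub_nonneg.2 (hz1 i)) hu0, mul_nonneg (sub_nonneg.2 (hu1 i)) hz0]
  have G1 := mul_add_mul_lt_add hu0 hz0 hzu h4 h3
  have G2 := mul_add_mul_lt_add hy0 hx0 hxy h2 h1
  rw [hF1] at G1
  rw [hF2] at G2
  have key := pairing_trichotomy (c₁ := 1 - x i) (c₂ := 1 - y i) (c₃ := 1 - z i) (c₄ := 1 - u i)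
    (by linarith [hx1 i]) (by linarith [hy1 i]) (by linarith [hz1 i]) (by linarith [hu1 i])
    (by linarith) (by linarith) (by linarith) (by linarith) (hb hx hy hx1 hy1) (hb hz hu hz1 hu1)
    (by linarith) (by linarith)
  rw [hA hx hy, hB hx hy, hA hz hu, hB hz hu]
  rcases key with ⟨a, b⟩ | ⟨a, b, c, d⟩ | ⟨a, b, c, d⟩
  · left; constructor <;> linarith
  · right; left; exact ⟨by linarith, by linarith, c, d⟩
  · right; right; exact ⟨by linarith, by linarith, c, d⟩

/-- The hypotheses `d12`, ..., `d24` bound determinants of two of the points with a point (e, f, 1)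
of the facet of coordinate k. By `b12`, ..., `b24` the terms in e and f must be negative. According
to the signs of e and f, two of these inequalities that share a point read aA + bW < 0 and bB + aV <
0 with a = |f|, b = |e| and A, B ≥ 0. Multiplying them gives AB < WV, whereas AB - WV is a
coordinate of the shared point times a nonnegative `signedDet`. -/
theorem false_of_four_dets_lt_one {x y z u : Fin 3 → ℝ} {i j k : Fin 3} {e f : ℝ}
    (hx0 : ∀ i, 0 ≤ x i) (hy0 : ∀ i, 0 ≤ y i) (hz0 : ∀ i, 0 ≤ z i) (hu0 : ∀ i, 0 ≤ u i)
    (h4 : 0 ≤ signedDet x y z i j k) (h3 : 0 ≤ signedDet y x u i j k)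
    (h2 : 0 ≤ signedDet z u x i j k) (h1 : 0 ≤ signedDet u z y i j k)
    (b12 : 1 ≤ x i * y j + x j * y i) (b34 : 1 ≤ z i * u j + z j * u i)
    (b13 : 1 ≤ x i * z j + x j * z i) (b24 : 1 ≤ y i * u j + y j * u i)
    (d12 : x i * y j + x j * y i - f * (x i * y k + x k * y i) + e * (x j * y k - x k * y j) < 1)
    (d34 : z i * u j + z j * u i + f * (z i * u k + z k * u i) + e * (z j * u k - z k * u j) < 1)
    (d13 : x i * z j + x j * z i - e * (x j * z k + x k * z j) + f * (x i * z k - x k * z i) < 1)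
    (d24 : y i * u j + y j * u i + e * (y j * u k + y k * u j) + f * (y i * u k - y k * u i) < 1) :
    False := by
  have key : ∀ {a b A B W V t : ℝ}, 0 ≤ a → 0 ≤ b → 0 ≤ A → 0 ≤ B → a * A + b * W < 0 →
      b * B + a * V < 0 → 0 ≤ t → A * B - W * V = t → False := by
    intro a b A B W V t ha hb hA hB h h' ht heq
    have ha' : 0 < a := by
      rcases ha.eq_or_lt with h0 | h0
      · rw [← h0] at h'; nlinarith [mul_nonneg hb hB]
      · exact h0
    have hb' : 0 < b := by
      rcases hb.eq_or_lt with h0 | h0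
      · rw [← h0] at h; nlinarith [mul_nonneg ha hA]
      · exact h0
    have m : (a * A) * (b * B) < (-(b * W)) * (-(a * V)) :=
      mul_lt_mul'' (by linarith) (by linarith) (mul_nonneg ha hA) (mul_nonneg hb hB)
    have : 0 < a * b * (W * V - A * B) := by linarith
    have := (mul_pos_iff_of_pos_left (mul_pos ha' hb')).1 this
    linarith
  have c : ∀ {w v : Fin 3 → ℝ} (i j : Fin 3), (∀ i, 0 ≤ w i) → (∀ i, 0 ≤ v i) →
      0 ≤ w i * v j + w j * v i := fun i j hw hv =>
    add_nonneg (mul_nonneg (hw _) (hv _)) (mul_nonneg (hw _) (hv _))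
  rcases le_total 0 e with he | he <;> rcases le_total 0 f with hf | hf
  · exact key (A := z i * u k + z k * u i) (B := y j * u k + y k * u j) hf he (c _ _ hz0 hu0)
      (c _ _ hy0 hu0) (W := z j * u k - z k * u j) (V := y i * u k - y k * u i) (by linarith)
      (by linarith) (mul_nonneg (hu0 k) h1) (by simp only [signedDet]; ring)
  · exact key (a := -f) (A := x i * y k + x k * y i) (B := y j * u k + y k * u j) (by linarith) he
      (c _ _ hx0 hy0) (c _ _ hy0 hu0) (W := x j * y k - x k * y j)
      (V := -(y i * u k - y k * u i)) (by linarith)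
      (by linarith) (mul_nonneg (hy0 k) h3) (by simp only [signedDet]; ring)
  · exact key (b := -e) (A := z i * u k + z k * u i) (B := x j * z k + x k * z j) hf (by linarith)
      (c _ _ hz0 hu0) (c _ _ hx0 hz0) (W := -(z j * u k - z k * u j))
      (V := (x i * z k - x k * z i)) (by linarith)
      (by linarith) (mul_nonneg (hz0 k) h2) (by simp only [signedDet]; ring)
  · exact key (a := -f) (b := -e) (A := x i * y k + x k * y i) (B := x j * z k + x k * z j)
      (by linarith) (by linarith) (c _ _ hx0 hy0) (c _ _ hx0 hz0)
      (W := -(x j * y k - x k * y j)) (V := -(x i * z k - x k * z i)) (by linarith)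
      (by linarith) (mul_nonneg (hx0 k) h4) (by simp only [signedDet]; ring)

/-- The determinant with rows `a`, `b`, `c`. -/
def det3 (a b c : Fin 3 → ℝ) : ℝ := (Matrix.of ![a, b, c]).det

theorem det3_eq (a b c : Fin 3 → ℝ) : det3 a b c =
    a 0 * (b 1 * c 2 - b 2 * c 1) - a 1 * (b 0 * c 2 - b 2 * c 0)
      + a 2 * (b 0 * c 1 - b 1 * c 0) := by
  simp [det3, Matrix.det_fin_three]; ring

/-- The trichotomy is applied to the coordinates i and j. The alternatives to be excluded are small
sums, and mixed products involving k. If the sums at k are small, the former would make the total of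
all coordinates less than 8, and the latter would make the sums at k large. Otherwise `hk` excludes
the former outright, and the latter by maximality of the product of the deficits at k. What remains
is the input of `false_of_four_dets_lt_one`. -/
theorem false_of_best_coordinate {x y z u : Fin 3 → ℝ} {i j k : Fin 3} {e f : ℝ}
    (hx : x i + x j + x k = 2) (hy : y i + y j + y k = 2) (hz : z i + z j + z k = 2)
    (hu : u i + u j + u k = 2) (hx1 : ∀ i, x i ≤ 1) (hy1 : ∀ i, y i ≤ 1) (hz1 : ∀ i, z i ≤ 1)
    (hu1 : ∀ i, u i ≤ 1)
    (hx0 : ∀ i, 0 ≤ x i) (hy0 : ∀ i, 0 ≤ y i) (hz0 : ∀ i, 0 ≤ z i) (hu0 : ∀ i, 0 ≤ u i)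
    (h4 : signedDet x y z i j k < 1) (h3 : signedDet y x u i j k < 1)
    (h2 : signedDet z u x i j k < 1) (h1 : signedDet u z y i j k < 1)
    (hk : (x k + u k < 1 ∧ y k + z k < 1) ∨
      (¬ (x i + y i < 1 ∧ z i + u i < 1) ∧ ¬ (x j + z j < 1 ∧ y j + u j < 1) ∧
      (1 - x i) * (1 - y i) * ((1 - z i) * (1 - u i)) ≤
        (1 - x k) * (1 - y k) * ((1 - z k) * (1 - u k)) ∧
      (1 - x j) * (1 - y j) * ((1 - z j) * (1 - u j)) ≤
        (1 - x k) * (1 - y k) * ((1 - z k) * (1 - u k))))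
    (d12 : x i * y j + x j * y i - f * (x i * y k + x k * y i) + e * (x j * y k - x k * y j) < 1)
    (d34 : z i * u j + z j * u i + f * (z i * u k + z k * u i) + e * (z j * u k - z k * u j) < 1)
    (d13 : x i * z j + x j * z i - e * (x j * z k + x k * z j) + f * (x i * z k - x k * z i) < 1)
    (d24 : y i * u j + y j * u i + e * (y j * u k + y k * u j) + f * (y i * u k - y k * u i) < 1) :
    False := by
  have small : ∀ {w v : Fin 3 → ℝ} {i : Fin 3}, (∀ i, w i ≤ 1) → (∀ i, v i ≤ 1) →
      (∀ i, 0 ≤ w i) → (∀ i, 0 ≤ v i) → 1 ≤ w i * v k + w k * v i → 1 ≤ w k + v k := by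
    intro w v i hw hv hw0 hv0 h
    have := mul_le_of_le_one_left (hv0 k) (hw i)
    have := mul_le_of_le_one_right (hw0 k) (hv i)
    linarith
  have nn : ∀ {w v : Fin 3 → ℝ} (i : Fin 3), (∀ i, w i ≤ 1) → (∀ i, v i ≤ 1) →
      0 ≤ (1 - w i) * (1 - v i) := fun i hw hv =>
    mul_nonneg (sub_nonneg.2 (hw i)) (sub_nonneg.2 (hv i))
  have g1 : 1 ≤ x i * y j + x j * y i ∧ 1 ≤ z i * u j + z j * u i := by
    rcases opposite_edges_trichotomy hx hy hz hu hx1 hy1 hz1 hu1 h4 h3 h2 h1 with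
      h | h | ⟨ha, hb, hc, hd⟩
    · exfalso
      rcases hk with hk | hk
      · linarith [hx1 j, hy1 j, hz1 j, hu1 j]
      · exact hk.1 h
    · exact h.2.2
    · exfalso
      rcases hk with hk | hk
      · linarith [small hx1 hy1 hx0 hy0 hc, small hz1 hu1 hz0 hu0 hd]
      · have := mul_lt_mul'' ha hb (nn k hx1 hy1) (nn k hz1 hu1)
        linarith [hk.2.2.2]
  have g2 : 1 ≤ x j * z i + x i * z j ∧ 1 ≤ y j * u i + y i * u j := by
    have e4 : signedDet x z y j i k < 1 := by rwa [signedDet_swap_right]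
    have e3 : signedDet z x u j i k < 1 := by
      have : signedDet z x u j i k = signedDet z u x i j k := by simp only [signedDet]; ring
      rwa [this]
    have e2 : signedDet y u x j i k < 1 := by
      have : signedDet y u x j i k = signedDet y x u i j k := by simp only [signedDet]; ring
      rwa [this]
    have e1 : signedDet u y z j i k < 1 := by
      have : signedDet u y z j i k = signedDet u z y i j k := by simp only [signedDet]; ring
      rwa [this]
    rcases opposite_edges_trichotomy (by linarith) (by linarith) (by linarith) (by linarith)
      hx1 hz1 hy1 hu1 e4 e3 e2 e1 with h | h | ⟨ha, hb, hc, hd⟩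
    · exfalso
      rcases hk with hk | hk
      · linarith [hx1 i, hy1 i, hz1 i, hu1 i]
      · exact hk.2.1 h
    · exact h.2.2
    · exfalso
      rcases hk with hk | hk
      · linarith [small hx1 hz1 hx0 hz0 hc, small hy1 hu1 hy0 hu0 hd]
      · have := mul_lt_mul'' ha hb (nn k hx1 hz1) (nn k hy1 hu1)
        linarith [hk.2.2.1]
  exact false_of_four_dets_lt_one hx0 hy0 hz0 hu0
    (signedDet_nonneg hx hy hz hx1 hy1 hz1) (signedDet_nonneg hy hx hu hy1 hx1 hu1)
    (signedDet_nonneg hz hu hx hz1 hu1 hx1) (signedDet_nonneg hu hz hy hu1 hz1 hy1)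
    g1.1 g1.2 (by linarith [g2.1]) (by linarith [g2.2]) d12 d34 d13 d24

/-- A symmetric convex set inside a cube which touches all the facets, and whose width along each
of the diagonals is at least two thirds of that of the cube, contains three vectors with determinant
at least one. -/
theorem exists_one_le_abs_det3_of_subset_cube {D : Set (Fin 3 → ℝ)}
    (hcube : ∀ p ∈ D, ∀ i, p i ≤ 1) (hneg : ∀ p ∈ D, -p ∈ D)
    (hstar : ∀ p ∈ D, ∀ c : ℝ, 0 ≤ c → c ≤ 1 → c • p ∈ D)
    (htouch : ∀ i, ∃ r ∈ D, r i = 1)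
    (h1 : ∃ q ∈ D, 2 ≤ q 0 + q 1 + q 2) (h2 : ∃ q ∈ D, 2 ≤ q 0 - q 1 - q 2)
    (h3 : ∃ q ∈ D, 2 ≤ -q 0 + q 1 - q 2) (h4 : ∃ q ∈ D, 2 ≤ -q 0 - q 1 + q 2) :
    ∃ p ∈ D, ∃ q ∈ D, ∃ r ∈ D, 1 ≤ |det3 p q r| := by
  have hcube' : ∀ p ∈ D, ∀ i, -1 ≤ p i := fun p hp i => by
    have := hcube _ (hneg p hp) i
    simp only [Pi.neg_apply] at this
    linarith
  -- Shrinking q makes its signed sum exactly 2. After the sign change the coordinates are at most 1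
  -- and sum to 2, so they are nonnegative.
  have scale : ∀ v : Fin 3 → ℝ, (∃ q ∈ D, 2 ≤ v 0 * q 0 + v 1 * q 1 + v 2 * q 2) →
      (∀ i, v i = 1 ∨ v i = -1) → ∃ x : Fin 3 → ℝ, (fun i => v i * x i) ∈ D ∧
        x 0 + x 1 + x 2 = 2 ∧ (∀ i, x i ≤ 1) ∧ ∀ i, 0 ≤ x i := by
    rintro v ⟨q, hq, hs⟩ hv
    set s := v 0 * q 0 + v 1 * q 1 + v 2 * q 2 with hsdef
    have hs0 : 0 < s := by linarith
    have hmem := hstar q hq (2 / s) (by positivity) ((div_le_one hs0).2 hs)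
    have hv2 : ∀ i, v i * v i = 1 := fun i => by rcases hv i with h | h <;> simp [h]
    refine ⟨fun i => v i * ((2 / s) * q i), ?_, ?_, ?_⟩
    · convert hmem using 1
      funext i
      rw [← mul_assoc, hv2]; simp
    · have : v 0 * (2 / s * q 0) + v 1 * (2 / s * q 1) + v 2 * (2 / s * q 2) = 2 / s * s := by
        rw [hsdef]; ring
      rw [this]; field_simp
    · have hle : ∀ i, v i * ((2 / s) * q i) ≤ 1 := by
        intro i
        have a := hcube _ hmem i
        have b := hcube' _ hmem i
        simp only [Pi.smul_apply, smul_eq_mul] at a b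
        rcases hv i with h | h <;> rw [h] <;> linarith
      refine ⟨hle, ?_⟩
      have hsum : v 0 * (2 / s * q 0) + v 1 * (2 / s * q 1) + v 2 * (2 / s * q 2) = 2 := by
        have : v 0 * (2 / s * q 0) + v 1 * (2 / s * q 1) + v 2 * (2 / s * q 2) = 2 / s * s := by
          rw [hsdef]; ring
        rw [this]; field_simp
      have a0 := hle 0; have a1 := hle 1; have a2 := hle 2
      intro i
      fin_cases i <;> simp only [Fin.zero_eta, Fin.mk_one, Fin.reduceFinMk] <;> linarith
  by_contra hcon
  push Not at hcon
  obtain ⟨x, hxD, hx, hx1, hx0⟩ := scale ![1, 1, 1] (by simpa using h1) (by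
    intro i; fin_cases i <;> simp)
  obtain ⟨y, hyD, hy, hy1, hy0⟩ := scale ![1, -1, -1] (by
    simpa [sub_eq_add_neg] using h2) (by intro i; fin_cases i <;> simp)
  obtain ⟨z, hzD, hz, hz1, hz0⟩ := scale ![-1, 1, -1] (by
    simpa [sub_eq_add_neg] using h3) (by intro i; fin_cases i <;> simp)
  obtain ⟨u, huD, hu, hu1, hu0⟩ := scale ![-1, -1, 1] (by
    simpa [sub_eq_add_neg] using h4) (by intro i; fin_cases i <;> simp)
  obtain ⟨r, hr, hr1⟩ := htouch 0
  obtain ⟨s, hs, hs1⟩ := htouch 1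
  obtain ⟨t, ht, ht1⟩ := htouch 2
  have hd : ∀ p ∈ D, ∀ q ∈ D, ∀ w ∈ D, _ := fun p hp q hq w hw => abs_lt.1 (hcon p hp q hq w hw)
  have t4 := hd _ hxD _ hyD _ hzD
  have t3 := hd _ hxD _ hyD _ huD
  have t2 := hd _ hxD _ hzD _ huD
  have t1 := hd _ hyD _ hzD _ huD
  have r12 := hd _ hxD _ hyD _ hr
  have r13 := hd _ hxD _ hzD _ hr
  have r14 := hd _ hxD _ huD _ hr
  have r23 := hd _ hyD _ hzD _ hr
  have r24 := hd _ hyD _ huD _ hr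
  have r34 := hd _ hzD _ huD _ hr
  have s12 := hd _ hxD _ hyD _ hs
  have s13 := hd _ hxD _ hzD _ hs
  have s14 := hd _ hxD _ huD _ hs
  have s23 := hd _ hyD _ hzD _ hs
  have s24 := hd _ hyD _ huD _ hs
  have s34 := hd _ hzD _ huD _ hs
  have t12 := hd _ hxD _ hyD _ ht
  have t13 := hd _ hxD _ hzD _ ht
  have t14 := hd _ hxD _ huD _ ht
  have t23 := hd _ hyD _ hzD _ ht
  have t24 := hd _ hyD _ huD _ ht
  have t34 := hd _ hzD _ huD _ ht
  clear hd hcon hxD hyD hzD huD hr hs ht h1 h2 h3 h4 hcube hcube' hneg hstar htouch scale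
  simp only [det3_eq, Matrix.cons_val_zero, Matrix.cons_val_one, Matrix.cons_val, one_mul,
    neg_mul, mul_neg, neg_neg, hr1, hs1, ht1, mul_one] at *
  have T4 : signedDet x y z 0 1 2 < 1 := by simp only [signedDet]; linarith
  have T3 : signedDet y x u 0 1 2 < 1 := by simp only [signedDet]; linarith
  have T2 : signedDet z u x 0 1 2 < 1 := by simp only [signedDet]; linarith
  have T1 : signedDet u z y 0 1 2 < 1 := by simp only [signedDet]; linarith
  -- No coordinate can play the role of k. Each of the three belongs to another pairing of the four
  -- points, obtained by renaming them.
  have m2 : ¬ _ := fun hk => false_of_best_coordinate (i := 0) (j := 1) (k := 2) (e := t 0)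
    (f := t 1) hx hy hz hu hx1 hy1 hz1 hu1 hx0 hy0 hz0 hu0 T4 T3 T2 T1 hk
    (by linarith) (by linarith) (by linarith) (by linarith)
  have m1 : ¬ _ := fun hk => false_of_best_coordinate (x := x) (y := y) (z := u) (u := z)
    (i := 0) (j := 2) (k := 1) (e := s 0)
    (f := s 2) (by linarith) (by linarith) (by linarith) (by linarith)
    hx1 hy1 hu1 hz1 hx0 hy0 hu0 hz0 (by simp only [signedDet] at *; linarith)
    (by simp only [signedDet] at *; linarith) (by simp only [signedDet] at *; linarith)
    (by simp only [signedDet] at *; linarith) hk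
    (by linarith) (by linarith) (by linarith) (by linarith)
  have m0 : ¬ _ := fun hk => false_of_best_coordinate (x := x) (y := u) (z := z) (u := y)
    (i := 2) (j := 1) (k := 0) (e := r 2)
    (f := r 1) (by linarith) (by linarith) (by linarith) (by linarith)
    hx1 hu1 hz1 hy1 hx0 hu0 hz0 hy0 (by simp only [signedDet] at *; linarith)
    (by simp only [signedDet] at *; linarith) (by simp only [signedDet] at *; linarith)
    (by simp only [signedDet] at *; linarith) hk
    (by linarith) (by linarith) (by linarith) (by linarith)
  clear T1 T2 T3 T4 t1 t2 t3 t4 r12 r13 r14 r23 r24 r34 s12 s13 s14 s23 s24 s34 t12 t13 t14 t23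
    t24 t34
  push Not at m0 m1 m2
  obtain ⟨n2, m2⟩ := m2
  obtain ⟨n1, m1⟩ := m1
  obtain ⟨n0, m0⟩ := m0
  -- A coordinate with both sums small would qualify as k, so there is none. But then the coordinate
  -- with the largest product of deficits qualifies.
  have b2 : ¬ (x 2 + u 2 < 1 ∧ z 2 + y 2 < 1) := fun h => absurd (n2 h.1) (by linarith [h.2])
  have b1 : ¬ (x 1 + z 1 < 1 ∧ y 1 + u 1 < 1) := fun h => absurd (n1 h.1) (by linarith [h.2])
  have b0 : ¬ (x 0 + y 0 < 1 ∧ z 0 + u 0 < 1) := fun h => absurd (n0 h.1) (by linarith [h.2])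
  have key := fun h => m2 (fun h' => not_lt.1 fun h'' => b0 ⟨h', h''⟩)
    (fun h' => not_lt.1 fun h'' => b1 ⟨h', h''⟩) h
  have key1 := fun h => m1 (fun h' => not_lt.1 fun h'' => b0 ⟨h', by linarith⟩)
    (fun h' => not_lt.1 fun h'' => b2 ⟨h', by linarith⟩) h
  have key0 := fun h => m0 (fun h' => not_lt.1 fun h'' => b2 ⟨h', by linarith⟩)
    (fun h' => not_lt.1 fun h'' => b1 ⟨h', by linarith⟩) h
  by_cases c1 : (1 - x 0) * (1 - y 0) * ((1 - z 0) * (1 - u 0)) ≤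
      (1 - x 2) * (1 - y 2) * ((1 - z 2) * (1 - u 2))
  · have := key c1
    have := key1 (by linarith)
    linarith
  · by_cases c2 : (1 - x 1) * (1 - y 1) * ((1 - z 1) * (1 - u 1)) ≤
      (1 - x 0) * (1 - y 0) * ((1 - z 0) * (1 - u 0))
    · have := key0 (by linarith)
      linarith
    · have := key1 (by linarith)
      linarith

/-! ### Triples of contacts with determinant at least two. -/

/-- Some p in D gives 1 ≤ ⟨y, p⟩ = ∑ a i ⟨U i, p⟩ ≤ ∑ |a i|. If the sum were at most 1, every row
with a i ≠ 0 would take the value ±1 at p. By strictness there is only one such row, and its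
coefficient is too small. -/
theorem one_lt_sum_abs_of_strict_contacts {D : Set (Fin 3 → ℝ)} {U : Fin 3 → Fin 3 → ℤ}
    (hfeas : ∀ x : Fin 3 → ℤ, x ≠ 0 → ∃ p ∈ D, 1 ≤ ∑ j, (x j : ℝ) * p j)
    (hle : ∀ p ∈ D, ∀ i, |∑ j, (U i j : ℝ) * p j| ≤ 1)
    (hstr : ∀ p ∈ D, ∀ i j, |∑ l, (U i l : ℝ) * p l| = 1 → |∑ l, (U j l : ℝ) * p l| = 1 → i = j)
    {y : Fin 3 → ℤ} (hy : y ≠ 0) {a : Fin 3 → ℝ} (hya : ∀ j, (y j : ℝ) = ∑ i, a i * U i j)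
    (ha : ∀ i, |a i| < 1) : 1 < ∑ i, |a i| := by
  obtain ⟨p, hp, h1⟩ := hfeas y hy
  set t : Fin 3 → ℝ := fun i => ∑ j, (U i j : ℝ) * p j with ht
  have h2 : ∑ j, (y j : ℝ) * p j = ∑ i, a i * t i := by
    simp only [hya, ht, Fin.sum_univ_three]
    ring
  rw [h2] at h1
  have h3 : ∀ i, a i * t i ≤ |a i| * |t i| := fun i => by
    rw [← abs_mul]; exact le_abs_self _
  have h4 : ∀ i, |a i| * |t i| ≤ |a i| := fun i =>
    mul_le_of_le_one_right (abs_nonneg _) (hle p hp i)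
  by_contra hlt
  push Not at hlt
  have h5 : ∀ i, a i ≠ 0 → |t i| = 1 := by
    have key : ∀ i, |a i| * |t i| = |a i| := by
      have hs : ∑ i, (|a i| - |a i| * |t i|) ≤ 0 := by
        rw [Finset.sum_sub_distrib]
        have := Finset.sum_le_sum fun i (_ : i ∈ Finset.univ) => h3 i
        linarith
      have hs' := (Finset.sum_eq_zero_iff_of_nonneg (s := Finset.univ)
        (fun i _ => sub_nonneg.2 (h4 i))).1
        (le_antisymm hs (Finset.sum_nonneg fun i _ => sub_nonneg.2 (h4 i)))
      intro i
      have := hs' i (Finset.mem_univ i)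
      linarith
    intro i hi
    exact mul_left_cancel₀ (abs_ne_zero.2 hi) ((key i).trans (mul_one _).symm)
  have h6 : ∃ i, a i ≠ 0 := by
    by_contra h
    push Not at h
    simp only [h, zero_mul, Finset.sum_const_zero] at h1
    linarith
  obtain ⟨i, hi⟩ := h6
  have h7 : ∀ j, j ≠ i → a j = 0 := by
    intro j hj
    by_contra h
    exact hj (hstr p hp j i (h5 j h) (h5 i hi))
  rw [Finset.sum_eq_single i (fun j _ hj => by rw [h7 j hj, zero_mul]) (by simp)] at h1
  linarith [h3 i, h4 i, ha i]

theorem exists_sum_smul_eq_det_smul (U : Matrix (Fin 3) (Fin 3) ℤ) (x : Fin 3 → ℤ) :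
    ∃ c : Fin 3 → ℤ, ∀ j, |U.det| * x j = ∑ i, c i * U i j := by
  have h : ∀ j, U.det * x j = ∑ i, (Matrix.vecMul x U.adjugate) i * U i j := by
    intro j
    have h1 : Matrix.vecMul (Matrix.vecMul x U.adjugate) U = U.det • x := by
      rw [Matrix.vecMul_vecMul, Matrix.adjugate_mul, Matrix.vecMul_smul, Matrix.vecMul_one]
    have h2 := congrFun h1 j
    rw [Pi.smul_apply, smul_eq_mul] at h2
    rw [← h2]
    rfl
  rcases abs_choice U.det with hd | hd
  · exact ⟨_, fun j => by rw [hd]; exact h j⟩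
  · refine ⟨fun i => -(Matrix.vecMul x U.adjugate) i, fun j => ?_⟩
    rw [hd, neg_mul, h j, ← Finset.sum_neg_distrib]
    simp only [neg_mul]

/-- Modulo the rows of U, x becomes a vector y with coefficients r i / d, d = |det U|, of absolute
value at most 1/2. If y ≠ 0, these have absolute sum greater than 1. Then 2y - ∑ sign(r i) U i has
coefficients of absolute sum at most 3 - 2 ∑ |r i| / d < 1, so it vanishes by
`one_lt_sum_abs_of_strict_contacts`. Hence y is a combination of the rows with all coefficients
±1/2. -/
theorem exists_two_mul_eq_of_strict_contacts {D : Set (Fin 3 → ℝ)} {U : Matrix (Fin 3) (Fin 3) ℤ}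
    (hfeas : ∀ x : Fin 3 → ℤ, x ≠ 0 → ∃ p ∈ D, 1 ≤ ∑ j, (x j : ℝ) * p j)
    (hle : ∀ p ∈ D, ∀ i, |∑ j, (U i j : ℝ) * p j| ≤ 1)
    (hstr : ∀ p ∈ D, ∀ i j, |∑ l, (U i l : ℝ) * p l| = 1 → |∑ l, (U j l : ℝ) * p l| = 1 → i = j)
    (hdet : U.det ≠ 0) (x : Fin 3 → ℤ) :
    ∃ (k : Fin 3 → ℤ) (e : ℤ), (e = 0 ∨ e = 1) ∧
      ∀ j, 2 * x j = ∑ i, (2 * k i + e) * U i j := by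
  obtain ⟨c, hc⟩ := exists_sum_smul_eq_det_smul U x
  set d := |U.det| with hd
  have hd0 : 0 < d := abs_pos.2 hdet
  have hdr : (0 : ℝ) < d := by exact_mod_cast hd0
  obtain ⟨k, r, hkr, hr⟩ : ∃ k r : Fin 3 → ℤ, (∀ i, c i = d * k i + r i) ∧ ∀ i, 2 * |r i| ≤ d := by
    have : ∀ i, ∃ k r : ℤ, c i = d * k + r ∧ 2 * |r| ≤ d := by
      intro i
      have h1 := Int.emod_add_mul_ediv (c i) d
      have h2 := Int.emod_nonneg (c i) hd0.ne'
      have h3 := Int.emod_lt_of_pos (c i) hd0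
      rcases le_or_gt (2 * (c i % d)) d with h | h
      · exact ⟨c i / d, c i % d, by linarith, by rw [abs_of_nonneg h2]; exact h⟩
      · refine ⟨c i / d + 1, c i % d - d, by linarith, ?_⟩
        rw [abs_of_neg (by linarith)]
        linarith
    choose k r h using this
    exact ⟨k, r, fun i => (h i).1, fun i => (h i).2⟩
  clear_value d
  have hinj : ∀ s : Fin 3 → ℤ, (∀ j, ∑ i, s i * U i j = 0) → s = 0 := by
    intro s hs
    exact Matrix.eq_zero_of_vecMul_eq_zero hdet (funext hs)
  set y : Fin 3 → ℤ := fun j => x j - ∑ i, k i * U i j with hy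
  have hdy : ∀ j, d * y j = ∑ i, r i * U i j := by
    intro j
    have := hc j
    simp only [hy, hkr, Fin.sum_univ_three] at this ⊢
    linarith
  -- the general tool: a small combination of the contacts is zero
  have tool : ∀ (z s : Fin 3 → ℤ), (∀ j, d * z j = ∑ i, s i * U i j) → (∀ i, |s i| < d) →
      z ≠ 0 → d < ∑ i, |s i| := by
    intro z s hz hs hz0
    have h := one_lt_sum_abs_of_strict_contacts hfeas hle hstr hz0 (a := fun i => (s i : ℝ) / d)
      (fun j => by
        have : (d : ℝ) * z j = ∑ i, (s i : ℝ) * U i j := by exact_mod_cast hz j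
        rw [eq_comm]
        simp only [Fin.sum_univ_three] at this ⊢
        field_simp
        linarith)
      (fun i => by
        rw [abs_div, abs_of_pos hdr, div_lt_one hdr]
        exact_mod_cast hs i)
    simp only [abs_div, abs_of_pos hdr] at h
    rw [← Finset.sum_div, one_lt_div hdr] at h
    exact_mod_cast h
  have hrlt : ∀ i, |r i| < d := fun i => by
    have := hr i
    have := abs_nonneg (r i)
    omega
  by_cases hy0 : y = 0
  · refine ⟨k, 0, Or.inl rfl, fun j => ?_⟩
    have := congrFun hy0 j
    simp only [hy, Pi.zero_apply, Fin.sum_univ_three] at this ⊢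
    linarith
  · have hN := tool y r hdy hrlt hy0
    set z : Fin 3 → ℤ := fun j => 2 * y j - ∑ i, (r i).sign * U i j with hz
    have hdz : ∀ j, d * z j = ∑ i, (2 * r i - d * (r i).sign) * U i j := by
      intro j
      have := hdy j
      simp only [hz, Fin.sum_univ_three] at this ⊢
      linear_combination 2 * this
    have hs : ∀ i, |2 * r i - d * (r i).sign| < d ∧
        |2 * r i - d * (r i).sign| ≤ d - 2 * |r i| := by
      intro i
      have := hr i
      rcases lt_trichotomy (r i) 0 with h | h | h
      · rw [Int.sign_eq_neg_one_of_neg h]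
        rw [abs_of_neg h] at this ⊢
        rw [abs_of_nonneg (by linarith)]
        constructor <;> linarith
      · rw [h]; simp [hd0]; exact hd0.le
      · rw [Int.sign_eq_one_of_pos h]
        rw [abs_of_pos h] at this ⊢
        rw [abs_of_nonpos (by linarith)]
        constructor <;> linarith
    have hz0 : z = 0 := by
      by_contra h
      have h1 := tool z _ hdz (fun i => (hs i).1) h
      simp only [Fin.sum_univ_three] at h1 hN
      linarith [(hs 0).2, (hs 1).2, (hs 2).2]
    have hsz := hinj (fun i => 2 * r i - d * (r i).sign) (fun j => by rw [← hdz j, hz0]; simp)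
    have hsz' : ∀ i, 2 * r i = d * (r i).sign := fun i => by
      have := congrFun hsz i
      simp only [Pi.zero_apply] at this
      linarith
    -- Three terms of size at most d/2 have a sum exceeding d only if none of them is zero.
    have hr0 : ∀ i, r i ≠ 0 := by
      simp only [Fin.sum_univ_three] at hN
      have h0 := hr 0
      have h1 := hr 1
      have h2 := hr 2
      have a0 := abs_nonneg (r 0)
      have a1 := abs_nonneg (r 1)
      have a2 := abs_nonneg (r 2)
      intro i hi
      have : |r i| = 0 := by rw [hi]; rfl
      fin_cases i <;> simp only [Fin.zero_eta, Fin.mk_one, Fin.reduceFinMk] at this <;> omega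
    have hsg : ∀ i, ∃ l : ℤ, (r i).sign = 2 * l + 1 := by
      intro i
      rcases lt_trichotomy (r i) 0 with h | h | h
      · exact ⟨-1, by rw [Int.sign_eq_neg_one_of_neg h]; norm_num⟩
      · exact absurd h (hr0 i)
      · exact ⟨0, by rw [Int.sign_eq_one_of_pos h]; norm_num⟩
    choose l hl using hsg
    refine ⟨fun i => k i + l i, 1, Or.inr rfl, fun j => ?_⟩
    have := congrFun hz0 j
    simp only [hz, hy, hl, Pi.zero_apply, Fin.sum_univ_three] at this ⊢
    linarith

/-- Applied to the standard basis, the previous result gives KU = 2 with every row of K congruent to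
a multiple of (1, 1, 1) modulo 2. Hence 4 divides det K, and det K · det U = 8 makes det U a divisor
of 2. If half the row sum were not integral, e would always be 0 and U would be invertible over the
integers. -/
theorem abs_det_eq_two_of_strict_contacts {D : Set (Fin 3 → ℝ)} {U : Matrix (Fin 3) (Fin 3) ℤ}
    (hfeas : ∀ x : Fin 3 → ℤ, x ≠ 0 → ∃ p ∈ D, 1 ≤ ∑ j, (x j : ℝ) * p j)
    (hle : ∀ p ∈ D, ∀ i, |∑ j, (U i j : ℝ) * p j| ≤ 1)
    (hstr : ∀ p ∈ D, ∀ i j, |∑ l, (U i l : ℝ) * p l| = 1 → |∑ l, (U j l : ℝ) * p l| = 1 → i = j)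
    (hdet : 2 ≤ |U.det|) :
    |U.det| = 2 ∧ ∃ w : Fin 3 → ℤ, ∀ j, 2 * w j = U 0 j + U 1 j + U 2 j := by
  have hdet0 : U.det ≠ 0 := by
    intro h
    rw [h] at hdet
    norm_num at hdet
  have h := fun x => exists_two_mul_eq_of_strict_contacts hfeas hle hstr hdet0 x
  choose k e he hk using h
  constructor
  · set K : Matrix (Fin 3) (Fin 3) ℤ :=
      Matrix.of fun a i => 2 * k (Pi.single a 1) i + e (Pi.single a 1) with hK
    have h1 : K * U = (2 : ℤ) • (1 : Matrix (Fin 3) (Fin 3) ℤ) := by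
      ext a j
      rw [Matrix.mul_apply]
      simp only [hK, Matrix.of_apply]
      rw [← hk (Pi.single a 1) j, Matrix.smul_apply, Matrix.one_apply, Pi.single_apply, smul_eq_mul]
      simp only [eq_comm]
    have h2 : K.det * U.det = 8 := by
      rw [← Matrix.det_mul, h1, Matrix.det_smul, Matrix.det_one]
      norm_num
    have h3 : (4 : ℤ) ∣ K.det := by
      have e2 : ∀ a, e (Pi.single a 1) * e (Pi.single a 1) = e (Pi.single a 1) := fun a => by
        rcases he (Pi.single a 1) with h | h <;> rw [h] <;> norm_num
      rw [Matrix.det_fin_three]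
      simp only [hK, Matrix.of_apply]
      generalize e (Pi.single 0 1) = e0
      generalize e (Pi.single 1 1) = e1
      generalize e (Pi.single 2 1) = e2
      generalize k (Pi.single 0 1) = a
      generalize k (Pi.single 1 1) = b
      generalize k (Pi.single 2 1) = c
      refine ⟨2 * (a 0 * (b 1 * c 2 - b 2 * c 1) - a 1 * (b 0 * c 2 - b 2 * c 0)
        + a 2 * (b 0 * c 1 - b 1 * c 0))
        + e0 * ((b 1 * c 2 - b 2 * c 1) - (b 0 * c 2 - b 2 * c 0) + (b 0 * c 1 - b 1 * c 0))
        + e1 * ((a 2 * c 1 - a 1 * c 2) - (a 2 * c 0 - a 0 * c 2) + (a 1 * c 0 - a 0 * c 1))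
        + e2 * ((a 1 * b 2 - a 2 * b 1) - (a 0 * b 2 - a 2 * b 0) + (a 0 * b 1 - a 1 * b 0)), ?_⟩
      ring
    obtain ⟨t, ht⟩ := h3
    rw [ht] at h2
    have h4 : U.det ∣ 2 := ⟨t, by linarith⟩
    have h5 := Int.le_of_dvd (by norm_num) ((abs_dvd _ _).2 h4)
    omega
  · by_contra hw
    have he0 : ∀ x, e x = 0 := by
      intro x
      refine (he x).resolve_right fun h => hw ⟨fun j => x j - ∑ i, k x i * U i j, fun j => ?_⟩
      have := hk x j
      rw [h] at this
      simp only [Fin.sum_univ_three] at this ⊢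
      linarith
    set K : Matrix (Fin 3) (Fin 3) ℤ := Matrix.of fun a i => k (Pi.single a 1) i with hK
    have h1 : K * U = 1 := by
      ext a j
      rw [Matrix.mul_apply]
      simp only [hK, Matrix.of_apply]
      have h2 := hk (Pi.single a 1) j
      simp only [he0, add_zero, mul_assoc, ← Finset.mul_sum] at h2
      have h3 := mul_left_cancel₀ two_ne_zero h2
      rw [← h3, Matrix.one_apply, Pi.single_apply]
      simp only [eq_comm]
    have h2 : IsUnit U.det := (Matrix.isUnit_iff_isUnit_det _).1 (IsUnit.of_mul_eq_one_right _ h1)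
    rw [Int.isUnit_iff_abs_eq] at h2
    omega

/-- The coordinates ⟨U i, p⟩ put D in a cube whose facets it touches. Half the row sum, minus
suitable rows, gives the other signed half-sums; these are nonzero integer vectors, so the support
along each diagonal is at least 2. The change of coordinates doubles determinants. -/
theorem exists_one_half_le_abs_det3_of_strict_contacts {D : Set (Fin 3 → ℝ)}
    {U : Matrix (Fin 3) (Fin 3) ℤ} (hneg : ∀ p ∈ D, -p ∈ D)
    (hstar : ∀ p ∈ D, ∀ c : ℝ, 0 ≤ c → c ≤ 1 → c • p ∈ D)
    (hfeas : ∀ x : Fin 3 → ℤ, x ≠ 0 → ∃ p ∈ D, 1 ≤ ∑ j, (x j : ℝ) * p j)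
    (hle : ∀ p ∈ D, ∀ i, ∑ j, (U i j : ℝ) * p j ≤ 1)
    (hstr : ∀ p ∈ D, ∀ i j, |∑ l, (U i l : ℝ) * p l| = 1 → |∑ l, (U j l : ℝ) * p l| = 1 → i = j)
    (hdet : 2 ≤ |U.det|) :
    ∃ p ∈ D, ∃ q ∈ D, ∃ r ∈ D, 1 / 2 ≤ |det3 p q r| := by
  have hle' : ∀ p ∈ D, ∀ i, |∑ j, (U i j : ℝ) * p j| ≤ 1 := by
    intro p hp i
    refine abs_le.2 ⟨?_, hle p hp i⟩
    have := hle _ (hneg p hp) i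
    simp only [Pi.neg_apply, mul_neg, Finset.sum_neg_distrib] at this
    linarith
  obtain ⟨hd2, w, hw⟩ := abs_det_eq_two_of_strict_contacts hfeas hle' hstr hdet
  have hdet0 : U.det ≠ 0 := by
    intro h
    rw [h] at hdet
    norm_num at hdet
  have hinj : ∀ s : Fin 3 → ℤ, (∀ j, ∑ i, s i * U i j = 0) → s = 0 := fun s hs =>
    Matrix.eq_zero_of_vecMul_eq_zero hdet0 (funext hs)
  set T : (Fin 3 → ℝ) → Fin 3 → ℝ := fun p i => ∑ j, (U i j : ℝ) * p j with hT
  have hmid : ∀ (x s : Fin 3 → ℤ), s 0 ≠ 0 → (∀ j, 2 * x j = ∑ i, s i * U i j) →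
      ∃ q ∈ T '' D, 2 ≤ s 0 * q 0 + s 1 * q 1 + s 2 * q 2 := by
    intro x s hs hx
    have hx0 : x ≠ 0 := by
      rintro rfl
      exact hs (congrFun (hinj s fun j => by rw [← hx j]; simp) 0)
    obtain ⟨p, hp, h1⟩ := hfeas x hx0
    refine ⟨T p, ⟨p, hp, rfl⟩, ?_⟩
    have hx' : ∀ j, 2 * (x j : ℝ) = ∑ i, (s i : ℝ) * U i j := fun j => by exact_mod_cast hx j
    simp only [Fin.sum_univ_three] at h1 hx'
    simp only [hT, Fin.sum_univ_three]
    linear_combination 2 * h1 + p 0 * hx' 0 + p 1 * hx' 1 + p 2 * hx' 2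
  obtain ⟨_, ⟨p, hp, rfl⟩, _, ⟨q, hq, rfl⟩, _, ⟨r, hr, rfl⟩, h1⟩ :=
    exists_one_le_abs_det3_of_subset_cube (D := T '' D)
      (by rintro _ ⟨p, hp, rfl⟩ i; exact hle p hp i)
      (by
        rintro _ ⟨p, hp, rfl⟩
        refine ⟨-p, hneg p hp, ?_⟩
        ext i
        simp only [hT, Pi.neg_apply, mul_neg, Finset.sum_neg_distrib])
      (by
        rintro _ ⟨p, hp, rfl⟩ c hc hc1
        refine ⟨c • p, hstar p hp c hc hc1, ?_⟩
        ext i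
        simp only [hT, Pi.smul_apply, smul_eq_mul, Finset.mul_sum]
        exact Finset.sum_congr rfl fun j _ => by ring)
      (by
        intro i
        have hi : U i ≠ 0 := by
          intro h
          have := hinj (Pi.single i 1) (fun j => by
            rw [Finset.sum_eq_single i (fun b _ hb => by simp [hb]) (by simp)]
            simp [h])
          simpa using congrFun this i
        obtain ⟨p, hp, h1⟩ := hfeas (U i) hi
        exact ⟨T p, ⟨p, hp, rfl⟩, le_antisymm (hle p hp i) h1⟩)
      (by
        obtain ⟨q, hq, h⟩ := hmid w ![1, 1, 1] (by simp) (fun j => by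
          rw [hw]; simp [Fin.sum_univ_three])
        exact ⟨q, hq, by simpa using h⟩)
      (by
        obtain ⟨q, hq, h⟩ := hmid (fun j => w j - U 1 j - U 2 j) ![1, -1, -1] (by simp) (fun j => by
          have := hw j
          simp [Fin.sum_univ_three]; linarith)
        exact ⟨q, hq, by simp at h; linarith⟩)
      (by
        obtain ⟨q, hq, h⟩ := hmid (fun j => w j - U 0 j - U 2 j) ![-1, 1, -1] (by simp) (fun j => by
          have := hw j
          simp [Fin.sum_univ_three]; linarith)
        exact ⟨q, hq, by simp at h; linarith⟩)
      (by
        obtain ⟨q, hq, h⟩ := hmid (fun j => w j - U 0 j - U 1 j) ![-1, -1, 1] (by simp) (fun j => by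
          have := hw j
          simp [Fin.sum_univ_three]; linarith)
        exact ⟨q, hq, by simp at h; linarith⟩)
  refine ⟨p, hp, q, hq, r, hr, ?_⟩
  have h2 : det3 (T p) (T q) (T r) = U.det * det3 p q r := by
    rw [det3_eq, det3_eq, Matrix.det_fin_three]
    simp only [hT, Fin.sum_univ_three]
    push_cast
    ring
  have h3 : |(U.det : ℝ)| = 2 := by exact_mod_cast hd2
  rw [h2, abs_mul, h3] at h1
  linarith

/-! ### Unimodular systems in dimension three as roots of A₃. -/

/-- Vectors of a unimodular system in coordinates with respect to a basis of the system. -/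
theorem exists_matrix_of_unimodular_coordinates {W : Set (Fin 3 → ℤ)}
    (h1 : ∀ v ∈ W, ∀ i, |v i| ≤ 1)
    (h2 : ∀ v ∈ W, ∀ w ∈ W, ∀ i j, |v i * w j - v j * w i| ≤ 1)
    (h3 : ∀ u ∈ W, ∀ v ∈ W, ∀ w ∈ W, |(Matrix.of ![u, v, w]).det| ≤ 1) :
    ∃ B : Matrix (Fin 3) (Fin 3) ℤ, |B.det| = 2 ∧ ∀ v ∈ W, ∑ i, (B.mulVec v i) ^ 2 ≤ 2 := by
  -- If v i * v j = -1 and w i * w j = 1, the minor of v and w would be ±2. So the nonzero products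
  -- of two given coordinates share a sign.
  have hσ : ∀ i j, ∃ σ : ℤ, (σ = 1 ∨ σ = -1) ∧ ∀ v ∈ W, v i * v j = 0 ∨ v i * v j = σ := by
    intro i j
    by_cases h : ∃ v ∈ W, v i * v j = -1
    · obtain ⟨v, hv, hvij⟩ := h
      refine ⟨-1, Or.inr rfl, fun w hw => ?_⟩
      have a1 := abs_le.1 (h1 v hv i)
      have a2 := abs_le.1 (h1 v hv j)
      have a3 := abs_le.1 (h1 w hw i)
      have a4 := abs_le.1 (h1 w hw j)
      have a5 := abs_le.1 (h2 v hv w hw i j)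
      generalize v i = vi at *
      generalize v j = vj at *
      generalize w i = wi at *
      generalize w j = wj at *
      obtain ⟨b1, b1'⟩ := a1
      obtain ⟨b2, b2'⟩ := a2
      obtain ⟨b3, b3'⟩ := a3
      obtain ⟨b4, b4'⟩ := a4
      interval_cases vi <;> interval_cases vj <;> first | omega | skip
      all_goals interval_cases wi <;> interval_cases wj <;> omega
    · push Not at h
      refine ⟨1, Or.inl rfl, fun w hw => ?_⟩
      have a3 := abs_le.1 (h1 w hw i)
      have a4 := abs_le.1 (h1 w hw j)
      have a5 := h w hw
      generalize w i = wi at *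
      generalize w j = wj at *
      obtain ⟨b3, b3'⟩ := a3
      obtain ⟨b4, b4'⟩ := a4
      interval_cases wi <;> interval_cases wj <;> omega
  have hsq : ∀ v ∈ W, ∀ i, v i ^ 2 = 0 ∧ v i = 0 ∨ v i ^ 2 = 1 ∧ v i ≠ 0 := by
    intro v hv i
    have a1 := abs_le.1 (h1 v hv i)
    generalize v i = vi at *
    obtain ⟨b1, b1'⟩ := a1
    interval_cases vi <;> simp
  -- no vector has support `{j, k}`
  have hcase : ∀ i j k : Fin 3, (∀ f : Fin 3 → ℤ, ∑ l, f l = f i + f j + f k) →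
      (∀ v ∈ W, v i = 0 → v j * v k = 0) →
      (∀ a b c : Fin 3 → ℤ, |(Matrix.of fun r l => if l = i then a r else if l = j then b r else c r
        : Matrix (Fin 3) (Fin 3) ℤ).det| = |(Matrix.of ![a, b, c]).det|) → i ≠ j → i ≠ k → j ≠ k →
      ∃ B : Matrix (Fin 3) (Fin 3) ℤ, |B.det| = 2 ∧ ∀ v ∈ W, ∑ i, (B.mulVec v i) ^ 2 ≤ 2 := by
    intro i j k hsum hex hB hij hik hjk
    obtain ⟨s, hs, hsW⟩ := hσ i j
    obtain ⟨t, ht, htW⟩ := hσ i k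
    -- The sum of squares becomes 2x² + 2y² + 2z² - 2sxy - 2txz. For x ≠ 0 the sign pattern reduces
    -- it to 2x²; for x = 0 at most one of y, z is nonzero.
    refine ⟨Matrix.of fun r l => if l = i then ![1, 1, 0] r else if l = j then ![-s, 0, -s] r
      else ![-t, 0, t] r, ?_, ?_⟩
    · rw [hB, Matrix.det_fin_three]
      rcases hs with rfl | rfl <;> rcases ht with rfl | rfl <;> simp
    · intro v hv
      rw [Fin.sum_univ_three]
      simp only [Matrix.mulVec, dotProduct, hsum, Matrix.of_apply, if_true,
        hij.symm, hik.symm, hjk.symm, if_false]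
      simp
      have e1 := hsW v hv
      have e2 := htW v hv
      have e3 := hex v hv
      have d1 := hsq v hv i
      have d2 := hsq v hv j
      have d3 := hsq v hv k
      generalize v i = x at *
      generalize v j = y at *
      generalize v k = z at *
      have s2 : s * s = 1 := by rcases hs with rfl | rfl <;> norm_num
      have t2 : t * t = 1 := by rcases ht with rfl | rfl <;> norm_num
      have key : (x + -(s * y) + -(t * z)) ^ 2 + x ^ 2 + (-(s * y) + t * z) ^ 2 =
        2 * x ^ 2 + 2 * y ^ 2 + 2 * z ^ 2 - 2 * (s * (x * y)) - 2 * (t * (x * z)) := by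
        linear_combination (2 * y ^ 2) * s2 + (2 * z ^ 2) * t2
      rw [key]
      rcases d1 with ⟨d1, f1⟩ | ⟨d1, f1⟩
      · have := e3 f1
        rw [d1, f1]
        rcases mul_eq_zero.1 this with h | h <;> rw [h]
        · rcases d3 with ⟨d3, -⟩ | ⟨d3, -⟩ <;> rw [d3] <;> norm_num
        · rcases d2 with ⟨d2, -⟩ | ⟨d2, -⟩ <;> rw [d2] <;> norm_num
      · have g1 : 2 * y ^ 2 - 2 * (s * (x * y)) = 0 := by
          rcases d2 with ⟨d2, f2⟩ | ⟨d2, f2⟩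
          · rw [f2]; ring
          · rcases e1 with h | h
            · exact absurd h (mul_ne_zero f1 f2)
            · rw [h, s2, d2]; norm_num
        have g2 : 2 * z ^ 2 - 2 * (t * (x * z)) = 0 := by
          rcases d3 with ⟨d3, f3⟩ | ⟨d3, f3⟩
          · rw [f3]; ring
          · rcases e2 with h | h
            · exact absurd h (mul_ne_zero f1 f3)
            · rw [h, t2, d3]; norm_num
        linarith
  by_cases c0 : ∀ v ∈ W, v 0 = 0 → v 1 * v 2 = 0
  · exact hcase 0 1 2 (fun f => Fin.sum_univ_three f) c0
      (fun a b c => by congr 1; simp [Matrix.det_fin_three]; ring) (by decide) (by decide)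
      (by decide)
  by_cases c1 : ∀ v ∈ W, v 1 = 0 → v 0 * v 2 = 0
  · exact hcase 1 0 2 (fun f => by rw [Fin.sum_univ_three]; ring) c1
      (fun a b c => by rw [← abs_neg]; congr 1; simp [Matrix.det_fin_three]; ring) (by decide)
      (by decide) (by decide)
  by_cases c2 : ∀ v ∈ W, v 2 = 0 → v 0 * v 1 = 0
  · exact hcase 2 0 1 (fun f => by rw [Fin.sum_univ_three]; ring) c2
      (fun a b c => by congr 1; simp [Matrix.det_fin_three]; ring) (by decide) (by decide)
      (by decide)
  push Not at c0 c1 c2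
  obtain ⟨u, hu, u0, hu12⟩ := c0
  obtain ⟨v, hv, v1, hv02⟩ := c1
  obtain ⟨w, hw, w2, hw01⟩ := c2
  obtain ⟨s, hs, hsW⟩ := hσ 0 1
  obtain ⟨t, ht, htW⟩ := hσ 0 2
  obtain ⟨r, hr, hrW⟩ := hσ 1 2
  have s2 : s * s = 1 := by rcases hs with rfl | rfl <;> norm_num
  have t2 : t * t = 1 := by rcases ht with rfl | rfl <;> norm_num
  have r2 : r * r = 1 := by rcases hr with rfl | rfl <;> norm_num
  -- For the three vectors with supports of size two, the determinant is, up to sign, a sum of two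
  -- terms ±1 whose product is s t r. As it is at most 1 in absolute value, the terms cancel.
  have hprod : s * t * r = -1 := by
    have k1 := (hsW w hw).resolve_left hw01
    have k2 := (htW v hv).resolve_left hv02
    have k3 := (hrW u hu).resolve_left hu12
    have hd := h3 u hu v hv w hw
    rw [Matrix.det_fin_three] at hd
    simp [u0, v1, w2] at hd
    have hd3 : |u 1 * v 2 * w 0 + u 2 * v 0 * w 1| ≤ 1 := by
      convert hd using 2
    have hm : (u 1 * v 2 * w 0) * (u 2 * v 0 * w 1) = s * t * r := by
      rw [← k1, ← k2, ← k3]; ring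
    have hsq1 : (u 1 * v 2 * w 0) ^ 2 = 1 := by
      have q1 := ((hsq u hu 1).resolve_left fun h => hu12 (by rw [h.2, zero_mul])).1
      have q2 := ((hsq v hv 2).resolve_left fun h => hv02 (by rw [h.2, mul_zero])).1
      have q3 := ((hsq w hw 0).resolve_left fun h => hw01 (by rw [h.2, zero_mul])).1
      rw [mul_pow, mul_pow, q1, q2, q3]; norm_num
    have hb := abs_le.1 hd3
    have hA : u 1 * v 2 * w 0 = 1 ∨ u 1 * v 2 * w 0 = -1 := sq_eq_one_iff.1 hsq1
    rcases hs with rfl | rfl <;> rcases ht with rfl | rfl <;> rcases hr with rfl | rfl <;>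
      rcases hA with h | h <;> rw [h] at hm hb <;> omega
  -- Since s t = -r, the sum of squares is 2(a² + b² + c² - s a b - t a c - r b c), which is at most
  -- 2 unless the support is full. Full support is impossible: the product of the three mixed
  -- products would be 1, not s t r = -1.
  refine ⟨!![1, -s, 0; 1, 0, -t; 0, -s, -t], ?_, ?_⟩
  · rw [Matrix.det_fin_three]
    rcases hs with rfl | rfl <;> rcases ht with rfl | rfl <;> simp
  · intro x hx
    simp [Fin.sum_univ_three, Matrix.mulVec, dotProduct]
    have e1 := hsW x hx
    have e2 := htW x hx
    have e3 := hrW x hx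
    have d1 := hsq x hx 0
    have d2 := hsq x hx 1
    have d3 := hsq x hx 2
    clear hx
    generalize x 0 = a at *
    generalize x 1 = b at *
    generalize x 2 = c at *
    have hst : s * t = -r := by
      linear_combination r * hprod - s * t * r2
    have key : (a + -(s * b)) ^ 2 + (a + -(t * c)) ^ 2 + (-(s * b) + -(t * c)) ^ 2 =
        2 * a ^ 2 + 2 * b ^ 2 + 2 * c ^ 2 - 2 * (s * (a * b)) - 2 * (t * (a * c))
          - 2 * (r * (b * c)) := by
      linear_combination (2 * b ^ 2) * s2 + (2 * c ^ 2) * t2 + 2 * (b * c) * hst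
    rw [key]
    rcases d1 with ⟨d1, f1⟩ | ⟨d1, f1⟩ <;> rcases d2 with ⟨d2, f2⟩ | ⟨d2, f2⟩ <;>
      rcases d3 with ⟨d3, f3⟩ | ⟨d3, f3⟩
    · simp [f1, f2, f3]
    · simp [f1, f2, d3]
    · simp [f1, f3, d2]
    · simp [f1, d2, d3, e3.resolve_left (mul_ne_zero f2 f3), r2]
    · simp [f2, f3, d1]
    · simp [f2, d1, d3, e2.resolve_left (mul_ne_zero f1 f3), t2]
    · simp [f3, d1, d2, e1.resolve_left (mul_ne_zero f1 f2), s2]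
    · have : s * t * r = a ^ 2 * b ^ 2 * c ^ 2 := by
        rw [← e1.resolve_left (mul_ne_zero f1 f2), ← e2.resolve_left (mul_ne_zero f1 f3),
          ← e3.resolve_left (mul_ne_zero f2 f3)]
        ring
      rw [hprod, d1, d2, d3] at this
      norm_num at this

/-- In coordinates with respect to three independent vectors of W the system contains the standard
basis. Determinants with basis vectors are entries and 2 × 2 minors, which are therefore bounded by
1. -/
theorem exists_matrix_of_unimodular {W : Set (Fin 3 → ℤ)}
    (hW : ∀ u ∈ W, ∀ v ∈ W, ∀ w ∈ W, |(Matrix.of ![u, v, w]).det| ≤ 1)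
    {u : Fin 3 → Fin 3 → ℤ} (hu : ∀ i, u i ∈ W) (hdet : (Matrix.of u).det ≠ 0) :
    ∃ B : Matrix (Fin 3) (Fin 3) ℤ, |B.det| = 2 ∧ ∀ v ∈ W, ∑ i, (B.mulVec v i) ^ 2 ≤ 2 := by
  set A : Matrix (Fin 3) (Fin 3) ℤ := Matrix.of u with hA
  have hA1 : |A.det| = 1 := by
    have h1 := hW _ (hu 0) _ (hu 1) _ (hu 2)
    have h2 : (Matrix.of ![u 0, u 1, u 2]) = A := by
      ext i j
      fin_cases i <;> rfl
    rw [h2] at h1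
    exact le_antisymm h1 (Int.one_le_abs hdet)
  have hunit : IsUnit A.det := Int.isUnit_iff_abs_eq.2 hA1
  have hinv : A * A⁻¹ = 1 := Matrix.mul_nonsing_inv _ hunit
  have hinv1 : |A⁻¹.det| = 1 := by
    have := congrArg (fun M => |Matrix.det M|) hinv
    simpa [Matrix.det_mul, abs_mul, hA1] using this
  set c : (Fin 3 → ℤ) → Fin 3 → ℤ := fun v => Matrix.vecMul v A⁻¹ with hc
  have hcdet : ∀ x y z, |(Matrix.of ![c x, c y, c z]).det| = |(Matrix.of ![x, y, z]).det| := by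
    intro x y z
    have : Matrix.of ![c x, c y, c z] = Matrix.of ![x, y, z] * A⁻¹ := by
      ext i j
      fin_cases i <;> rfl
    rw [this, Matrix.det_mul, abs_mul, hinv1, mul_one]
  have hW' : ∀ x ∈ c '' W, ∀ y ∈ c '' W, ∀ z ∈ c '' W, |(Matrix.of ![x, y, z]).det| ≤ 1 := by
    rintro _ ⟨x, hx, rfl⟩ _ ⟨y, hy, rfl⟩ _ ⟨z, hz, rfl⟩
    rw [hcdet]
    exact hW x hx y hy z hz
  have hbasis : ∀ i, (1 : Matrix (Fin 3) (Fin 3) ℤ) i ∈ c '' W := by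
    intro i
    refine ⟨u i, hu i, ?_⟩
    rw [← hinv]
    rfl
  have hcoord : ∀ x ∈ c '' W, ∀ i, |x i| ≤ 1 := by
    intro x hx i
    have h0 := hW' x hx _ (hbasis 1) _ (hbasis 2)
    have h1 := hW' x hx _ (hbasis 0) _ (hbasis 2)
    have h2 := hW' x hx _ (hbasis 0) _ (hbasis 1)
    rw [Matrix.det_fin_three] at h0 h1 h2
    fin_cases i
    · simpa [Matrix.one_apply] using h0
    · simpa [Matrix.one_apply] using h1
    · simpa [Matrix.one_apply] using h2
  have hminor : ∀ x ∈ c '' W, ∀ y ∈ c '' W, ∀ i j, |x i * y j - x j * y i| ≤ 1 := by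
    intro x hx y hy
    have h0 := hW' x hx y hy _ (hbasis 0)
    have h1 := hW' x hx y hy _ (hbasis 1)
    have h2 := hW' x hx y hy _ (hbasis 2)
    rw [Matrix.det_fin_three] at h0 h1 h2
    simp at h0 h1 h2
    rw [neg_add_eq_sub] at h1
    have g0 : |x 1 * y 2 - x 2 * y 1| ≤ 1 := by convert h0 using 2
    have g1 : |x 0 * y 2 - x 2 * y 0| ≤ 1 := by
      rw [abs_sub_comm]; convert h1 using 2
    have g2 : |x 0 * y 1 - x 1 * y 0| ≤ 1 := by convert h2 using 2
    intro i j
    fin_cases i <;> fin_cases j <;> simp <;> first | assumption | (rw [abs_sub_comm]; assumption)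
  obtain ⟨B, hB, hB2⟩ := exists_matrix_of_unimodular_coordinates hcoord hminor hW'
  refine ⟨B * (A⁻¹).transpose, ?_, fun v hv => ?_⟩
  · rw [Matrix.det_mul, Matrix.det_transpose, abs_mul, hB, hinv1, mul_one]
  · have := hB2 (c v) ⟨v, hv, rfl⟩
    rwa [← Matrix.mulVec_mulVec, Matrix.mulVec_transpose]

/-! ### Cauchy–Binet and the unimodular case. -/

open Equiv in
/-- The Cauchy–Binet formula for a sum of rank one matrices. -/
theorem factorial_mul_det_sum_vecMulVec {R ι : Type*} [CommRing R] {n : ℕ} (s : Finset ι)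
    (p u : ι → Fin n → R) :
    (n.factorial : R) * (∑ k ∈ s, Matrix.vecMulVec (p k) (u k)).det =
      ∑ k ∈ Fintype.piFinset fun _ : Fin n => s,
        (Matrix.of fun i => p (k i)).det * (Matrix.of fun i => u (k i)).det := by
  set S := ∑ k ∈ s, Matrix.vecMulVec (p k) (u k) with hS
  have h1 : ∀ k : Fin n → ι, (Matrix.of fun i => p (k i)).det * (Matrix.of fun i => u (k i)).det =
      ∑ σ : Perm (Fin n), ∑ τ : Perm (Fin n), ((Perm.sign σ : ℤ) : R) * ((Perm.sign τ : ℤ) : R) *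
        ∏ i, (p (k i) (σ i) * u (k i) (τ i)) := by
    intro k
    rw [← Matrix.det_transpose, ← Matrix.det_transpose (Matrix.of fun i => u (k i)),
      Matrix.det_apply', Matrix.det_apply', Finset.sum_mul_sum]
    refine Finset.sum_congr rfl fun σ _ => Finset.sum_congr rfl fun τ _ => ?_
    simp only [Matrix.transpose_apply, Matrix.of_apply]
    rw [Finset.prod_mul_distrib]
    ring
  simp only [h1]
  rw [Finset.sum_comm]
  -- For fixed σ the sum over k and τ is sign σ times the determinant of S with rows permuted by σ,
  -- hence independent of σ.
  have h2 : ∀ σ : Perm (Fin n), ∑ k ∈ Fintype.piFinset fun _ : Fin n => s,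
      ∑ τ : Perm (Fin n), ((Perm.sign σ : ℤ) : R) * ((Perm.sign τ : ℤ) : R) *
        ∏ i, (p (k i) (σ i) * u (k i) (τ i)) = S.det := by
    intro σ
    rw [Finset.sum_comm]
    have h3 : ∀ τ : Perm (Fin n), ∑ k ∈ Fintype.piFinset fun _ : Fin n => s,
        ((Perm.sign σ : ℤ) : R) * ((Perm.sign τ : ℤ) : R) *
          ∏ i, (p (k i) (σ i) * u (k i) (τ i)) =
        ((Perm.sign σ : ℤ) : R) * (((Perm.sign τ : ℤ) : R) *
          ∏ i, (S.submatrix σ id).transpose (τ i) i) := by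
      intro τ
      rw [← Finset.mul_sum, Finset.sum_prod_piFinset s (fun i k => p k (σ i) * u k (τ i)), mul_assoc]
      congr 2
      refine Finset.prod_congr rfl fun i _ => ?_
      simp [hS, Matrix.sum_apply, Matrix.vecMulVec_apply]
    simp only [h3]
    rw [← Finset.mul_sum, ← Matrix.det_apply', Matrix.det_transpose, Matrix.det_permute, ← mul_assoc,
      ← Int.cast_mul]
    simp
  simp only [h2, Finset.sum_const, Finset.card_univ, Fintype.card_perm, Fintype.card_fin, nsmul_eq_mul]

/-- AM–GM for the eigenvalues. -/
theorem det_le_of_posSemidef {M : Matrix (Fin 3) (Fin 3) ℝ} (hM : M.PosSemidef) :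
    27 * M.det ≤ M.trace ^ 3 := by
  have h0 := hM.eigenvalues_nonneg
  rw [hM.1.det_eq_prod_eigenvalues, hM.1.trace_eq_sum_eigenvalues]
  simp only [Fin.sum_univ_three, Fin.prod_univ_three, RCLike.ofReal_real_eq_id, id]
  generalize hM.1.eigenvalues = e at *
  nlinarith [mul_nonneg (h0 0) (sq_nonneg (e 1 - e 2)), mul_nonneg (h0 1) (sq_nonneg (e 0 - e 2)),
    mul_nonneg (h0 2) (sq_nonneg (e 1 - e 0)), mul_nonneg (h0 0) (sq_nonneg (e 0 - e 2)),
    mul_nonneg (h0 0) (sq_nonneg (e 0 - e 1)), mul_nonneg (h0 1) (sq_nonneg (e 1 - e 2)),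
    mul_nonneg (h0 1) (sq_nonneg (e 1 - e 0)), mul_nonneg (h0 2) (sq_nonneg (e 2 - e 0)),
    mul_nonneg (h0 2) (sq_nonneg (e 2 - e 1))]

/-- The determinant is 1 plus the sum of the squares of all minors of C. -/
theorem one_le_det_one_add_transpose_mul_self (C : Matrix (Fin 3) (Fin 3) ℝ) :
    1 ≤ (1 + C.transpose * C).det := by
  have : (1 + C.transpose * C).det = 1 + ∑ i, ∑ j, C i j ^ 2 +
      ((C 0 0 * C 1 1 - C 0 1 * C 1 0) ^ 2 + (C 0 0 * C 1 2 - C 0 2 * C 1 0) ^ 2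
      + (C 0 1 * C 1 2 - C 0 2 * C 1 1) ^ 2 + (C 0 0 * C 2 1 - C 0 1 * C 2 0) ^ 2
      + (C 0 0 * C 2 2 - C 0 2 * C 2 0) ^ 2 + (C 0 1 * C 2 2 - C 0 2 * C 2 1) ^ 2
      + (C 1 0 * C 2 1 - C 1 1 * C 2 0) ^ 2 + (C 1 0 * C 2 2 - C 1 2 * C 2 0) ^ 2
      + (C 1 1 * C 2 2 - C 1 2 * C 2 1) ^ 2) + C.det ^ 2 := by
    rw [Matrix.det_fin_three, Matrix.det_fin_three]
    simp [Matrix.mul_apply, Fin.sum_univ_three]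
    ring
  rw [this]
  have : 0 ≤ ∑ i, ∑ j, C i j ^ 2 := by positivity
  nlinarith [sq_nonneg C.det]

/-- A decomposition of a matrix of determinant at least one into rank one matrices forces a large
determinant among the real vectors, if the integer vectors form a unimodular system. -/
theorem le_mul_cube_of_unimodular_decomposition {ι : Type*} {s : Finset ι} {c : ι → ℝ}
    {p : ι → Fin 3 → ℝ} {u : ι → Fin 3 → ℤ} {m : ℝ} (hc : ∀ k ∈ s, 0 ≤ c k)
    (hdet : 1 ≤ (∑ k ∈ s, Matrix.vecMulVec (c k • p k) (fun j => (u k j : ℝ))).det)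
    (hu : ∀ k ∈ s, ∀ l ∈ s, ∀ r ∈ s, |(Matrix.of ![u k, u l, u r]).det| ≤ 1)
    (hp : ∀ k ∈ s, ∀ l ∈ s, ∀ r ∈ s, |det3 (p k) (p l) (p r)| ≤ m) (hm : 0 ≤ m) :
    27 ≤ 2 * m * (∑ k ∈ s, c k) ^ 3 := by
  set v : ι → Fin 3 → ℝ := fun k j => (u k j : ℝ) with hv
  have hof : ∀ (q : ι → Fin 3 → ℝ) (k : Fin 3 → ι),
      (Matrix.of fun i => q (k i)) = Matrix.of ![q (k 0), q (k 1), q (k 2)] := by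
    intro q k
    ext i j
    fin_cases i <;> rfl
  have hofu : ∀ k : Fin 3 → ι, (Matrix.of fun i => v (k i)).det =
      ((Matrix.of ![u (k 0), u (k 1), u (k 2)]).det : ℝ) := by
    intro k
    rw [Matrix.det_fin_three, Matrix.det_fin_three]
    simp [hv]
  have hscale : ∀ (q : ι → Fin 3 → ℝ) (k : Fin 3 → ι), (Matrix.of fun i => c (k i) • q (k i)).det =
      c (k 0) * c (k 1) * c (k 2) * (Matrix.of fun i => q (k i)).det := by
    intro q k
    rw [Matrix.det_fin_three, Matrix.det_fin_three]
    simp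
    ring
  have hmem : ∀ k ∈ Fintype.piFinset fun _ : Fin 3 => s, ∀ i, k i ∈ s := fun k hk =>
    Fintype.mem_piFinset.1 hk
  have h1 := factorial_mul_det_sum_vecMulVec s (fun k => c k • p k) v
  have h2 := factorial_mul_det_sum_vecMulVec s (fun k => c k • v k) v
  set M := ∑ k ∈ s, Matrix.vecMulVec (c k • v k) (v k) with hM
  -- Cauchy–Binet on both sides; termwise det p · det u ≤ m (det u)², because det u is 0 or ±1.
  have hle : (Nat.factorial 3 : ℝ) * (∑ k ∈ s, Matrix.vecMulVec (c k • p k) (v k)).det ≤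
      m * ((Nat.factorial 3 : ℝ) * M.det) := by
    rw [h1, h2, Finset.mul_sum]
    refine Finset.sum_le_sum fun k hk => ?_
    have hk := hmem k hk
    rw [hscale, hscale, hofu]
    set d : ℝ := ((Matrix.of ![u (k 0), u (k 1), u (k 2)]).det : ℝ) with hd
    have hd1 : |d| ≤ 1 := by
      rw [hd]; exact_mod_cast hu _ (hk 0) _ (hk 1) _ (hk 2)
    have hd2 : d = 0 ∨ d ^ 2 = 1 := by
      have h5 := hu _ (hk 0) _ (hk 1) _ (hk 2)
      rw [hd]
      generalize (Matrix.of ![u (k 0), u (k 1), u (k 2)]).det = z at h5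
      obtain ⟨a1, a2⟩ := abs_le.1 h5
      interval_cases z <;> simp
    have hq : |(Matrix.of fun i => p (k i)).det| ≤ m := by
      rw [hof]; exact hp _ (hk 0) _ (hk 1) _ (hk 2)
    have hcc : 0 ≤ c (k 0) * c (k 1) * c (k 2) :=
      mul_nonneg (mul_nonneg (hc _ (hk 0)) (hc _ (hk 1))) (hc _ (hk 2))
    have h3 : (Matrix.of fun i => p (k i)).det * d ≤ m * (d * d) := by
      rcases hd2 with h | h
      · rw [h]; simp
      · rw [← sq, h, mul_one]
        calc _ ≤ |(Matrix.of fun i => p (k i)).det * d| := le_abs_self _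
          _ = |(Matrix.of fun i => p (k i)).det| * |d| := abs_mul _ _
          _ ≤ m * 1 := mul_le_mul hq hd1 (abs_nonneg _) hm
          _ = m := mul_one m
    calc _ = c (k 0) * c (k 1) * c (k 2) * ((Matrix.of fun i => p (k i)).det * d) := by ring
      _ ≤ c (k 0) * c (k 1) * c (k 2) * (m * (d * d)) := mul_le_mul_of_nonneg_left h3 hcc
      _ = _ := by ring
  have h6 : (Nat.factorial 3 : ℝ) = 6 := by norm_num [Nat.factorial]
  rw [h6] at hle
  have hM1 : 1 ≤ m * M.det := by linarith
  have hdetM : 0 < M.det := by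
    by_contra h
    push Not at h
    nlinarith
  have hex : ∃ k : Fin 3 → ι, (∀ i, k i ∈ s) ∧ (Matrix.of fun i => u (k i)).det ≠ 0 := by
    by_contra hcon
    push Not at hcon
    rw [Finset.sum_eq_zero, h6] at h2
    · linarith
    · intro k hk
      have h5 := hcon k (hmem k hk)
      have h7 : Matrix.of (fun i => u (k i)) = Matrix.of ![u (k 0), u (k 1), u (k 2)] := by
        ext i j
        fin_cases i <;> rfl
      rw [hofu, ← h7, h5]
      simp
  obtain ⟨k, hk, hk0⟩ := hex
  obtain ⟨B, hB, hB2⟩ := exists_matrix_of_unimodular (W := u '' s)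
    (by rintro _ ⟨k, hk, rfl⟩ _ ⟨l, hl, rfl⟩ _ ⟨r, hr, rfl⟩; exact hu k hk l hl r hr)
    (fun i => ⟨k i, hk i, rfl⟩) hk0
  set B' : Matrix (Fin 3) (Fin 3) ℝ := B.map (Int.cast) with hB'
  have hB'det : B'.det ^ 2 = 4 := by
    have h8 : B'.det = (B.det : ℝ) := (Int.cast_det B).symm
    rw [h8, ← sq_abs]
    have : (|(B.det : ℝ)|) = 2 := by exact_mod_cast hB
    rw [this]; norm_num
  have hBM : B' * M * B'.transpose =
      ∑ k ∈ s, c k • Matrix.vecMulVec (B'.mulVec (v k)) (B'.mulVec (v k)) := by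
    rw [hM, Finset.mul_sum, Finset.sum_mul]
    refine Finset.sum_congr rfl fun k _ => ?_
    rw [Matrix.mul_vecMulVec, Matrix.vecMulVec_mul, Matrix.mulVec_smul, Matrix.smul_vecMulVec,
      Matrix.vecMul_transpose]
  have hpsd : (B' * M * B'.transpose).PosSemidef := by
    rw [hBM]
    refine Matrix.posSemidef_sum _ fun k hk => Matrix.PosSemidef.smul ?_ (hc k hk)
    simpa using Matrix.posSemidef_vecMulVec_self_star (B'.mulVec (v k))
  -- On the left (det B)² = 4, and |Bu|² ≤ 2 bounds the trace, so 27 · 4 det M ≤ (2 ∑ c)³. This is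
  -- combined with 1 ≤ m det M.
  have h9 := det_le_of_posSemidef hpsd
  have htr : (B' * M * B'.transpose).trace ≤ 2 * ∑ k ∈ s, c k := by
    rw [hBM, Matrix.trace_sum, Finset.mul_sum]
    refine Finset.sum_le_sum fun k hk => ?_
    rw [Matrix.trace_smul, Matrix.trace_vecMulVec, smul_eq_mul, mul_comm 2]
    refine mul_le_mul_of_nonneg_left ?_ (hc k hk)
    have h10 := hB2 (u k) ⟨k, hk, rfl⟩
    have h11 : B'.mulVec (v k) = fun i => (B.mulVec (u k) i : ℝ) := by
      ext i
      simp [hB', hv, Matrix.mulVec, dotProduct]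
    rw [h11]
    simp only [dotProduct, ← sq]
    exact_mod_cast h10
  rw [Matrix.det_mul, Matrix.det_mul, Matrix.det_transpose] at h9
  have h12 : B'.det * M.det * B'.det = 4 * M.det := by rw [← hB'det]; ring
  rw [h12] at h9
  have h13 : (B' * M * B'.transpose).trace ^ 3 ≤ (2 * ∑ k ∈ s, c k) ^ 3 :=
    pow_le_pow_left₀ hpsd.trace_nonneg htr 3
  have h14 : M.det * 27 ≤ 2 * (∑ k ∈ s, c k) ^ 3 := by nlinarith
  nlinarith

/-! ### First order condition for the penalized determinant. -/

/-- The expression in `hL` is the derivative at t = 0 of the penalized determinant of 1 + tY. -/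
theorem exists_decrease_of_neg_derivative {A Y : Matrix (Fin 3) (Fin 3) ℝ} {κ : ℝ}
    (hL : Y.trace + 2 * κ * ∑ i, ∑ j, A i j * (A * Y) i j < 0) :
    ∀ᶠ t in nhdsWithin (0 : ℝ) (Set.Ioi 0), 0 < (1 + t • Y).det ∧
      |(1 + t • Y).det| + κ * ∑ i, ∑ j, (A * (1 + t • Y)) i j ^ 2 < 1 + κ * ∑ i, ∑ j, A i j ^ 2 := by
  obtain ⟨c, hc⟩ : ∃ c : ℝ, ∀ t : ℝ,
      (1 + t • Y).det = 1 + t * (Y.trace + t * (c + t * Y.det)) := by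
    refine ⟨(Y 0 0 * Y 1 1 - Y 0 1 * Y 1 0) + (Y 0 0 * Y 2 2 - Y 0 2 * Y 2 0)
      + (Y 1 1 * Y 2 2 - Y 1 2 * Y 2 1), fun t => ?_⟩
    rw [Matrix.det_fin_three, Matrix.det_fin_three, Matrix.trace_fin_three]
    simp
    ring
  have hsum : ∀ t : ℝ, ∑ i, ∑ j, (A * (1 + t • Y)) i j ^ 2 = ∑ i, ∑ j, A i j ^ 2 +
      t * (2 * ∑ i, ∑ j, A i j * (A * Y) i j + t * ∑ i, ∑ j, (A * Y) i j ^ 2) := by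
    intro t
    rw [Matrix.mul_add, Matrix.mul_one, Matrix.mul_smul]
    simp only [Finset.mul_sum, ← Finset.sum_add_distrib]
    refine Finset.sum_congr rfl fun i _ => Finset.sum_congr rfl fun j _ => ?_
    rw [Matrix.add_apply, Matrix.smul_apply, smul_eq_mul]
    ring
  have h1 : ∀ᶠ t in nhdsWithin (0 : ℝ) (Set.Ioi 0), 0 < (1 + t • Y).det := by
    have hcont : Continuous fun t : ℝ => 1 + t * (Y.trace + t * (c + t * Y.det)) := by fun_prop
    simp only [hc]
    exact (hcont.tendsto 0).eventually_const_lt (by simp) |>.filter_mono nhdsWithin_le_nhds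
  have h2 : ∀ᶠ t in nhdsWithin (0 : ℝ) (Set.Ioi 0),
      (Y.trace + t * (c + t * Y.det)) + κ * (2 * ∑ i, ∑ j, A i j * (A * Y) i j
        + t * ∑ i, ∑ j, (A * Y) i j ^ 2) < 0 := by
    have hcont : Continuous fun t : ℝ => (Y.trace + t * (c + t * Y.det)) +
      κ * (2 * ∑ i, ∑ j, A i j * (A * Y) i j + t * ∑ i, ∑ j, (A * Y) i j ^ 2) := by fun_prop
    refine ((hcont.tendsto 0).eventually_lt_const ?_).filter_mono nhdsWithin_le_nhds
    simp only [zero_mul, add_zero]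
    linarith
  filter_upwards [h1, h2, self_mem_nhdsWithin] with t ht1 ht2 ht0
  refine ⟨ht1, ?_⟩
  rw [abs_of_pos ht1, hc, hsum]
  have := mul_neg_of_pos_of_neg (Set.mem_Ioi.1 ht0) ht2
  linarith

/-- Feasibility of the identity is stable under perturbations that increase all tight constraints. -/
theorem eventually_feasible_of_contacts {D : Set (Fin 3 → ℝ)} {ρ : ℝ} (hρ : 0 < ρ)
    (hball : ∀ q : Fin 3 → ℝ, (∀ i, |q i| ≤ ρ) → q ∈ D) {Y : Matrix (Fin 3) (Fin 3) ℝ}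
    {p : (Fin 3 → ℤ) → Fin 3 → ℝ} (hp : ∀ u, u ≠ 0 → p u ∈ D)
    (hp1 : ∀ u, u ≠ 0 → 1 ≤ ∑ j, (u j : ℝ) * p u j)
    (hY : ∀ u, u ≠ 0 → ∑ j, (u j : ℝ) * p u j = 1 →
      0 < ∑ j, Y.mulVec (fun i => (u i : ℝ)) j * p u j) :
    ∀ᶠ t in nhdsWithin (0 : ℝ) (Set.Ioi 0), ∀ u : Fin 3 → ℤ, u ≠ 0 →
      ∃ q ∈ D, 1 ≤ ∑ j, (1 + t • Y).mulVec (fun i => (u i : ℝ)) j * q j := by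
  -- Only the finitely many u with entries below 2/ρ need the hypothesis on Y, or continuity. For
  -- the others the cube of radius ρ in D already yields at least 2, and a small perturbation loses
  -- at most half of it.
  have hfin : {u : Fin 3 → ℤ | u ≠ 0 ∧ ∀ i, |(u i : ℝ)| < 2 / ρ}.Finite := by
    refine (Set.finite_Icc (fun _ => -⌈2 / ρ⌉ : Fin 3 → ℤ) (fun _ => ⌈2 / ρ⌉)).subset ?_
    rintro u ⟨-, hu⟩
    have h2 : ∀ i, |u i| ≤ ⌈2 / ρ⌉ := fun i => by
      exact_mod_cast (hu i).le.trans (Int.le_ceil _)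
    exact ⟨fun i => (abs_le.1 (h2 i)).1, fun i => (abs_le.1 (h2 i)).2⟩
  have hexp : ∀ (t : ℝ) (u q : Fin 3 → ℝ), ∑ j, (1 + t • Y).mulVec u j * q j =
      ∑ j, u j * q j + t * ∑ j, Y.mulVec u j * q j := by
    intro t u q
    rw [Matrix.add_mulVec, Matrix.one_mulVec, Matrix.smul_mulVec, Finset.mul_sum,
      ← Finset.sum_add_distrib]
    refine Finset.sum_congr rfl fun j _ => ?_
    simp only [Pi.add_apply, Pi.smul_apply, smul_eq_mul]
    ring
  have hsmall : ∀ᶠ t in nhdsWithin (0 : ℝ) (Set.Ioi 0),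
      ∀ u ∈ {u : Fin 3 → ℤ | u ≠ 0 ∧ ∀ i, |(u i : ℝ)| < 2 / ρ},
        1 ≤ ∑ j, (1 + t • Y).mulVec (fun i => (u i : ℝ)) j * p u j := by
    refine (Filter.eventually_all_finite hfin).2 fun u hu => ?_
    simp only [hexp]
    rcases (hp1 u hu.1).eq_or_lt with h | h
    · filter_upwards [self_mem_nhdsWithin] with t ht
      rw [← h]
      have := mul_pos (Set.mem_Ioi.1 ht) (hY u hu.1 h.symm)
      linarith
    · have hcont : Continuous fun t : ℝ => ∑ j, (u j : ℝ) * p u j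
        + t * ∑ j, Y.mulVec (fun i => (u i : ℝ)) j * p u j := by fun_prop
      exact (((hcont.tendsto 0).eventually_const_lt (by simpa using h)).mono
        fun t ht => ht.le).filter_mono nhdsWithin_le_nhds
  have hY1 : ∀ᶠ t in nhdsWithin (0 : ℝ) (Set.Ioi 0), t * ∑ i, ∑ j, |Y i j| < 1 / 2 := by
    have hcont : Continuous fun t : ℝ => t * ∑ i, ∑ j, |Y i j| := by fun_prop
    exact ((hcont.tendsto 0).eventually_lt_const (by norm_num)).filter_mono nhdsWithin_le_nhds
  filter_upwards [hsmall, hY1, self_mem_nhdsWithin] with t ht1 ht2 ht0 u hu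
  have ht0 : 0 < t := ht0
  by_cases hlt : ∀ i, |(u i : ℝ)| < 2 / ρ
  · exact ⟨p u, hp u hu, ht1 u ⟨hu, hlt⟩⟩
  · obtain ⟨i, -, hi⟩ := Finset.exists_max_image Finset.univ (fun i => |(u i : ℝ)|) ⟨0, Finset.mem_univ _⟩
    have hi2 : 2 / ρ ≤ |(u i : ℝ)| := by
      by_contra h
      push Not at h hlt
      obtain ⟨j, hj⟩ := hlt
      linarith [hi j (Finset.mem_univ j)]
    have hYu : |t * Y.mulVec (fun i => (u i : ℝ)) i| ≤ |(u i : ℝ)| / 2 := by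
      have h1 : |Y.mulVec (fun i => (u i : ℝ)) i| ≤ (∑ a, ∑ j, |Y a j|) * |(u i : ℝ)| := by
        calc |Y.mulVec (fun i => (u i : ℝ)) i| ≤ ∑ j, |Y i j * u j| :=
              Finset.abs_sum_le_sum_abs (fun j => Y i j * (u j : ℝ)) Finset.univ
          _ ≤ ∑ j, |Y i j| * |(u i : ℝ)| := Finset.sum_le_sum fun j _ => by
              rw [abs_mul]
              exact mul_le_mul_of_nonneg_left (hi j (Finset.mem_univ j)) (abs_nonneg _)
          _ = (∑ j, |Y i j|) * |(u i : ℝ)| := by rw [Finset.sum_mul]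
          _ ≤ _ := mul_le_mul_of_nonneg_right
              (Finset.single_le_sum (f := fun a => ∑ j, |Y a j|)
                (fun a _ => Finset.sum_nonneg fun j _ => abs_nonneg _) (Finset.mem_univ i))
              (abs_nonneg _)
      rw [abs_mul, abs_of_pos ht0]
      nlinarith [mul_le_mul_of_nonneg_left h1 ht0.le, abs_nonneg (u i : ℝ)]
    have key : ∀ σ : ℝ, |σ| = 1 → σ * u i = |(u i : ℝ)| →
        ∃ q ∈ D, 1 ≤ ∑ j, (1 + t • Y).mulVec (fun i => (u i : ℝ)) j * q j := by
      intro σ hσ hσu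
      refine ⟨Pi.single i (σ * ρ), hball _ fun j => ?_, ?_⟩
      · rcases eq_or_ne j i with rfl | h
        · rw [Pi.single_eq_same, abs_mul, hσ, abs_of_pos hρ, one_mul]
        · rw [Pi.single_eq_of_ne h, abs_zero]; exact hρ.le
      · rw [hexp]
        have h2 : ∀ f : Fin 3 → ℝ, ∑ j, f j * (Pi.single i (σ * ρ) : Fin 3 → ℝ) j = f i * (σ * ρ) := by
          intro f
          rw [Finset.sum_eq_single i (fun b _ hb => by rw [Pi.single_eq_of_ne hb, mul_zero]) (by simp),
            Pi.single_eq_same]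
        rw [h2, h2]
        have h3 : -(|(u i : ℝ)| / 2) ≤ σ * (t * Y.mulVec (fun i => (u i : ℝ)) i) := by
          refine (neg_le_neg hYu).trans ?_
          rw [← one_mul (|t * _|), ← hσ, ← abs_mul]
          exact neg_abs_le _
        have h4 : 1 ≤ ρ * (|(u i : ℝ)| / 2) := by
          rw [div_le_iff₀ hρ] at hi2
          linarith
        calc 1 ≤ ρ * (|(u i : ℝ)| / 2) := h4
          _ ≤ ρ * (σ * u i + σ * (t * Y.mulVec (fun i => (u i : ℝ)) i)) :=
            mul_le_mul_of_nonneg_left (by linarith) hρ.le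
          _ = _ := by ring
    rcases abs_choice (u i : ℝ) with h | h
    · exact key 1 (by simp) (by rw [h, one_mul])
    · exact key (-1) (by simp) (by rw [h]; ring)

/-- The first order condition at a minimizer of the penalized determinant. -/
theorem exists_decomposition_of_minimal {D : Set (Fin 3 → ℝ)} {ρ : ℝ} (hρ : 0 < ρ)
    (hball : ∀ q : Fin 3 → ℝ, (∀ i, |q i| ≤ ρ) → q ∈ D)
    (hfeas : ∀ u : Fin 3 → ℤ, u ≠ 0 → ∃ p ∈ D, 1 ≤ ∑ j, (u j : ℝ) * p j)
    {A : Matrix (Fin 3) (Fin 3) ℝ} {κ : ℝ} (hκ : 0 ≤ κ)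
    (hmin : ∀ B : Matrix (Fin 3) (Fin 3) ℝ, B.det ≠ 0 →
      (∀ u : Fin 3 → ℤ, u ≠ 0 → ∃ p ∈ D, 1 ≤ ∑ j, B.mulVec (fun i => (u i : ℝ)) j * p j) →
      1 + κ * ∑ i, ∑ j, A i j ^ 2 ≤ |B.det| + κ * ∑ i, ∑ j, (A * B) i j ^ 2) :
    ∃ (ι : Type) (s : Finset ι) (c : ι → ℝ) (p : ι → Fin 3 → ℝ) (u : ι → Fin 3 → ℤ),
      (∀ k ∈ s, 0 ≤ c k) ∧ (∀ k ∈ s, p k ∈ D) ∧ (∀ k ∈ s, u k ≠ 0) ∧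
      (∀ k ∈ s, ∀ q ∈ D, ∑ j, (u k j : ℝ) * q j ≤ 1) ∧
      ∑ k ∈ s, c k = 3 + 2 * κ * ∑ i, ∑ j, A i j ^ 2 ∧
      ∑ k ∈ s, Matrix.vecMulVec (c k • p k) (fun j => (u k j : ℝ)) =
        1 + (2 * κ) • (A.transpose * A) := by
  have hsq : 0 ≤ ∑ i, ∑ j, A i j ^ 2 := by positivity
  set τ := 3 + 2 * κ * ∑ i, ∑ j, A i j ^ 2 with hτ
  have hτ0 : 0 < τ := by positivity
  -- The point p u exceeds 1 whenever some point of D does, so that ⟨u, p u⟩ = 1 characterizes the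
  -- contacts.
  have hch : ∀ u : Fin 3 → ℤ, ∃ p : Fin 3 → ℝ, u ≠ 0 → p ∈ D ∧ 1 ≤ ∑ j, (u j : ℝ) * p j ∧
      ((∃ q ∈ D, 1 < ∑ j, (u j : ℝ) * q j) → 1 < ∑ j, (u j : ℝ) * p j) := by
    intro u
    by_cases hu : u = 0
    · exact ⟨0, fun h => absurd hu h⟩
    by_cases h : ∃ q ∈ D, 1 < ∑ j, (u j : ℝ) * q j
    · obtain ⟨q, hq, h1⟩ := h
      exact ⟨q, fun _ => ⟨hq, h1.le, fun _ => h1⟩⟩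
    · obtain ⟨q, hq, h1⟩ := hfeas u hu
      exact ⟨q, fun _ => ⟨hq, h1, fun h' => absurd h' h⟩⟩
  choose p hp using hch
  set C : Set (Fin 3 → ℤ) := {u | u ≠ 0 ∧ ∀ q ∈ D, ∑ j, (u j : ℝ) * q j ≤ 1} with hC
  have hCp : ∀ u ∈ C, ∑ j, (u j : ℝ) * p u j = 1 := fun u hu =>
    le_antisymm (hu.2 _ (hp u hu.1).1) (hp u hu.1).2.1
  have hfin : C.Finite := by
    refine (Set.finite_Icc (fun _ => -⌈1 / ρ⌉ : Fin 3 → ℤ) (fun _ => ⌈1 / ρ⌉)).subset ?_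
    rintro u ⟨-, hu⟩
    have h1 : ∀ i, ∀ σ : ℝ, |σ| = 1 → σ * u i ≤ 1 / ρ := by
      intro i σ hσ
      have := hu (Pi.single i (σ * ρ)) (hball _ fun j => by
        rcases eq_or_ne j i with rfl | h
        · rw [Pi.single_eq_same, abs_mul, hσ, abs_of_pos hρ, one_mul]
        · rw [Pi.single_eq_of_ne h, abs_zero]; exact hρ.le)
      rw [Finset.sum_eq_single i (fun b _ hb => by rw [Pi.single_eq_of_ne hb, mul_zero]) (by simp),
        Pi.single_eq_same] at this
      rw [le_div_iff₀ hρ]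
      linarith
    have h2 : ∀ i, |u i| ≤ ⌈1 / ρ⌉ := fun i => by
      have h3 : |(u i : ℝ)| ≤ 1 / ρ := abs_le.2
        ⟨by linarith [h1 i (-1) (by simp)], by linarith [h1 i 1 (by simp)]⟩
      exact_mod_cast h3.trans (Int.le_ceil _)
    exact ⟨fun i => (abs_le.1 (h2 i)).1, fun i => (abs_le.1 (h2 i)).2⟩
  set T : (Fin 3 → ℤ) → Fin 3 → Fin 3 → ℝ := fun u i j => p u i * u j with hT
  set N : Matrix (Fin 3) (Fin 3) ℝ := 1 + (2 * κ) • (A.transpose * A) with hN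
  set x₀ : Fin 3 → Fin 3 → ℝ := fun i j => τ⁻¹ * N i j with hx₀
  have hNtr : N.trace = τ := by
    rw [hN, hτ, Matrix.trace_add, Matrix.trace_one, Matrix.trace_smul, Matrix.trace_fin_three]
    simp only [Matrix.mul_apply, Fin.sum_univ_three, Matrix.transpose_apply, smul_eq_mul, Fintype.card_fin]
    push_cast
    ring
  -- Otherwise a functional f separates x₀ from the contact matrices. All of these have trace 1, so
  -- subtracting b times the trace gives Y negative on x₀ and positive on all contacts: a direction
  -- that stays feasible and lowers the objective.
  have hmem : x₀ ∈ convexHull ℝ (T '' C) := by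
    by_contra hnot
    obtain ⟨f, b, hfx, hfb⟩ := geometric_hahn_banach_point_closed (convex_convexHull ℝ _)
      ((hfin.image T).isClosed_convexHull ℝ) hnot
    have hrep : ∀ M : Fin 3 → Fin 3 → ℝ,
        f M = ∑ i, ∑ j, M i j * f (Pi.single i (Pi.single j 1)) := by
      intro M
      have hM : M = ∑ i, ∑ j, M i j • (Pi.single i (Pi.single j 1) : Fin 3 → Fin 3 → ℝ) := by
        ext a b
        simp only [Finset.sum_apply, Pi.smul_apply, smul_eq_mul]
        rw [Finset.sum_eq_single a (fun i _ hi => Finset.sum_eq_zero fun j _ => by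
          rw [Pi.single_eq_of_ne hi.symm]; simp) (by simp)]
        rw [Finset.sum_eq_single b (fun j _ hj => by
          rw [Pi.single_eq_same, Pi.single_eq_of_ne hj.symm, mul_zero]) (by simp)]
        simp
      conv_lhs => rw [hM]
      simp only [map_sum, map_smul, smul_eq_mul]
    set Y : Matrix (Fin 3) (Fin 3) ℝ := Matrix.of
      fun i j => f (Pi.single i (Pi.single j 1)) - if i = j then b else 0 with hY
    have hpair : ∀ M : Fin 3 → Fin 3 → ℝ,
        ∑ i, ∑ j, M i j * Y i j = f M - b * ∑ i, M i i := by
      intro M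
      rw [hrep M]
      simp only [hY, Matrix.of_apply, mul_sub, Finset.sum_sub_distrib, mul_ite, mul_zero,
        Finset.sum_ite_eq, Finset.mem_univ, if_true]
      rw [Finset.mul_sum]
      simp only [mul_comm b]
    have hL : Y.trace + 2 * κ * ∑ i, ∑ j, A i j * (A * Y) i j < 0 := by
      have h1 : Y.trace + 2 * κ * ∑ i, ∑ j, A i j * (A * Y) i j =
          τ * ∑ i, ∑ j, x₀ i j * Y i j := by
        have h2 : τ * ∑ i, ∑ j, x₀ i j * Y i j = ∑ i, ∑ j, N i j * Y i j := by
          simp only [hx₀, Finset.mul_sum]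
          refine Finset.sum_congr rfl fun i _ => Finset.sum_congr rfl fun j _ => ?_
          field_simp
        rw [h2, hN, Matrix.trace_fin_three]
        simp [Matrix.mul_apply, Fin.sum_univ_three, Matrix.one_apply]
        ring
      rw [h1, hpair]
      refine mul_neg_of_pos_of_neg hτ0 ?_
      have h3 : ∑ i, x₀ i i = 1 := by
        simp only [hx₀, ← Finset.mul_sum]
        have : ∑ i, N i i = N.trace := rfl
        rw [this, hNtr, inv_mul_cancel₀ hτ0.ne']
      rw [h3]
      linarith
    have hYp : ∀ u, u ≠ 0 → ∑ j, (u j : ℝ) * p u j = 1 →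
        0 < ∑ j, Y.mulVec (fun i => (u i : ℝ)) j * p u j := by
      intro u hu hu1
      have huC : u ∈ C := by
        refine ⟨hu, fun q hq => ?_⟩
        by_contra h
        push Not at h
        exact absurd hu1 ((hp u hu).2.2 ⟨q, hq, h⟩).ne'
      have h1 := hfb (T u) (subset_convexHull ℝ _ ⟨u, huC, rfl⟩)
      have h2 := hpair (T u)
      have h3 : ∑ i, T u i i = 1 := by
        rw [← hu1]
        exact Finset.sum_congr rfl fun i _ => mul_comm _ _
      have h4 : ∑ j, Y.mulVec (fun i => (u i : ℝ)) j * p u j = ∑ i, ∑ j, T u i j * Y i j := by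
        refine Finset.sum_congr rfl fun i _ => ?_
        rw [Matrix.mulVec, dotProduct, Finset.sum_mul]
        refine Finset.sum_congr rfl fun j _ => ?_
        simp only [hT]
        ring
      rw [h4, h2, h3]
      linarith
    have hev := (exists_decrease_of_neg_derivative hL).and
      (eventually_feasible_of_contacts hρ hball (fun u hu => (hp u hu).1)
        (fun u hu => (hp u hu).2.1) hYp)
    obtain ⟨t, ⟨h1, h2⟩, h3⟩ := hev.exists
    linarith [hmin _ h1.ne' h3]
  rw [convexHull_eq] at hmem
  obtain ⟨ι, s, w, z, hw0, hw1, hz, hwz⟩ := hmem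
  have hz' : ∀ k, ∃ u, k ∈ s → u ∈ C ∧ T u = z k := by
    intro k
    by_cases hk : k ∈ s
    · obtain ⟨u, hu, h⟩ := hz k hk
      exact ⟨u, fun _ => ⟨hu, h⟩⟩
    · exact ⟨0, fun h => absurd h hk⟩
  choose u hu using hz'
  rw [Finset.centerMass_eq_of_sum_1 _ _ hw1] at hwz
  refine ⟨ι, s, fun k => τ * w k, fun k => p (u k), u, fun k hk => mul_nonneg hτ0.le (hw0 k hk),
    fun k hk => (hp _ (hu k hk).1.1).1, fun k hk => (hu k hk).1.1, fun k hk => (hu k hk).1.2,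
    by rw [← Finset.mul_sum, hw1, mul_one], ?_⟩
  ext i j
  have h1 := congrFun (congrFun hwz i) j
  rw [Finset.sum_apply, Finset.sum_apply] at h1
  simp only [hx₀] at h1
  rw [eq_inv_mul_iff_mul_eq₀ hτ0.ne', Finset.mul_sum] at h1
  rw [← h1, Matrix.sum_apply]
  refine Finset.sum_congr rfl fun k hk => ?_
  rw [← (hu k hk).2, Matrix.vecMulVec_apply]
  simp only [hT, Pi.smul_apply, smul_eq_mul]
  ring

/-! ### Feasible matrices and existence of minimizers. -/

/-- The matrix `A` maps the nonzero integer vectors to vectors on which the support function of `D`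
is at least one. -/
def IsFeasible (D : Set (Fin 3 → ℝ)) (A : Matrix (Fin 3) (Fin 3) ℝ) : Prop :=
  ∀ u : Fin 3 → ℤ, u ≠ 0 → ∃ p ∈ D, 1 ≤ ∑ j, A.mulVec (fun i => (u i : ℝ)) j * p j

/-- Minkowski's theorem for the preimage under A of a cube of side 2r, whose volume (2r)³ / |det A|
exceeds 8. -/
theorem exists_int_mulVec_mem_ball {A : Matrix (Fin 3) (Fin 3) ℝ} (hA : A.det ≠ 0) {r : ℝ}
    (hr : 0 < r) (hlt : |A.det| < r ^ 3) :
    ∃ u : Fin 3 → ℤ, u ≠ 0 ∧ A.mulVec (fun i => (u i : ℝ)) ∈ Metric.ball 0 r := by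
  set f : (Fin 3 → ℝ) →ₗ[ℝ] Fin 3 → ℝ := Matrix.toLin' A with hf
  have hdet : LinearMap.det f = A.det := LinearMap.det_toLin' A
  have hvol := Measure.addHaar_preimage_linearMap volume (f := f) (by rwa [hdet]) (Metric.ball 0 r)
  rw [hdet, Real.volume_pi_ball _ hr, ← ENNReal.ofReal_mul (abs_nonneg _)] at hvol
  set b := Pi.basisFun ℝ (Fin 3) with hb
  have : Countable (Submodule.span ℤ (Set.range b)).toAddSubgroup :=
    inferInstanceAs (Countable (Submodule.span ℤ (Set.range b)))
  obtain ⟨x, hx0, hx⟩ := exists_ne_zero_mem_lattice_of_measure_mul_two_pow_lt_measure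
    (ZSpan.isAddFundamentalDomain' b volume) (s := f ⁻¹' Metric.ball 0 r)
    (fun x hx => by simpa [Set.mem_preimage] using hx)
    ((convex_ball (0 : Fin 3 → ℝ) r).linear_preimage f)
    (by
      rw [hvol, ZSpan.volume_fundamentalDomain]
      have h1 : (Matrix.of b).det = 1 := by
        have : Matrix.of b = (1 : Matrix (Fin 3) (Fin 3) ℝ) := by
          ext i j
          simp [hb, Matrix.one_apply, Pi.single_apply, eq_comm]
        rw [this, Matrix.det_one]
      rw [h1, abs_one, ENNReal.ofReal_one, one_mul, Module.finrank_fin_fun, Fintype.card_fin,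
        abs_inv]
      have h2 : (2 : ENNReal) ^ 3 = ENNReal.ofReal (2 ^ 3) := by
        rw [ENNReal.ofReal_pow (by norm_num)]; simp
      rw [h2, ENNReal.ofReal_lt_ofReal_iff_of_nonneg (by norm_num), mul_pow,
        lt_inv_mul_iff₀ (abs_pos.2 hA)]
      linarith)
  have hmem : ∀ i, ∃ n : ℤ, (n : ℝ) = (x : Fin 3 → ℝ) i := by
    intro i
    have := (b.mem_span_iff_repr_mem ℤ (x : Fin 3 → ℝ)).1 x.2 i
    simpa [hb] using this
  choose u hu using hmem
  have hux : (fun i => (u i : ℝ)) = (x : Fin 3 → ℝ) := funext hu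
  refine ⟨u, ?_, ?_⟩
  · rintro rfl
    apply hx0
    ext i
    rw [← hux]
    simp
  · rw [hux]
    simpa [hf] using hx

theorem IsFeasible.le_abs_det {D : Set (Fin 3 → ℝ)} {R : ℝ} (hR : 0 < R)
    (hD : ∀ p ∈ D, ∀ i, |p i| ≤ R) {A : Matrix (Fin 3) (Fin 3) ℝ} (hA : IsFeasible D A)
    (hdet : A.det ≠ 0) : (1 / (3 * R)) ^ 3 ≤ |A.det| := by
  by_contra hlt
  push Not at hlt
  obtain ⟨u, hu0, hu⟩ := exists_int_mulVec_mem_ball hdet (by positivity) hlt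
  obtain ⟨p, hp, h1⟩ := hA u hu0
  rw [mem_ball_zero_iff, pi_norm_lt_iff (by positivity)] at hu
  have h2 : ∀ j, A.mulVec (fun i => (u i : ℝ)) j * p j < 1 / 3 := by
    intro j
    calc _ ≤ |A.mulVec (fun i => (u i : ℝ)) j| * |p j| := by
          rw [← abs_mul]; exact le_abs_self _
      _ ≤ |A.mulVec (fun i => (u i : ℝ)) j| * R :=
          mul_le_mul_of_nonneg_left (hD p hp j) (abs_nonneg _)
      _ < 1 / (3 * R) * R := mul_lt_mul_of_pos_right (hu j) hR
      _ = 1 / 3 := by field_simp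
  rw [Fin.sum_univ_three] at h1
  linarith [h2 0, h2 1, h2 2]

theorem isClosed_setOf_isFeasible {D : Set (Fin 3 → ℝ)} (hD : IsCompact D) :
    IsClosed {A : Matrix (Fin 3) (Fin 3) ℝ | IsFeasible D A} := by
  have : {A : Matrix (Fin 3) (Fin 3) ℝ | IsFeasible D A} =
      ⋂ (u : Fin 3 → ℤ) (_ : u ≠ 0), {A | ∃ p ∈ D, 1 ≤ ∑ j, A.mulVec (fun i => (u i : ℝ)) j * p j} := by
    ext A
    simp only [Set.mem_iInter]
    rfl
  rw [this]
  refine isClosed_iInter fun u => isClosed_iInter fun _ => ?_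
  have := isCompact_iff_compactSpace.1 hD
  have hcl : IsClosed {x : D × Matrix (Fin 3) (Fin 3) ℝ |
      1 ≤ ∑ j, x.2.mulVec (fun i => (u i : ℝ)) j * (x.1 : Fin 3 → ℝ) j} := by
    refine isClosed_le continuous_const ?_
    refine continuous_finsetSum _ fun j _ => ?_
    refine Continuous.mul ?_ ((continuous_apply j).comp (continuous_subtype_val.comp continuous_fst))
    exact (continuous_apply j).comp (continuous_snd.matrix_mulVec continuous_const)
  convert isClosedMap_snd_of_compactSpace _ hcl using 1
  ext A
  constructor
  · rintro ⟨p, hp, h⟩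
    exact ⟨(⟨p, hp⟩, A), h, rfl⟩
  · rintro ⟨⟨p, A'⟩, h, rfl⟩
    exact ⟨p, p.2, h⟩

/-- Feasibility and |det| are invariant under right multiplication by GL₃(ℤ), so |det| alone does
not confine a minimizing sequence. The penalty makes sublevel sets compact, and the closed condition
d ≤ |det| excludes singular limits when d > 0. -/
theorem exists_minimizer_of_isFeasible {D : Set (Fin 3 → ℝ)} (hD : IsCompact D) {d θ : ℝ}
    (hθ : 0 < θ) {A₀ : Matrix (Fin 3) (Fin 3) ℝ} (hA₀ : IsFeasible D A₀) (hd : d ≤ |A₀.det|) :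
    ∃ A : Matrix (Fin 3) (Fin 3) ℝ, IsFeasible D A ∧ d ≤ |A.det| ∧
      ∀ B : Matrix (Fin 3) (Fin 3) ℝ, IsFeasible D B → d ≤ |B.det| →
        |A.det| + θ * ∑ i, ∑ j, A i j ^ 2 ≤ |B.det| + θ * ∑ i, ∑ j, B i j ^ 2 := by
  set J : Matrix (Fin 3) (Fin 3) ℝ → ℝ := fun A => |A.det| + θ * ∑ i, ∑ j, A i j ^ 2 with hJ
  have hent : ∀ i j, Continuous fun A : Matrix (Fin 3) (Fin 3) ℝ => A i j := fun i j =>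
    (continuous_apply j).comp (continuous_apply i)
  have hdet : Continuous fun A : Matrix (Fin 3) (Fin 3) ℝ => |A.det| :=
    (continuous_id.matrix_det).abs
  have hJc : Continuous J := by
    refine hdet.add (continuous_const.mul ?_)
    exact continuous_finsetSum _ fun i _ => continuous_finsetSum _ fun j _ => (hent i j).pow 2
  set S : Set (Matrix (Fin 3) (Fin 3) ℝ) := {A | IsFeasible D A} ∩ {A | d ≤ |A.det|} ∩ {A | J A ≤ J A₀}
    with hS
  have hSc : IsClosed S := ((isClosed_setOf_isFeasible hD).inter
    (isClosed_le continuous_const hdet)).inter (isClosed_le hJc continuous_const)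
  obtain ⟨C, hC⟩ : ∃ C : ℝ, ∀ A, J A ≤ J A₀ → ∀ i j, |A i j| ≤ C := by
    refine ⟨Real.sqrt (J A₀ / θ), fun A hA i j => Real.abs_le_sqrt ?_⟩
    rw [le_div_iff₀ hθ]
    have h1 : A i j ^ 2 ≤ ∑ i, ∑ j, A i j ^ 2 :=
      (Finset.single_le_sum (f := fun j => A i j ^ 2) (fun _ _ => sq_nonneg _)
        (Finset.mem_univ j)).trans
      (Finset.single_le_sum (f := fun i => ∑ j, A i j ^ 2)
        (fun _ _ => Finset.sum_nonneg fun _ _ => sq_nonneg _) (Finset.mem_univ i))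
    have h2 := abs_nonneg A.det
    have h3 := mul_le_mul_of_nonneg_left h1 hθ.le
    simp only [hJ] at hA ⊢
    linarith
  have hSk : IsCompact S := by
    have hbox : IsCompact (Set.pi Set.univ fun _ : Fin 3 => Set.pi Set.univ fun _ : Fin 3 =>
        Set.Icc (-C) C) :=
      isCompact_univ_pi fun _ => isCompact_univ_pi fun _ => isCompact_Icc
    refine hbox.of_isClosed_subset hSc ?_
    intro A hA i _ j _
    exact abs_le.1 (hC A hA.2 i j)
  obtain ⟨A, hA, hmin⟩ := hSk.exists_isMinOn ⟨A₀, ⟨hA₀, hd⟩, le_refl (J A₀)⟩ hJc.continuousOn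
  refine ⟨A, hA.1.1, hA.1.2, fun B hB hBd => ?_⟩
  rcases le_total (J B) (J A₀) with h | h
  · exact hmin ⟨⟨hB, hBd⟩, h⟩
  · exact le_trans hA.2 h

/-! ### Determinants close to one half in smooth bodies. -/

/-- No point of `D` maximizes two linearly independent linear forms. -/
def IsSmoothlySupported (D : Set (Fin 3 → ℝ)) : Prop :=
  ∀ p ∈ D, ∀ u v : Fin 3 → ℝ, u ≠ 0 → v ≠ 0 → (∀ q ∈ D, ∑ j, u j * q j ≤ ∑ j, u j * p j) →
    (∀ q ∈ D, ∑ j, v j * q j ≤ ∑ j, v j * p j) → ∃ c : ℝ, v = c • u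

/-- The two outcomes are the two cases for the contacts of the first order condition: a triple of
determinant at least 2 in absolute value, or a unimodular system. In the former case smooth support
gives strictness, since a point where two of the contacts take values ±1 would maximize two
independent linear forms. -/
theorem one_half_le_or_le_of_minimal {D : Set (Fin 3 → ℝ)} (hneg : ∀ p ∈ D, -p ∈ D)
    (hstar : ∀ p ∈ D, ∀ c : ℝ, 0 ≤ c → c ≤ 1 → c • p ∈ D) (hsm : IsSmoothlySupported D)
    {ρ : ℝ} (hρ : 0 < ρ) (hball : ∀ q : Fin 3 → ℝ, (∀ i, |q i| ≤ ρ) → q ∈ D)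
    (hfeas : ∀ u : Fin 3 → ℤ, u ≠ 0 → ∃ p ∈ D, 1 ≤ ∑ j, (u j : ℝ) * p j)
    {A : Matrix (Fin 3) (Fin 3) ℝ} {κ : ℝ} (hκ : 0 ≤ κ)
    (hmin : ∀ B : Matrix (Fin 3) (Fin 3) ℝ, B.det ≠ 0 → IsFeasible D B →
      1 + κ * ∑ i, ∑ j, A i j ^ 2 ≤ |B.det| + κ * ∑ i, ∑ j, (A * B) i j ^ 2)
    {m : ℝ} (hm : ∀ p ∈ D, ∀ q ∈ D, ∀ r ∈ D, |det3 p q r| ≤ m) :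
    1 / 2 ≤ m ∨ 27 ≤ 2 * m * (3 + 2 * κ * ∑ i, ∑ j, A i j ^ 2) ^ 3 := by
  obtain ⟨ι, s, c, p, u, hc, hp, hu0, hu, hsum, hdec⟩ :=
    exists_decomposition_of_minimal hρ hball hfeas hκ hmin
  by_cases hdet : ∀ k ∈ s, ∀ l ∈ s, ∀ r ∈ s, |(Matrix.of ![u k, u l, u r]).det| ≤ 1
  · right
    rw [← hsum]
    refine le_mul_cube_of_unimodular_decomposition hc ?_ hdet
      (fun k hk l hl r hr => hm _ (hp k hk) _ (hp l hl) _ (hp r hr)) ?_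
    · rw [hdec]
      have h1 : (2 * κ) • (A.transpose * A) =
          (Real.sqrt (2 * κ) • A).transpose * (Real.sqrt (2 * κ) • A) := by
        rw [Matrix.transpose_smul, Matrix.smul_mul, Matrix.mul_smul, smul_smul,
          Real.mul_self_sqrt (by positivity)]
      rw [h1]
      exact one_le_det_one_add_transpose_mul_self _
    · have h0 : (0 : Fin 3 → ℝ) ∈ D := hball 0 fun i => by simpa using hρ.le
      exact (abs_nonneg _).trans (hm 0 h0 0 h0 0 h0)
  · left
    push Not at hdet
    obtain ⟨k, hk, l, hl, r, hr, hdet⟩ := hdet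
    set U : Matrix (Fin 3) (Fin 3) ℤ := Matrix.of ![u k, u l, u r] with hU
    have hUle : ∀ p ∈ D, ∀ i, ∑ j, (U i j : ℝ) * p j ≤ 1 := by
      intro p hp i
      fin_cases i
      · exact hu k hk p hp
      · exact hu l hl p hp
      · exact hu r hr p hp
    have hU0 : U.det ≠ 0 := by
      intro h
      rw [h] at hdet
      norm_num at hdet
    have hinj : ∀ s : Fin 3 → ℝ, (∀ j, ∑ i, s i * (U i j : ℝ) = 0) → s = 0 := by
      intro s hs
      have h1 : (U.map (Int.cast : ℤ → ℝ)).det ≠ 0 := by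
        have : (U.map (Int.cast : ℤ → ℝ)).det = (U.det : ℝ) := (Int.cast_det U).symm
        rw [this]
        exact_mod_cast hU0
      exact Matrix.eq_zero_of_vecMul_eq_zero h1 (funext hs)
    obtain ⟨p, hp, q, hq, r, hr, h⟩ := exists_one_half_le_abs_det3_of_strict_contacts (U := U) hneg
      hstar hfeas hUle
      (by
        intro p hp i j hi hj
        by_contra hij
        -- a signed contact is maximal at `p`
        have hmax : ∀ i, |∑ l, (U i l : ℝ) * p l| = 1 → ∃ σ : ℝ, σ ≠ 0 ∧
            ∀ q ∈ D, ∑ l, (σ * U i l) * q l ≤ ∑ l, (σ * U i l) * p l := by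
          intro i hi
          have hs : ∀ (σ : ℝ) (q : Fin 3 → ℝ), ∑ l, (σ * U i l) * q l = σ * ∑ l, (U i l : ℝ) * q l := by
            intro σ q
            rw [Finset.mul_sum]
            exact Finset.sum_congr rfl fun _ _ => mul_assoc _ _ _
          rcases eq_or_eq_neg_of_abs_eq hi with h | h
          · refine ⟨1, one_ne_zero, fun q hq => ?_⟩
            rw [hs, hs, h, one_mul, one_mul]
            exact hUle q hq i
          · refine ⟨-1, by norm_num, fun q hq => ?_⟩
            rw [hs, hs, h]
            have := hUle _ (hneg q hq) i
            simp only [Pi.neg_apply, mul_neg, Finset.sum_neg_distrib] at this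
            linarith
        obtain ⟨σ, hσ, h1⟩ := hmax i hi
        obtain ⟨τ, hτ, h2⟩ := hmax j hj
        have hne : ∀ (i : Fin 3) (σ : ℝ), σ ≠ 0 → (fun l => σ * (U i l : ℝ)) ≠ 0 := by
          intro i σ hσ h
          have := hinj (Pi.single i σ) (fun j => by
            rw [Finset.sum_eq_single i (fun b _ hb => by simp [hb]) (by simp), Pi.single_eq_same]
            exact congrFun h j)
          have := congrFun this i
          rw [Pi.single_eq_same] at this
          exact hσ this
        obtain ⟨c, hc⟩ := hsm p hp _ _ (hne i σ hσ) (hne j τ hτ) h1 h2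
        have := hinj (Pi.single j τ - Pi.single i (c * σ)) (fun b => by
          have h3 := congrFun hc b
          simp only [Pi.smul_apply, smul_eq_mul] at h3
          simp only [Pi.sub_apply, sub_mul, Finset.sum_sub_distrib]
          rw [Finset.sum_eq_single j (fun b _ hb => by simp [hb]) (by simp), Pi.single_eq_same,
            Finset.sum_eq_single i (fun b _ hb => by simp [hb]) (by simp), Pi.single_eq_same, h3]
          ring)
        have h4 := congrFun this j
        rw [Pi.sub_apply, Pi.single_eq_same, Pi.single_eq_of_ne (Ne.symm hij)] at h4
        exact hτ (by simpa using h4))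
      (by omega)
    exact h.trans (hm p hp q hq r hr)

theorem IsSmoothlySupported.image_transpose {D : Set (Fin 3 → ℝ)} (hD : IsSmoothlySupported D)
    {A : Matrix (Fin 3) (Fin 3) ℝ} (hA : A.det ≠ 0) :
    IsSmoothlySupported (A.transpose.mulVec '' D) := by
  have hadj : ∀ u p : Fin 3 → ℝ, ∑ j, u j * A.transpose.mulVec p j = ∑ j, A.mulVec u j * p j := by
    intro u p
    have := Matrix.dotProduct_mulVec u A.transpose p
    rwa [Matrix.vecMul_transpose] at this
  rintro _ ⟨p, hp, rfl⟩ u v hu hv h1 h2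
  obtain ⟨c, hc⟩ := hD p hp (A.mulVec u) (A.mulVec v)
    (fun h => hu (Matrix.eq_zero_of_mulVec_eq_zero hA h))
    (fun h => hv (Matrix.eq_zero_of_mulVec_eq_zero hA h))
    (fun q hq => by rw [← hadj, ← hadj]; exact h1 _ ⟨q, hq, rfl⟩)
    (fun q hq => by rw [← hadj, ← hadj]; exact h2 _ ⟨q, hq, rfl⟩)
  refine ⟨c, sub_eq_zero.1 (Matrix.eq_zero_of_mulVec_eq_zero hA ?_)⟩
  rw [Matrix.mulVec_sub, Matrix.mulVec_smul, hc, sub_self]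

/-- A compact convex symmetric set whose support function is at least one at the nonzero integer
vectors contains triples of points with determinant close to one half. -/
theorem exists_lt_abs_det3_of_isSmoothlySupported {D : Set (Fin 3 → ℝ)} (hcpt : IsCompact D)
    (hneg : ∀ p ∈ D, -p ∈ D) (hstar : ∀ p ∈ D, ∀ c : ℝ, 0 ≤ c → c ≤ 1 → c • p ∈ D)
    (hsm : IsSmoothlySupported D) {ρ : ℝ} (hρ : 0 < ρ)
    (hball : ∀ q : Fin 3 → ℝ, (∀ i, |q i| ≤ ρ) → q ∈ D)
    (hfeas : ∀ u : Fin 3 → ℤ, u ≠ 0 → ∃ p ∈ D, 1 ≤ ∑ j, (u j : ℝ) * p j)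
    {m : ℝ} (hm : m < 1 / 2) : ∃ p ∈ D, ∃ q ∈ D, ∃ r ∈ D, m < |det3 p q r| := by
  by_contra hcon
  push Not at hcon
  have h0 : (0 : Fin 3 → ℝ) ∈ D := hball 0 fun i => by simpa using hρ.le
  have hm0 : 0 ≤ m := (abs_nonneg _).trans (hcon 0 h0 0 h0 0 h0)
  obtain ⟨R, hR⟩ := hcpt.isBounded.exists_norm_le
  have hR' : ∀ p ∈ D, ∀ i, |p i| ≤ max R 1 := fun p hp i =>
    ((norm_le_pi_norm p i).trans (hR p hp)).trans (le_max_left _ _)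
  set S : Set ℝ := (fun B : Matrix (Fin 3) (Fin 3) ℝ => |B.det|) '' {B | B.det ≠ 0 ∧ IsFeasible D B}
    with hS
  have hone : IsFeasible D 1 := fun u hu => by
    simp only [Matrix.one_mulVec]
    exact hfeas u hu
  have hSne : S.Nonempty := ⟨_, 1, ⟨by simp, hone⟩, rfl⟩
  have hSlb : ∀ x ∈ S, (1 / (3 * max R 1)) ^ 3 ≤ x := by
    rintro _ ⟨B, ⟨hB, hB'⟩, rfl⟩
    exact hB'.le_abs_det (by positivity) hR' hB
  have hSbdd : BddBelow S := ⟨_, hSlb⟩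
  set δ := sInf S with hδ
  have hδ0 : 0 < δ := lt_of_lt_of_le (by positivity) (le_csInf hSne hSlb)
  have hδle : ∀ B : Matrix (Fin 3) (Fin 3) ℝ, B.det ≠ 0 → IsFeasible D B → δ ≤ |B.det| :=
    fun B hB hB' => csInf_le hSbdd ⟨B, ⟨hB, hB'⟩, rfl⟩
  have hδ1 : δ ≤ 1 := by simpa using hδle 1 (by simp) hone
  -- The tolerance g makes both outcomes of `one_half_le_or_le_of_minimal` fail; at g = 0 the
  -- conditions read m < 1/2 and 54m < 27.
  obtain ⟨g, hg0, hg1, hg2⟩ : ∃ g : ℝ, 0 < g ∧ (1 + 2 * g) * m < 1 / 2 ∧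
      2 * ((1 + 2 * g) * m) * (3 + 4 * g / δ) ^ 3 < 27 := by
    have c1 : Continuous fun g : ℝ => (1 + 2 * g) * m := by fun_prop
    have c2 : Continuous fun g : ℝ => 2 * ((1 + 2 * g) * m) * (3 + 4 * g / δ) ^ 3 := by fun_prop
    have e1 : ∀ᶠ g in nhdsWithin (0 : ℝ) (Set.Ioi 0), (1 + 2 * g) * m < 1 / 2 :=
      ((c1.tendsto 0).eventually_lt_const (by simpa using hm)).filter_mono nhdsWithin_le_nhds
    have e2 : ∀ᶠ g in nhdsWithin (0 : ℝ) (Set.Ioi 0),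
        2 * ((1 + 2 * g) * m) * (3 + 4 * g / δ) ^ 3 < 27 :=
      ((c2.tendsto 0).eventually_lt_const (by norm_num; linarith)).filter_mono nhdsWithin_le_nhds
    obtain ⟨g, ⟨h1, h2⟩, h3⟩ := ((e1.and e2).and self_mem_nhdsWithin).exists
    exact ⟨g, h3, h1, h2⟩
  obtain ⟨_, ⟨A₀, ⟨hA₀, hA₀f⟩, rfl⟩, hA₀lt⟩ := exists_lt_of_csInf_lt hSne (show sInf S < δ + g by linarith)
  set F := ∑ i, ∑ j, A₀ i j ^ 2 with hF
  have hF0 : 0 ≤ F := by positivity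
  -- With this weight the penalty of A₀ is at most g. The minimizer A then has |det A| ≤ δ + 2g ≤ 1
  -- + 2g, and its penalty is at most 2g because |det A| ≥ δ.
  set θ := g / (1 + F) with hθ
  have hθ0 : 0 < θ := by positivity
  have hθF : θ * F ≤ g := by
    rw [hθ, div_mul_eq_mul_div, div_le_iff₀ (by positivity)]
    nlinarith
  obtain ⟨A, hAf, hAδ, hAmin⟩ := exists_minimizer_of_isFeasible hcpt hθ0 hA₀f (hδle A₀ hA₀ hA₀f)
  have hA0 : 0 < |A.det| := hδ0.trans_le hAδ
  have hAdet : A.det ≠ 0 := abs_pos.1 hA0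
  have hAsq : 0 ≤ ∑ i, ∑ j, A i j ^ 2 := by positivity
  have hAle := hAmin A₀ hA₀f (hδle A₀ hA₀ hA₀f)
  rw [← hF] at hAle
  simp only at hA₀lt
  have hA1 : θ * ∑ i, ∑ j, A i j ^ 2 ≤ 2 * g := by linarith
  have hA2 : |A.det| ≤ 1 + 2 * g := by nlinarith
  have hadj : ∀ u p : Fin 3 → ℝ, ∑ j, u j * A.transpose.mulVec p j = ∑ j, A.mulVec u j * p j := by
    intro u p
    have := Matrix.dotProduct_mulVec u A.transpose p
    rwa [Matrix.vecMul_transpose] at this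
  have hdet3 : ∀ p q r, det3 (A.transpose.mulVec p) (A.transpose.mulVec q) (A.transpose.mulVec r) =
      A.det * det3 p q r := by
    intro p q r
    rw [det3_eq, det3_eq, Matrix.det_fin_three]
    simp only [Matrix.mulVec, dotProduct, Fin.sum_univ_three, Matrix.transpose_apply]
    ring
  set Q := (A.transpose)⁻¹ with hQ
  have hQA : ∀ q, A.transpose.mulVec (Q.mulVec q) = q := by
    intro q
    rw [Matrix.mulVec_mulVec, hQ, Matrix.mul_nonsing_inv _ (by
      rw [Matrix.det_transpose]; exact isUnit_iff_ne_zero.2 hAdet), Matrix.one_mulVec]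
  set q₁ := 1 + ∑ i, ∑ j, |Q i j| with hq₁
  have hq₁0 : 0 < q₁ := by positivity
  -- A matrix B feasible for AᵀD makes AB feasible for D; dividing the objective by |det A| turns θ
  -- into κ.
  rcases one_half_le_or_le_of_minimal (D := A.transpose.mulVec '' D) (ρ := ρ / q₁)
    (κ := θ / |A.det|) (A := A) (m := (1 + 2 * g) * m)
    (by
      rintro _ ⟨p, hp, rfl⟩
      exact ⟨-p, hneg p hp, Matrix.mulVec_neg _ _⟩)
    (by
      rintro _ ⟨p, hp, rfl⟩ c hc hc1
      exact ⟨c • p, hstar p hp c hc hc1, Matrix.mulVec_smul _ _ _⟩)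
    (hsm.image_transpose hAdet) (by positivity)
    (by
      intro q hq
      refine ⟨Q.mulVec q, hball _ fun i => ?_, hQA q⟩
      calc |Q.mulVec q i| ≤ ∑ j, |Q i j * q j| :=
            Finset.abs_sum_le_sum_abs (fun j => Q i j * q j) Finset.univ
        _ ≤ ∑ j, |Q i j| * (ρ / q₁) := Finset.sum_le_sum fun j _ => by
            rw [abs_mul]
            exact mul_le_mul_of_nonneg_left (hq j) (abs_nonneg _)
        _ = (∑ j, |Q i j|) * (ρ / q₁) := by rw [Finset.sum_mul]
        _ ≤ q₁ * (ρ / q₁) := by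
            refine mul_le_mul_of_nonneg_right ?_ (by positivity)
            have := Finset.single_le_sum (f := fun a => ∑ j, |Q a j|)
                (fun a _ => Finset.sum_nonneg fun j _ => abs_nonneg _) (Finset.mem_univ i)
            linarith
        _ = ρ := by field_simp)
    (by
      intro u hu
      obtain ⟨p, hp, h⟩ := hAf u hu
      exact ⟨_, ⟨p, hp, rfl⟩, by rw [hadj]; exact h⟩)
    (by positivity)
    (by
      intro B hB hBf
      have hAB : IsFeasible D (A * B) := by
        intro u hu
        obtain ⟨_, ⟨p, hp, rfl⟩, h⟩ := hBf u hu
        refine ⟨p, hp, ?_⟩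
        rw [hadj, Matrix.mulVec_mulVec] at h
        exact h
      have hABdet : (A * B).det ≠ 0 := by
        rw [Matrix.det_mul]; exact mul_ne_zero hAdet hB
      have h1 := hAmin _ hAB (hδle _ hABdet hAB)
      rw [Matrix.det_mul, abs_mul] at h1
      rw [← mul_le_mul_iff_right₀ hA0]
      calc _ = |A.det| + θ * ∑ i, ∑ j, A i j ^ 2 := by field_simp
        _ ≤ _ := h1
        _ = _ := by field_simp)
    (by
      rintro _ ⟨p, hp, rfl⟩ _ ⟨q, hq, rfl⟩ _ ⟨r, hr, rfl⟩
      rw [hdet3, abs_mul]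
      exact mul_le_mul hA2 (hcon p hp q hq r hr) (abs_nonneg _) (by positivity)) with h | h
  · linarith
  · have h1 : 2 * (θ / |A.det|) * ∑ i, ∑ j, A i j ^ 2 ≤ 4 * g / δ := by
      calc _ = 2 * (θ * ∑ i, ∑ j, A i j ^ 2) / |A.det| := by ring
        _ ≤ 2 * (2 * g) / δ := by gcongr
        _ = _ := by ring
    have h2 : (3 + 2 * (θ / |A.det|) * ∑ i, ∑ j, A i j ^ 2) ^ 3 ≤ (3 + 4 * g / δ) ^ 3 :=
      pow_le_pow_left₀ (by positivity) (by linarith) 3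
    have h3 := mul_le_mul_of_nonneg_left h2 (show 0 ≤ 2 * ((1 + 2 * g) * m) by positivity)
    linarith

/-! ### Smoothing by a small ball. -/

/-- Equality in Cauchy–Schwarz: with n = |u|, testing b' = u/n gives ⟨u, b⟩ ≥ n, hence |u - nb|² ≤
0. -/
theorem eq_sqrt_smul_of_forall_le {u b : Fin 3 → ℝ} (hu : u ≠ 0) (hb : ∑ j, b j ^ 2 ≤ 1)
    (h : ∀ b' : Fin 3 → ℝ, ∑ j, b' j ^ 2 ≤ 1 → ∑ j, u j * b' j ≤ ∑ j, u j * b j) :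
    0 < Real.sqrt (∑ j, u j ^ 2) ∧ u = Real.sqrt (∑ j, u j ^ 2) • b := by
  have hpos : 0 < ∑ j, u j ^ 2 := by
    obtain ⟨i, hi⟩ := Function.ne_iff.1 hu
    exact Finset.sum_pos' (fun j _ => sq_nonneg _) ⟨i, Finset.mem_univ i, by
      have : u i ≠ 0 := hi
      positivity⟩
  set n := Real.sqrt (∑ j, u j ^ 2) with hn
  have hn0 : 0 < n := Real.sqrt_pos.2 hpos
  have hn2 : n ^ 2 = ∑ j, u j ^ 2 := Real.sq_sqrt hpos.le
  refine ⟨hn0, ?_⟩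
  have h1 := h (n⁻¹ • u) (by
    simp only [Pi.smul_apply, smul_eq_mul, mul_pow, ← Finset.mul_sum]
    rw [← hn2, inv_pow, inv_mul_cancel₀ (by positivity)])
  have h2 : ∑ j, u j * (n⁻¹ • u) j = n := by
    have : ∑ j, u j * (n⁻¹ • u) j = n⁻¹ * ∑ j, u j ^ 2 := by
      rw [Finset.mul_sum]
      exact Finset.sum_congr rfl fun j _ => by simp only [Pi.smul_apply, smul_eq_mul]; ring
    rw [this, ← hn2]
    field_simp
  rw [h2] at h1
  have h3 : ∑ j, (u j - n * b j) ^ 2 = 0 := by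
    refine le_antisymm ?_ (Finset.sum_nonneg fun j _ => sq_nonneg _)
    have : ∑ j, (u j - n * b j) ^ 2 =
        ∑ j, u j ^ 2 - 2 * n * ∑ j, u j * b j + n ^ 2 * ∑ j, b j ^ 2 := by
      simp only [Fin.sum_univ_three]
      ring
    rw [this, ← hn2]
    nlinarith [mul_le_mul_of_nonneg_left h1 hn0.le, mul_le_mul_of_nonneg_left hb (sq_nonneg n)]
  ext j
  have h4 := (Finset.sum_eq_zero_iff_of_nonneg (fun j _ => sq_nonneg (u j - n * b j))).1 h3 j
    (Finset.mem_univ j)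
  have h5 := pow_eq_zero_iff (two_ne_zero) |>.1 h4
  simp only [Pi.smul_apply, smul_eq_mul]
  linarith

/-- A linear form that is maximal at p + εb is maximal at b over the unit ball, so it is a positive
multiple of b. -/
theorem isSmoothlySupported_add_ball (D : Set (Fin 3 → ℝ)) {ε : ℝ} (hε : 0 < ε) :
    IsSmoothlySupported {x | ∃ p ∈ D, ∃ b : Fin 3 → ℝ, ∑ j, b j ^ 2 ≤ 1 ∧ x = p + ε • b} := by
  rintro _ ⟨p, hp, b, hb, rfl⟩ u v hu hv h1 h2
  have key : ∀ u : Fin 3 → ℝ, (∀ q ∈ {x | ∃ p ∈ D, ∃ b : Fin 3 → ℝ, ∑ j, b j ^ 2 ≤ 1 ∧ x = p + ε • b},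
      ∑ j, u j * q j ≤ ∑ j, u j * (p + ε • b) j) →
      ∀ b' : Fin 3 → ℝ, ∑ j, b' j ^ 2 ≤ 1 → ∑ j, u j * b' j ≤ ∑ j, u j * b j := by
    intro u h b' hb'
    have h3 := h _ ⟨p, hp, b', hb', rfl⟩
    have h4 : ∀ b : Fin 3 → ℝ, ∑ j, u j * (p + ε • b) j = ∑ j, u j * p j + ε * ∑ j, u j * b j := by
      intro b
      simp only [Fin.sum_univ_three, Pi.add_apply, Pi.smul_apply, smul_eq_mul]
      ring
    rw [h4, h4] at h3
    exact le_of_mul_le_mul_left (by linarith) hε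
  obtain ⟨hn, hun⟩ := eq_sqrt_smul_of_forall_le hu hb (key u h1)
  obtain ⟨-, hvn⟩ := eq_sqrt_smul_of_forall_le hv hb (key v h2)
  refine ⟨Real.sqrt (∑ j, v j ^ 2) / Real.sqrt (∑ j, u j ^ 2), ?_⟩
  generalize Real.sqrt (∑ j, v j ^ 2) = b' at *
  generalize Real.sqrt (∑ j, u j ^ 2) = a at *
  rw [hun, hvn, smul_smul, div_mul_cancel₀ _ hn.ne']

/-- For ε = ρ(s - 1) the smooth body D + εB lies between D and sD, because ρB ⊆ D. Returning to D
divides determinants by s³, which the choice s³m < 1/2 allows for. -/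
theorem exists_lt_abs_det3 {D : Set (Fin 3 → ℝ)} (hcpt : IsCompact D) (hconv : Convex ℝ D)
    (hneg : ∀ p ∈ D, -p ∈ D) {ρ : ℝ} (hρ : 0 < ρ)
    (hball : ∀ q : Fin 3 → ℝ, (∀ i, |q i| ≤ ρ) → q ∈ D)
    (hfeas : ∀ u : Fin 3 → ℤ, u ≠ 0 → ∃ p ∈ D, 1 ≤ ∑ j, (u j : ℝ) * p j)
    {m : ℝ} (hm : m < 1 / 2) : ∃ p ∈ D, ∃ q ∈ D, ∃ r ∈ D, m < |det3 p q r| := by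
  obtain ⟨s, hs1, hs⟩ : ∃ s : ℝ, 1 < s ∧ s ^ 3 * m < 1 / 2 := by
    have c : Continuous fun s : ℝ => s ^ 3 * m := by fun_prop
    have e : ∀ᶠ s in nhdsWithin (1 : ℝ) (Set.Ioi 1), s ^ 3 * m < 1 / 2 :=
      ((c.tendsto 1).eventually_lt_const (by simpa using hm)).filter_mono nhdsWithin_le_nhds
    obtain ⟨s, h1, h2⟩ := (e.and self_mem_nhdsWithin).exists
    exact ⟨s, h2, h1⟩
  set ε := ρ * (s - 1) with hε
  have hε0 : 0 < ε := mul_pos hρ (by linarith)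
  set B : Set (Fin 3 → ℝ) := {b | ∑ j, b j ^ 2 ≤ 1} with hB
  have hBabs : ∀ b ∈ B, ∀ i, |b i| ≤ 1 := by
    intro b hb i
    have := Finset.single_le_sum (f := fun j => b j ^ 2) (fun _ _ => sq_nonneg _) (Finset.mem_univ i)
    exact abs_le_one_iff_mul_self_le_one.2 (by rw [← sq]; exact this.trans hb)
  have hBcpt : IsCompact B := by
    refine (isCompact_univ_pi fun _ : Fin 3 => isCompact_Icc (a := (-1 : ℝ)) (b := 1)).of_isClosed_subset
      (isClosed_le (by fun_prop) continuous_const) ?_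
    intro b hb i _
    exact abs_le.1 (hBabs b hb i)
  have h0 : (0 : Fin 3 → ℝ) ∈ D := hball 0 fun i => by simpa using hρ.le
  have hstar : ∀ p ∈ D, ∀ c : ℝ, 0 ≤ c → c ≤ 1 → c • p ∈ D := fun p hp c hc hc1 => by
    simpa using hconv hp h0 hc (by linarith : (0 : ℝ) ≤ 1 - c) (by ring)
  set D' : Set (Fin 3 → ℝ) := {x | ∃ p ∈ D, ∃ b : Fin 3 → ℝ, ∑ j, b j ^ 2 ≤ 1 ∧ x = p + ε • b} with hD'
  have hsub : D ⊆ D' := fun p hp => ⟨p, hp, 0, by simp, by simp⟩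
  have hD'cpt : IsCompact D' := by
    have : D' = (fun x : (Fin 3 → ℝ) × (Fin 3 → ℝ) => x.1 + ε • x.2) '' (D ×ˢ B) := by
      ext x
      constructor
      · rintro ⟨p, hp, b, hb, rfl⟩
        exact ⟨(p, b), ⟨hp, hb⟩, rfl⟩
      · rintro ⟨⟨p, b⟩, ⟨hp, hb⟩, rfl⟩
        exact ⟨p, hp, b, hb, rfl⟩
    rw [this]
    exact (hcpt.prod hBcpt).image (by fun_prop)
  have hscale : ∀ x ∈ D', ∃ p ∈ D, x = s • p := by
    rintro _ ⟨p, hp, b, hb, rfl⟩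
    have hb' : ρ • b ∈ D := hball _ fun i => by
      rw [Pi.smul_apply, smul_eq_mul, abs_mul, abs_of_pos hρ]
      exact mul_le_of_le_one_right hρ.le (hBabs b hb i)
    refine ⟨s⁻¹ • p + (1 - s⁻¹) • ρ • b, hconv hp hb' (by positivity)
      (by linarith [inv_le_one_of_one_le₀ hs1.le]) (by ring), ?_⟩
    ext i
    simp only [Pi.add_apply, Pi.smul_apply, smul_eq_mul, hε]
    field_simp
  obtain ⟨x, hx, y, hy, z, hz, h⟩ := exists_lt_abs_det3_of_isSmoothlySupported hD'cpt
    (by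
      rintro _ ⟨p, hp, b, hb, rfl⟩
      exact ⟨-p, hneg p hp, -b, by simpa using hb, by rw [smul_neg, neg_add]⟩)
    (by
      rintro _ ⟨p, hp, b, hb, rfl⟩ c hc hc1
      refine ⟨c • p, hstar p hp c hc hc1, c • b, ?_, ?_⟩
      · simp only [Pi.smul_apply, smul_eq_mul, mul_pow, ← Finset.mul_sum]
        exact mul_le_one₀ (pow_le_one₀ hc hc1) (Finset.sum_nonneg fun _ _ => sq_nonneg _) hb
      · rw [smul_add, smul_comm])
    (isSmoothlySupported_add_ball D hε0) hρ (fun q hq => hsub (hball q hq))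
    (fun u hu => by
      obtain ⟨p, hp, h⟩ := hfeas u hu
      exact ⟨p, hsub hp, h⟩) hs
  obtain ⟨p, hp, rfl⟩ := hscale x hx
  obtain ⟨q, hq, rfl⟩ := hscale y hy
  obtain ⟨r, hr, rfl⟩ := hscale z hz
  refine ⟨p, hp, q, hq, r, hr, ?_⟩
  have h3 : det3 (s • p) (s • q) (s • r) = s ^ 3 * det3 p q r := by
    rw [det3_eq, det3_eq]
    simp only [Pi.smul_apply, smul_eq_mul]
    ring
  have hs3 : 0 < s ^ 3 := by positivity
  rw [h3, abs_mul, abs_of_pos hs3] at h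
  exact lt_of_mul_lt_mul_left h hs3.le

/-! ### The volume inequality. -/

theorem inner_intVec {n : ℕ} (u : Fin n → ℤ) (x : EuclideanSpace ℝ (Fin n)) :
    inner ℝ (intVec u) x = ∑ j, (u j : ℝ) * x j := by
  rw [PiLp.inner_apply]
  exact Finset.sum_congr rfl fun j _ => by simp [intVec, mul_comm]

theorem volume_image_ofLp {n : ℕ} {K : Set (EuclideanSpace ℝ (Fin n))} (hK : IsCompact K) :
    volume (WithLp.ofLp '' K) = volume K := by
  have h : WithLp.ofLp '' K = WithLp.toLp 2 ⁻¹' K := by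
    ext x
    exact ⟨by rintro ⟨y, hy, rfl⟩; exact hy, fun hx => ⟨_, hx, rfl⟩⟩
  rw [h, (PiLp.volume_preserving_toLp (Fin n)).measure_preimage hK.measurableSet.nullMeasurableSet]

theorem one_div_twelve_mul_latticeWidth_pow_le {K : Set (EuclideanSpace ℝ (Fin 3))}
    (hc : Convex ℝ K) (hK : IsCompact K) (hint : (interior K).Nonempty) :
    1 / 12 * latticeWidth K ^ 3 ≤ volume.real K := by
  set w := latticeWidth K with hw
  rcases le_or_gt w 0 with hw0 | hw0
  · have h1 : w ^ 3 ≤ 0 := by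
      rw [pow_succ]
      exact mul_nonpos_of_nonneg_of_nonpos (sq_nonneg w) hw0
    linarith [measureReal_nonneg (μ := volume) (s := K)]
  have hne : K.Nonempty := hint.mono interior_subset
  set K' : Set (Fin 3 → ℝ) := WithLp.ofLp '' K with hK'
  have hK'c : IsCompact K' := hK.image (PiLp.continuous_ofLp 2 _)
  have hK'conv : Convex ℝ K' := hc.linear_image (WithLp.linearEquiv 2 ℝ (Fin 3 → ℝ)).toLinearMap
  have hfin : volume K ≠ ⊤ := hK.measure_lt_top.ne
  set D : Set (Fin 3 → ℝ) := {z | ∃ x ∈ K', ∃ y ∈ K', z = w⁻¹ • (x - y)} with hD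
  have hDc : IsCompact D := by
    have : D = (fun z : (Fin 3 → ℝ) × (Fin 3 → ℝ) => w⁻¹ • (z.1 - z.2)) '' (K' ×ˢ K') := by
      ext z
      constructor
      · rintro ⟨x, hx, y, hy, rfl⟩
        exact ⟨(x, y), ⟨hx, hy⟩, rfl⟩
      · rintro ⟨⟨x, y⟩, ⟨hx, hy⟩, rfl⟩
        exact ⟨x, hx, y, hy, rfl⟩
    rw [this]
    exact (hK'c.prod hK'c).image (by fun_prop)
  have hDconv : Convex ℝ D := by
    rintro _ ⟨x, hx, y, hy, rfl⟩ _ ⟨x', hx', y', hy', rfl⟩ a b ha hb hab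
    refine ⟨a • x + b • x', hK'conv hx hx' ha hb hab, a • y + b • y', hK'conv hy hy' ha hb hab, ?_⟩
    ext i
    simp only [Pi.add_apply, Pi.smul_apply, Pi.sub_apply, smul_eq_mul]
    ring
  obtain ⟨c, hcK⟩ := hint
  obtain ⟨r, hr, hball⟩ : ∃ r > 0, ∀ q : Fin 3 → ℝ, (∀ i, |q i| ≤ r) → c.ofLp + q ∈ K' := by
    have hcont : Continuous fun q : Fin 3 → ℝ => WithLp.toLp 2 (c.ofLp + q) :=
      (PiLp.continuous_toLp 2 _).comp (continuous_const.add continuous_id)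
    have hnhds : (fun q : Fin 3 → ℝ => WithLp.toLp 2 (c.ofLp + q)) ⁻¹' K ∈ nhds 0 := by
      apply hcont.continuousAt
      simpa using mem_interior_iff_mem_nhds.1 hcK
    obtain ⟨r, hr, hb⟩ := Metric.nhds_basis_closedBall.mem_iff.1 hnhds
    refine ⟨r, hr, fun q hq => ⟨_, hb ?_, rfl⟩⟩
    rw [mem_closedBall_zero_iff, pi_norm_le_iff_of_nonneg hr.le]
    exact hq
  have hdet : ∀ m < (1 / 2 : ℝ), ∃ p ∈ D, ∃ q ∈ D, ∃ r ∈ D, m < |det3 p q r| := by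
    intro m hm
    refine exists_lt_abs_det3 hDc hDconv ?_ (ρ := r / w) (by positivity) ?_ ?_ hm
    · rintro _ ⟨x, hx, y, hy, rfl⟩
      exact ⟨y, hy, x, hx, by rw [← smul_neg, neg_sub]⟩
    · intro q hq
      refine ⟨_, hball (w • q) fun i => ?_, _, hball 0 fun i => by simpa using hr.le, ?_⟩
      · rw [Pi.smul_apply, smul_eq_mul, abs_mul, abs_of_pos hw0]
        have := hq i
        rw [le_div_iff₀ hw0] at this
        linarith
      · rw [add_sub_add_left_eq_sub, sub_zero, smul_smul, inv_mul_cancel₀ hw0.ne', one_smul]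
    · intro u hu
      obtain ⟨x, hx, y, hy, hxy⟩ := (widthAlong_isGreatest hK hne u).1
      have hle : w ≤ widthAlong K u := (latticeWidth_isLeast hK ⟨c, hcK⟩).2 ⟨u, hu, rfl⟩
      refine ⟨_, ⟨_, ⟨x, hx, rfl⟩, _, ⟨y, hy, rfl⟩, rfl⟩, ?_⟩
      rw [inner_intVec] at hxy
      have h1 : ∑ j, (u j : ℝ) * (w⁻¹ • (x.ofLp - y.ofLp)) j = w⁻¹ * widthAlong K u := by
        rw [hxy, Finset.mul_sum]
        refine Finset.sum_congr rfl fun j _ => ?_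
        simp only [Pi.smul_apply, Pi.sub_apply, smul_eq_mul, PiLp.sub_apply]
        ring
      rw [h1]
      rw [le_inv_mul_iff₀ hw0]
      linarith
  -- The determinants in D only approach 1/2, so the bound is shown for every t below ω³/12, that
  -- is, for 6t/ω³ < 1/2.
  refine le_of_forall_lt_imp_le_of_dense fun t ht => ?_
  obtain ⟨p, ⟨x₀, hx₀, y₀, hy₀, rfl⟩, q, ⟨x₁, hx₁, y₁, hy₁, rfl⟩, s, ⟨x₂, hx₂, y₂, hy₂, rfl⟩, hlt⟩ :=
    hdet (6 * t / w ^ 3) (by rw [div_lt_iff₀ (by positivity)]; linarith)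
  have hV := ofReal_abs_det_div_six_le_volume hK'c hK'conv (a := ![y₀, y₁, y₂])
    (p := ![x₀ - y₀, x₁ - y₁, x₂ - y₂])
    (by intro i; fin_cases i <;> assumption)
    (by intro i; fin_cases i <;> simpa)
  rw [volume_image_ofLp hK, ENNReal.ofReal_le_iff_le_toReal hfin] at hV
  have h3 : det3 (w⁻¹ • (x₀ - y₀)) (w⁻¹ • (x₁ - y₁)) (w⁻¹ • (x₂ - y₂)) =
      w⁻¹ ^ 3 * det3 (x₀ - y₀) (x₁ - y₁) (x₂ - y₂) := by
    rw [det3_eq, det3_eq]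
    simp only [Pi.smul_apply, smul_eq_mul]
    ring
  have hw3 : 0 < w ^ 3 := by positivity
  rw [h3, abs_mul, abs_of_pos (by positivity), inv_pow, div_lt_iff₀ hw3] at hlt
  have h4 : (w ^ 3)⁻¹ * |det3 (x₀ - y₀) (x₁ - y₁) (x₂ - y₂)| * w ^ 3 =
      |det3 (x₀ - y₀) (x₁ - y₁) (x₂ - y₂)| := by
    field_simp
  rw [h4] at hlt
  have h5 : volume.real K = (volume K).toReal := rfl
  rw [h5]
  have h6 : det3 (x₀ - y₀) (x₁ - y₁) (x₂ - y₂) = (Matrix.of ![x₀ - y₀, x₁ - y₁, x₂ - y₂]).det := rfl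
  rw [h6] at hlt
  linarith

/-! ### The extremal simplex. -/

theorem volume_le_ofReal_integral_of_slices {E : Type*} [MeasureSpace E]
    [SFinite (volume : Measure E)] {S : Set (ℝ × E)} (hS : MeasurableSet S) {s : ℝ} (hs : 0 ≤ s)
    {f : ℝ → ℝ} (hf : Continuous f) (hf0 : ∀ x ∈ Set.Icc 0 s, 0 ≤ f x)
    (hle : ∀ x ∈ Set.Icc 0 s, volume (Prod.mk x ⁻¹' S) ≤ ENNReal.ofReal (f x))
    (hempty : ∀ x ∉ Set.Icc 0 s, Prod.mk x ⁻¹' S = ∅) :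
    volume S ≤ ENNReal.ofReal (∫ x in (0 : ℝ)..s, f x) := by
  have h1 : volume S ≤ ∫⁻ x, (Set.Icc 0 s).indicator (fun x => ENNReal.ofReal (f x)) x := by
    rw [Measure.volume_eq_prod, Measure.prod_apply hS]
    refine lintegral_mono fun x => ?_
    by_cases hx : x ∈ Set.Icc 0 s
    · rw [Set.indicator_of_mem hx]
      exact hle x hx
    · rw [hempty x hx, measure_empty]
      exact zero_le
  rw [lintegral_indicator measurableSet_Icc] at h1
  rw [intervalIntegral.integral_of_le hs, ← integral_Icc_eq_integral_Ioc,
    ofReal_integral_eq_lintegral_ofReal (hf.integrableOn_Icc)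
      ((ae_restrict_iff' measurableSet_Icc).2 (Filter.Eventually.of_forall hf0))]
  exact h1

theorem volume_triangle_le {s : ℝ} (hs : 0 ≤ s) :
    volume {x : ℝ × ℝ | 0 ≤ x.1 ∧ 0 ≤ x.2 ∧ x.1 + x.2 ≤ s} ≤ ENNReal.ofReal (s ^ 2 / 2) := by
  have hm : MeasurableSet {x : ℝ × ℝ | 0 ≤ x.1 ∧ 0 ≤ x.2 ∧ x.1 + x.2 ≤ s} := by
    change MeasurableSet ({x : ℝ × ℝ | 0 ≤ x.1} ∩ ({x | 0 ≤ x.2} ∩ {x | x.1 + x.2 ≤ s}))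
    exact (measurableSet_le (by fun_prop) (by fun_prop)).inter
      ((measurableSet_le (by fun_prop) (by fun_prop)).inter
        (measurableSet_le (by fun_prop) (by fun_prop)))
  have hi : ∫ x in (0 : ℝ)..s, (s - x) = s ^ 2 / 2 := by
    rw [intervalIntegral.integral_sub (by simp) (by simp)]
    simp
    ring
  rw [← hi]
  refine volume_le_ofReal_integral_of_slices hm hs (by fun_prop) (fun x hx => by linarith [hx.2])
    (fun x hx => ?_) (fun x hx => ?_)
  · calc _ ≤ volume (Set.Icc 0 (s - x)) := measure_mono fun y hy => by
          have : 0 ≤ x ∧ 0 ≤ y ∧ x + y ≤ s := hy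
          exact ⟨this.2.1, by linarith⟩
      _ = _ := by rw [Real.volume_Icc, sub_zero]
  · ext y
    simp only [Set.mem_preimage, Set.mem_empty_iff_false, iff_false]
    intro hy
    have : 0 ≤ x ∧ 0 ≤ y ∧ x + y ≤ s := hy
    exact hx ⟨this.1, by linarith⟩

theorem volume_orthogonal_simplex_le :
    volume {x : Fin 3 → ℝ | (∀ i, 0 ≤ x i) ∧ ∑ i, x i ≤ 1} ≤ ENNReal.ofReal (1 / 6) := by
  set S : Set (ℝ × ℝ × ℝ) := {x | 0 ≤ x.1 ∧ 0 ≤ x.2.1 ∧ 0 ≤ x.2.2 ∧ x.1 + x.2.1 + x.2.2 ≤ 1} with hS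
  have hm : MeasurableSet S := by
    change MeasurableSet ({x : ℝ × ℝ × ℝ | 0 ≤ x.1} ∩ ({x | 0 ≤ x.2.1} ∩ ({x | 0 ≤ x.2.2} ∩
      {x | x.1 + x.2.1 + x.2.2 ≤ 1})))
    exact (measurableSet_le (by fun_prop) (by fun_prop)).inter
      ((measurableSet_le (by fun_prop) (by fun_prop)).inter
        ((measurableSet_le (by fun_prop) (by fun_prop)).inter
          (measurableSet_le (by fun_prop) (by fun_prop))))
  have hpre : {x : Fin 3 → ℝ | (∀ i, 0 ≤ x i) ∧ ∑ i, x i ≤ 1} = tripleEquiv ⁻¹' S := by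
    ext x
    simp only [Set.mem_preimage, tripleEquiv_apply, hS, Set.mem_ofPred_eq, Fin.forall_fin_succ,
      Fin.sum_univ_three]
    simp [and_assoc]
  rw [hpre, volume_preserving_tripleEquiv.measure_preimage hm.nullMeasurableSet]
  have hi : ∫ x in (0 : ℝ)..1, (1 - x) ^ 2 / 2 = 1 / 6 := by
    rw [intervalIntegral.integral_div, intervalIntegral.integral_comp_sub_left (fun x => x ^ 2)]
    simp
    norm_num
  rw [← hi]
  refine volume_le_ofReal_integral_of_slices hm zero_le_one (by fun_prop) (fun x hx => by positivity)
    (fun x hx => ?_) (fun x hx => ?_)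
  · refine le_trans (measure_mono fun y hy => ?_) (volume_triangle_le (by linarith [hx.2]))
    have : 0 ≤ x ∧ 0 ≤ y.1 ∧ 0 ≤ y.2 ∧ x + y.1 + y.2 ≤ 1 := hy
    exact ⟨this.2.1, this.2.2.1, by linarith⟩
  · ext y
    simp only [Set.mem_preimage, Set.mem_empty_iff_false, iff_false]
    intro hy
    have : 0 ≤ x ∧ 0 ≤ y.1 ∧ 0 ≤ y.2 ∧ x + y.1 + y.2 ≤ 1 := hy
    exact hx ⟨this.1, by linarith⟩

/-- The simplex with vertices `0`, `(1, 1/2, 1/2)`, `(1/2, 1, 1/2)` and `(1/2, 1/2, 1)`. -/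
def halfSimplex : Set (EuclideanSpace ℝ (Fin 3)) :=
  convexHull ℝ {!₂[0, 0, 0], !₂[1, 1 / 2, 1 / 2], !₂[1 / 2, 1, 1 / 2], !₂[1 / 2, 1 / 2, 1]}

theorem isCompact_halfSimplex : IsCompact halfSimplex := by
  refine Set.Finite.isCompact_convexHull ℝ ?_
  simp

theorem vertex_mem_halfSimplex (i : Fin 4) :
    (![!₂[0, 0, 0], !₂[1, 1 / 2, 1 / 2], !₂[1 / 2, 1, 1 / 2], !₂[1 / 2, 1 / 2, 1]] :
      Fin 4 → EuclideanSpace ℝ (Fin 3)) i ∈ halfSimplex := by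
  apply subset_convexHull
  fin_cases i <;> simp

/-- Edge vectors have half-integral products with u. If all were below 1 in absolute value, then |u
i + s| ≤ 1 and |u i - u j| ≤ 1 with s = u 0 + u 1 + u 2. Summing the former gives |4s| ≤ 3, so s =
0; entries in {-1, 0, 1} without opposite signs and with sum 0 all vanish. -/
theorem one_le_widthAlong_halfSimplex {u : Fin 3 → ℤ} (hu : u ≠ 0) :
    1 ≤ widthAlong halfSimplex u := by
  have hg := (widthAlong_isGreatest isCompact_halfSimplex ⟨_, vertex_mem_halfSimplex 0⟩ u).2
  by_contra hlt
  push Not at hlt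
  have key : ∀ i j : Fin 4, inner ℝ (intVec u)
      ((![!₂[0, 0, 0], !₂[1, 1 / 2, 1 / 2], !₂[1 / 2, 1, 1 / 2], !₂[1 / 2, 1 / 2, 1]] :
        Fin 4 → EuclideanSpace ℝ (Fin 3)) i -
      (![!₂[0, 0, 0], !₂[1, 1 / 2, 1 / 2], !₂[1 / 2, 1, 1 / 2], !₂[1 / 2, 1 / 2, 1]] :
        Fin 4 → EuclideanSpace ℝ (Fin 3)) j) < (1 : ℝ) := fun i j =>
    (hg ⟨_, vertex_mem_halfSimplex i, _, vertex_mem_halfSimplex j, rfl⟩).trans_lt hlt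
  simp only [inner_intVec, Fin.sum_univ_three] at key
  have k01 := key 0 1
  have k10 := key 1 0
  have k02 := key 0 2
  have k20 := key 2 0
  have k03 := key 0 3
  have k30 := key 3 0
  have k12 := key 1 2
  have k21 := key 2 1
  have k13 := key 1 3
  have k31 := key 3 1
  have k23 := key 2 3
  have k32 := key 3 2
  simp at k01 k10 k02 k20 k03 k30 k12 k21 k13 k31 k23 k32
  have c10 : (2 * u 0 + u 1 + u 2 : ℝ) < 2 := by linarith
  have c01 : (-2 : ℝ) < 2 * u 0 + u 1 + u 2 := by linarith
  have c20 : (u 0 + 2 * u 1 + u 2 : ℝ) < 2 := by linarith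
  have c02 : (-2 : ℝ) < u 0 + 2 * u 1 + u 2 := by linarith
  have c30 : (u 0 + u 1 + 2 * u 2 : ℝ) < 2 := by linarith
  have c03 : (-2 : ℝ) < u 0 + u 1 + 2 * u 2 := by linarith
  have c12 : (u 0 - u 1 : ℝ) < 2 := by linarith
  have c21 : (u 1 - u 0 : ℝ) < 2 := by linarith
  have c13 : (u 0 - u 2 : ℝ) < 2 := by linarith
  have c31 : (u 2 - u 0 : ℝ) < 2 := by linarith
  have c23 : (u 1 - u 2 : ℝ) < 2 := by linarith
  have c32 : (u 2 - u 1 : ℝ) < 2 := by linarith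
  norm_cast at c10 c01 c20 c02 c30 c03 c12 c21 c13 c31 c23 c32
  apply hu
  ext i
  have h0 : u 0 = 0 := by omega
  have h1 : u 1 = 0 := by omega
  have h2 : u 2 = 0 := by omega
  fin_cases i <;> assumption

/-- The first coordinate vector attains the bound, as 0 ≤ x 0 ≤ 1 on the simplex. -/
theorem latticeWidth_halfSimplex : latticeWidth halfSimplex = 1 := by
  have hne : (fun i => if i = 0 then 1 else 0 : Fin 3 → ℤ) ≠ 0 := fun h => by
    simpa using congrFun h 0
  refine le_antisymm ?_ (le_csInf (Set.Nonempty.image _ ⟨_, hne⟩) ?_)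
  · refine (csInf_le ⟨1, ?_⟩ (Set.mem_image_of_mem _ hne)).trans ?_
    · rintro _ ⟨u, hu, rfl⟩
      exact one_le_widthAlong_halfSimplex hu
    · obtain ⟨x, hx, y, hy, h⟩ := (widthAlong_isGreatest isCompact_halfSimplex
        ⟨_, vertex_mem_halfSimplex 0⟩ (fun i => if i = 0 then 1 else 0)).1
      have hbox : halfSimplex ⊆ {x | 0 ≤ x 0 ∧ x 0 ≤ 1} := by
        refine convexHull_min ?_ ?_
        · rintro x (rfl | rfl | rfl | rfl) <;> constructor <;> simp <;> norm_num
        · have hl : IsLinearMap ℝ fun x : EuclideanSpace ℝ (Fin 3) => x 0 :=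
            ⟨fun _ _ => rfl, fun _ _ => rfl⟩
          exact (convex_halfSpace_ge hl 0).inter (convex_halfSpace_le hl 1)
      rw [h, inner_intVec]
      have h1 := hbox hx
      have h2 := hbox hy
      simp
      linarith [h1.2, h2.1]
  · rintro _ ⟨u, hu, rfl⟩
    exact one_le_widthAlong_halfSimplex hu

/-- The simplex lies in the image of the orthogonal simplex under M, of determinant 1/2, which
bounds the volume above. The three edges at the origin, used as chords, give the same bound from
below. -/
theorem volume_halfSimplex : volume halfSimplex = ENNReal.ofReal (1 / 12) := by
  set M : Matrix (Fin 3) (Fin 3) ℝ := !![1, 1 / 2, 1 / 2; 1 / 2, 1, 1 / 2; 1 / 2, 1 / 2, 1] with hM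
  have hdet : M.det = 1 / 2 := by
    rw [hM, Matrix.det_fin_three]
    simp
    norm_num
  rw [← volume_image_ofLp isCompact_halfSimplex]
  refine le_antisymm ?_ ?_
  · set T : Set (Fin 3 → ℝ) := {x | (∀ i, 0 ≤ x i) ∧ ∑ i, x i ≤ 1} with hT
    have hTc : Convex ℝ T := by
      rintro x ⟨hx, hx1⟩ y ⟨hy, hy1⟩ a b ha hb hab
      refine ⟨fun i => add_nonneg (mul_nonneg ha (hx i)) (mul_nonneg hb (hy i)), ?_⟩
      simp only [Pi.add_apply, Pi.smul_apply, smul_eq_mul, Finset.sum_add_distrib, ← Finset.mul_sum]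
      nlinarith
    have hsub : WithLp.ofLp '' halfSimplex ⊆ Matrix.toLin' M '' T := by
      rw [Set.image_subset_iff]
      refine convexHull_min ?_ ((hTc.linear_image (Matrix.toLin' M)).linear_preimage
        (WithLp.linearEquiv 2 ℝ (Fin 3 → ℝ)).toLinearMap)
      rintro x (rfl | rfl | rfl | rfl)
      · exact ⟨![0, 0, 0], ⟨by simp [Fin.forall_fin_succ], by simp [Fin.sum_univ_three]⟩, by
          ext i; fin_cases i <;> simp [hM, Matrix.mulVec, dotProduct, Fin.sum_univ_three]⟩
      · exact ⟨![1, 0, 0], ⟨by simp [Fin.forall_fin_succ], by simp [Fin.sum_univ_three]⟩, by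
          ext i; fin_cases i <;> simp [hM, Matrix.mulVec, dotProduct, Fin.sum_univ_three]⟩
      · exact ⟨![0, 1, 0], ⟨by simp [Fin.forall_fin_succ], by simp [Fin.sum_univ_three]⟩, by
          ext i; fin_cases i <;> simp [hM, Matrix.mulVec, dotProduct, Fin.sum_univ_three]⟩
      · exact ⟨![0, 0, 1], ⟨by simp [Fin.forall_fin_succ], by simp [Fin.sum_univ_three]⟩, by
          ext i; fin_cases i <;> simp [hM, Matrix.mulVec, dotProduct, Fin.sum_univ_three]⟩
    refine (measure_mono hsub).trans ?_
    rw [Measure.addHaar_image_linearMap, LinearMap.det_toLin', hdet]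
    refine (mul_le_mul_right volume_orthogonal_simplex_le _).trans ?_
    rw [← ENNReal.ofReal_mul (abs_nonneg _)]
    refine ENNReal.ofReal_le_ofReal ?_
    rw [abs_of_pos (by norm_num)]
    norm_num
  · have h := ofReal_abs_det_div_six_le_volume (K := WithLp.ofLp '' halfSimplex)
      (isCompact_halfSimplex.image (PiLp.continuous_ofLp 2 _))
      ((convex_convexHull ℝ _).linear_image (WithLp.linearEquiv 2 ℝ (Fin 3 → ℝ)).toLinearMap)
      (a := 0) (p := M)
      (fun i => ⟨_, vertex_mem_halfSimplex 0, by ext i; fin_cases i <;> rfl⟩)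
      (fun i => ⟨_, vertex_mem_halfSimplex i.succ, by
        ext j; fin_cases i <;> fin_cases j <;> simp [hM]⟩)
    have h2 : Matrix.of (M : Fin 3 → Fin 3 → ℝ) = M := rfl
    rw [h2, hdet] at h
    refine le_trans (ENNReal.ofReal_le_ofReal ?_) h
    rw [abs_of_pos (by norm_num)]
    norm_num

theorem corollary2 :
    (∀ K : Set (EuclideanSpace ℝ (Fin 3)),
      Convex ℝ K → IsCompact K → (interior K).Nonempty →
        volume.real K ≥ 1 / 12 * latticeWidth K ^ 3) ∧
    (∀ K : Set (EuclideanSpace ℝ (Fin 3)),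
      K = convexHull ℝ
        {!₂[0, 0, 0], !₂[1, 1 / 2, 1 / 2], !₂[1 / 2, 1, 1 / 2], !₂[1 / 2, 1 / 2, 1]} →
        volume.real K = 1 / 12 * latticeWidth K ^ 3) := by
  refine ⟨fun K hc hK hint => one_div_twelve_mul_latticeWidth_pow_le hc hK hint, ?_⟩
  intro K hK
  have hK' : K = halfSimplex := hK
  rw [hK', latticeWidth_halfSimplex, Measure.real, volume_halfSimplex,
    ENNReal.toReal_ofReal (by norm_num)]
  norm_num
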